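/- Let $\mathcal A$ be a (possibly non-unital) $C^*$-algebra, $\mathcal B$ a unital $C^*$-algebra, $V$ a right $\mathcal A$-module (a complex vector space with compatible right $\mathcal A$-action), $G$ a group, $U$ a representation of $G$ on $V$ by $\mathcal A$-linear bijections, and $g\mapsto\beta_g$ a homomorphism of $G$ into the group of $*$-automorphisms of $\mathcal B$. An $\mathcal A$-sesquilinear form on $V$ is a map $s:V\times V\to\mathcal A$ that is conjugate-linear in the first and linear in the second variable and satisfies $s(u,va)=s(u,v)a$, $s(ua,v)=a^*s(u,v)$; let $S_{\mathcal A}(V)$ be the space of these forms. A linear map $S:\mathcal B\to S_{\mathcal A}(V)$, $b\mapsto S_b$, belongs to $\mathbf{CP}_\beta^U$ if $\sum_{j,k=1}^nS_{b_j^*b_k}(v_j,v_k)\ge0$ for all $n$, $b_j\in\mathcal B$, $v_j\in V$, and $S_{\beta_g(b)}(v,w)=S_b(U(g^{-1})v,U(g^{-1})w)$ for all $g,b,v,w$. For a Hilbert $\mathcal A$-module $M$ let $\mathcal L_{\mathcal A}(M)$ be the $C^*$-algebra of its adjointable bounded $\mathcal A$-linear operators and $\mathcal U_{\mathcal A}(M)$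 its unitary group; $M$ is self-dual if every bounded $\mathcal A$-linear map $M\to\mathcal A$ is of the form $\langle m|\cdot\rangle$ with $m\in M$. For a quadruple $(M,\pi,J,\tilde U)$ of a Hilbert $\mathcal A$-module $M$, a unital $*$-homomorphism $\pi:\mathcal B\to\mathcal L_{\mathcal A}(M)$, an $\mathcal A$-linear map $J:V\to M$ and a group homomorphism $\tilde U:G\to\mathcal U_{\mathcal A}(M)$ consider (i) $S_b(v,w)=\langle Jv|\pi(b)Jw\rangle$ for all $b\in\mathcal B$, $v,w\in V$; (ii) the complex linear span of $\{\pi(b)Jv : b\in\mathcal B,\ v\in V\}$ is norm dense in $M$; (iii) $JU(g)=\tilde U(g)J$ for all $g\in G$; (iv) $\tilde U(g)\pi(b)=\pi(\beta_g(b))\tilde U(g)$ for all $g\in G$, $b\in\mathcal B$. (a) For every $S\in\mathbf{CP}_\beta^U$ there is a quadruple satisfying (i)–(iv). If $(M,\pi,J,\tilde U)$ and $(M',\pi',J',\tilde U')$ both satisfy (i)–(iv), there is a unitary $\mathcal A$-linear map $W:M\to M'$ with $WJ=J'$, $W\pi(b)=\pi'(b)W$ and $W\tilde U(g)=\tilde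 U'(g)W$ for all $b\in\mathcal B$, $g\in G$. (b) Suppose that $\mathcal A$ is a $W^*$-algebra. For a self-dual Hilbert $\mathcal A$-module $L$ let $\tau_1$ be the topology given by the seminorms $\ell\mapsto\varphi(\langle\ell|\ell\rangle)^{1/2}$ and $\tau_2$ the one given by the seminorms $\ell\mapsto|\varphi(\langle\ell'|\ell\rangle)|$, where $\varphi$ runs over the normal positive functionals on $\mathcal A$ and $\ell'$ over $L$. For every $S\in\mathbf{CP}_\beta^U$ there is a quadruple $(L,\pi,J,\tilde U)$ with $L$ self-dual that satisfies (i), (iii), (iv) and for which the span in (ii) is both $\tau_1$-dense and $\tau_2$-dense in $L$. Any two quadruples with self-dual modules that satisfy (i), (iii), (iv) and whose spans are $\tau_1$-dense or $\tau_2$-dense are unitarily equivalent as in (a). (c) Suppose that $\mathcal A$ and $\mathcal B$ are $W^*$-algebras, $S\in\mathbf{CP}_\beta^U$, and $(L,\pi,J,\tilde U)$ is as in (b): $L$ is self-dual, (i), (iii), (iv) hold and the span in (ii) is $\tau_1$-dense or $\tau_2$-dense. Then $b\mapsto S_b(v,v)$ is normal for every $v\in V$ if and only if $\pi:\mathcal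 B\to\mathcal L_{\mathcal A}(L)$ is normal. Here a positive linear map is normal if it preserves the suprema of bounded increasing nets of self-adjoint elements. (d) If a quadruple $(M,\pi,J,\tilde U)$ satisfies (iii) and (iv), then (i) defines an element $S$ of $\mathbf{CP}_\beta^U$. -/

import Mathlib

open scoped RightActions ComplexOrder

noncomputable section

/-! ### Right modules over a (possibly non-unital) C⋆-algebra -/

/-- A complex vector space `V` with a compatible right action `v <• a` of a possibly non-unital
complex algebra `A`. (If `A` has a unit, it is not required to act as the identity.) -/
class RightModule (A V : Type*) [NonUnitalRing A] [Module ℂ A] [AddCommGroup V] [Module ℂ V]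
    extends SMul Aᵐᵒᵖ V where
  add_rsmul (v w : V) (a : A) : (v + w) <• a = v <• a + w <• a
  rsmul_add (v : V) (a b : A) : v <• (a + b) = v <• a + v <• b
  rsmul_mul (v : V) (a b : A) : v <• (a * b) = (v <• a) <• b
  smul_rsmul (c : ℂ) (v : V) (a : A) : (c • v) <• a = c • (v <• a)
  rsmul_smul (c : ℂ) (v : V) (a : A) : v <• (c • a) = c • (v <• a)

section Linear

variable (A V W : Type*) [NonUnitalRing A] [Module ℂ A] [AddCommGroup V] [Module ℂ V]
  [RightModule A V] [AddCommGroup W] [Module ℂ W] [RightModule A W]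

/-- `Lin_A(V; W)`: the `A`-linear maps. -/
structure RightLinearMap extends V →ₗ[ℂ] W where
  map_rsmul (v : V) (a : A) : toFun (v <• a) = toFun v <• a

instance : CoeFun (RightLinearMap A V W) (fun _ => V → W) := ⟨fun L => L.toLinearMap⟩

/-- `GL_A(V)`: the group of `A`-linear bijections of `V`. -/
def rightGL : Subgroup (V ≃ₗ[ℂ] V) where
  carrier := {T | ∀ (v : V) (a : A), T (v <• a) = T v <• a}
  one_mem' := fun _ _ => rfl
  mul_mem' := fun {S T} hS hT v a => by
    change S (T (v <• a)) = S (T v) <• a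
    rw [hT, hS]
  inv_mem' := fun {T} hT v a => by
    change T.symm (v <• a) = T.symm v <• a
    rw [LinearEquiv.symm_apply_eq, hT, LinearEquiv.apply_symm_apply]

end Linear

/-! ### Sesquilinear forms and Hilbert modules -/

section Sesq

variable (A V : Type*) [NonUnitalCStarAlgebra A] [AddCommGroup V] [Module ℂ V] [RightModule A V]

/-- `A`-valued sesquilinear forms, conjugate linear in the first variable. -/
structure IsSesquilinearForm (s : V → V → A) : Prop where
  right_linear (u v w : V) (c : ℂ) : s u (v + c • w) = s u v + c • s u w
  left_conj_linear (u v w : V) (c : ℂ) : s (v + c • w) u = s v u + star c • s w u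
  right_rsmul (u v : V) (a : A) : s u (v <• a) = s u v * a
  left_rsmul (u v : V) (a : A) : s (u <• a) v = star a * s u v

/-- `S_A(V)`: the vector space of `A`-sesquilinear forms on `V`. -/
def sesqForms : Submodule ℂ (V → V → A) where
  carrier := {s | IsSesquilinearForm A V s}
  zero_mem' := by constructor <;> intros <;> simp
  add_mem' := fun {s t} hs ht => by
    constructor <;> intros <;> simp only [Pi.add_apply]
    · rw [hs.right_linear, ht.right_linear, smul_add]; abel
    · rw [hs.left_conj_linear, ht.left_conj_linear, smul_add]; abel
    · rw [hs.right_rsmul, ht.right_rsmul, add_mul]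
    · rw [hs.left_rsmul, ht.left_rsmul, mul_add]
  smul_mem' := fun z s hs => by
    constructor <;> intros <;> simp only [Pi.smul_apply]
    · rw [hs.right_linear, smul_add, smul_comm]
    · rw [hs.left_conj_linear, smul_add, smul_comm]
    · rw [hs.right_rsmul, smul_mul_assoc]
    · rw [hs.left_rsmul, mul_smul_comm]

instance : CoeFun (sesqForms A V) (fun _ => V → V → A) := ⟨fun s => s.1⟩

end Sesq

/-- A (right) Hilbert `A`-module: a right `A`-module with an `A`-valued inner product, complete
for the norm `‖x‖ = √‖⟨x | x⟩‖`. -/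
class HilbertModule (A M : Type*) [NonUnitalCStarAlgebra A] [PartialOrder A]
    [NormedAddCommGroup M] [NormedSpace ℂ M] extends RightModule A M, Inner A M where
  sesquilinear : IsSesquilinearForm A M (fun x y => inner x y)
  inner_self_nonneg (x : M) : 0 ≤ inner x x
  eq_zero_of_inner_self (x : M) : inner x x = 0 → x = 0
  norm_eq (x : M) : ‖x‖ = √‖inner x x‖
  complete : CompleteSpace M

section Operators

variable (A M : Type*) [NonUnitalCStarAlgebra A] [PartialOrder A] [NormedAddCommGroup M]
  [NormedSpace ℂ M] [HilbertModule A M]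

/-- `M` is self-dual: every bounded `A`-linear map `M → A` is of the form `⟨m | ·⟩`. -/
def IsSelfDual : Prop :=
  ∀ f : M →L[ℂ] A, (∀ (x : M) (a : A), f (x <• a) = f x * a) →
    ∃ m : M, ∀ x : M, f x = inner A m x

variable {A M} in
lemma HilbertModule.ext_left {x y : M} (h : ∀ z : M, inner A x z = inner A y z) : x = y := by
  have hs := HilbertModule.sesquilinear (A := A) (M := M)
  have key : ∀ z : M, inner A (x - y) z = 0 := fun z => by
    have := hs.left_conj_linear z x y (-1)
    simp only [neg_smul, one_smul, star_neg, star_one] at this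
    rw [← sub_eq_add_neg] at this
    rw [this, h z, add_neg_cancel]
  exact sub_eq_zero.1 (HilbertModule.eq_zero_of_inner_self (A := A) _ (key _))

/-- `T'` is an adjoint of `T`. -/
def IsAdjointOf {A M : Type*} [NonUnitalCStarAlgebra A] [PartialOrder A] [NormedAddCommGroup M]
    [NormedSpace ℂ M] [HilbertModule A M] (T' T : M →L[ℂ] M) : Prop :=
  ∀ x y : M, inner A x (T y) = inner A (T' x) y

variable {A M} in
lemma HilbertModule.inner_add_right' (x y z : M) :
    inner A x (y + z) = inner A x y + inner A x z := by
  have := (HilbertModule.sesquilinear (A := A) (M := M)).right_linear x y z 1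
  simpa using this

variable {A M} in
lemma HilbertModule.inner_zero_right' (x : M) : inner A x (0 : M) = 0 := by
  have := HilbertModule.inner_add_right' (A := A) x 0 0
  simpa using this

variable {A M} in
lemma HilbertModule.inner_add_left' (x y z : M) :
    inner A (x + y) z = inner A x z + inner A y z := by
  have := (HilbertModule.sesquilinear (A := A) (M := M)).left_conj_linear z x y 1
  simpa using this

variable {A M} in
lemma HilbertModule.inner_zero_left' (x : M) : inner A (0 : M) x = 0 := by
  have := HilbertModule.inner_add_left' (A := A) 0 0 x
  simpa using this

variable {A M} in
lemma HilbertModule.inner_smul_right' (c : ℂ) (x y : M) :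
    inner A x (c • y) = c • inner A x y := by
  have := (HilbertModule.sesquilinear (A := A) (M := M)).right_linear x 0 y c
  simpa [HilbertModule.inner_zero_right'] using this

variable {A M} in
lemma HilbertModule.inner_smul_left' (c : ℂ) (x y : M) :
    inner A (c • x) y = star c • inner A x y := by
  have := (HilbertModule.sesquilinear (A := A) (M := M)).left_conj_linear y 0 x c
  simpa [HilbertModule.inner_zero_left'] using this

variable {A M} in
lemma HilbertModule.star_inner' [StarOrderedRing A] (x y : M) :
    star (inner A x y) = inner A y x := by
  have hsa : ∀ z : M, star (inner A z z) = inner A z z := fun z =>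
    (HilbertModule.inner_self_nonneg (A := A) z).isSelfAdjoint.star_eq
  have h1 := hsa (x + y)
  have h2 := congrArg (Complex.I • ·) (hsa (x + Complex.I • y))
  simp only [HilbertModule.inner_add_left', HilbertModule.inner_add_right',
    HilbertModule.inner_smul_left', HilbertModule.inner_smul_right', star_add, star_smul,
    hsa, smul_add, smul_smul, RCLike.star_def, Complex.conj_I, neg_neg, smul_neg,
    Complex.I_mul_I, star_neg, one_smul, neg_smul] at h1 h2
  linear_combination (norm := module) (1 / 2 : ℂ) • h1 + (1 / 2 : ℂ) • h2

/-- `L_A(M)`: the algebra of adjointable bounded `A`-linear operators on `M`. -/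
def adjointable : Subalgebra ℂ (M →L[ℂ] M) where
  carrier := {T | (∀ (x : M) (a : A), T (x <• a) = T x <• a) ∧
    ∃ T' : M →L[ℂ] M, (∀ (x : M) (a : A), T' (x <• a) = T' x <• a) ∧
      IsAdjointOf (A := A) T' T}
  mul_mem' := by
    rintro S T ⟨hS, S', hS', hSS'⟩ ⟨hT, T', hT', hTT'⟩
    refine ⟨fun x a => ?_, T' * S', fun x a => ?_, fun x y => ?_⟩
    · change S (T (x <• a)) = S (T x) <• a
      rw [hT, hS]
    · change T' (S' (x <• a)) = T' (S' x) <• a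
      rw [hS', hT']
    · change inner A x (S (T y)) = inner A (T' (S' x)) y
      rw [hSS', hTT']
  add_mem' := by
    rintro S T ⟨hS, S', hS', hSS'⟩ ⟨hT, T', hT', hTT'⟩
    refine ⟨fun x a => ?_, S' + T', fun x a => ?_, fun x y => ?_⟩
    · simp only [_root_.add_apply, hT, hS, RightModule.add_rsmul]
    · simp only [_root_.add_apply, hT', hS', RightModule.add_rsmul]
    · simp only [_root_.add_apply, HilbertModule.inner_add_left',
        HilbertModule.inner_add_right']
      rw [hSS', hTT']
  algebraMap_mem' := by
    intro c
    refine ⟨fun x a => ?_, algebraMap ℂ (M →L[ℂ] M) (star c), fun x a => ?_, fun x y => ?_⟩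
    · simp only [ContinuousLinearMap.algebraMap_apply, RightModule.smul_rsmul]
    · simp only [ContinuousLinearMap.algebraMap_apply, RightModule.smul_rsmul]
    · simp only [ContinuousLinearMap.algebraMap_apply, HilbertModule.inner_smul_left',
        HilbertModule.inner_smul_right', star_star]

variable {A M} in
lemma IsAdjointOf.unique {S S' T : M →L[ℂ] M} (h : IsAdjointOf (A := A) S T)
    (h' : IsAdjointOf (A := A) S' T) : S = S' := by
  ext x
  exact HilbertModule.ext_left (A := A) fun z => by rw [← h, ← h']

variable {A M} in
lemma IsAdjointOf.symm [StarOrderedRing A] {S T : M →L[ℂ] M} (h : IsAdjointOf (A := A) S T) :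
    IsAdjointOf (A := A) T S := fun x y => by
  rw [← HilbertModule.star_inner' (S y) x, ← h y x, HilbertModule.star_inner']

/-- The involution of `L_A(M)` is the adjoint (which is unique, see `IsAdjointOf.unique`). -/
instance [StarOrderedRing A] : Star (adjointable A M) where
  star T := ⟨T.2.2.choose, T.2.2.choose_spec.1, T.1, T.2.1, T.2.2.choose_spec.2.symm⟩

variable {A M} in
lemma adjointable.isAdjointOf_star [StarOrderedRing A] (T : adjointable A M) :
    IsAdjointOf (A := A) (star T).1 T.1 := T.2.2.choose_spec.2

instance [StarOrderedRing A] : StarRing (adjointable A M) where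
  star_involutive T := Subtype.ext <|
    (adjointable.isAdjointOf_star (star T)).unique (adjointable.isAdjointOf_star T).symm
  star_mul S T := Subtype.ext <| (adjointable.isAdjointOf_star (S * T)).unique fun x y => by
    change inner A x (S.1 (T.1 y)) = inner A ((star T).1 ((star S).1 x)) y
    rw [adjointable.isAdjointOf_star S, adjointable.isAdjointOf_star T]
  star_add S T := Subtype.ext <| (adjointable.isAdjointOf_star (S + T)).unique fun x y => by
    change inner A x (S.1 y + T.1 y) = inner A ((star S).1 x + (star T).1 x) y
    rw [HilbertModule.inner_add_right', HilbertModule.inner_add_left',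
      adjointable.isAdjointOf_star S, adjointable.isAdjointOf_star T]

/-- The order of the C⋆-algebra `L_A(M)`: `S ≤ T` iff `T - S` is of the form `R⋆R`. -/
instance [StarOrderedRing A] : LE (adjointable A M) where
  le S T := ∃ R : adjointable A M, T - S = star R * R

end Operators

/-- Unitary maps between Hilbert `A`-modules: `A`-linear bijections preserving the inner product. -/
structure HilbertUnitary (A M M' : Type*) [NonUnitalCStarAlgebra A] [PartialOrder A]
    [NormedAddCommGroup M] [NormedSpace ℂ M] [HilbertModule A M]
    [NormedAddCommGroup M'] [NormedSpace ℂ M'] [HilbertModule A M'] extends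
    RightLinearMap A M M' where
  bijective : Function.Bijective toFun
  inner_map (x y : M) : inner A (toFun x) (toFun y) = inner A x y

instance (A M M' : Type*) [NonUnitalCStarAlgebra A] [PartialOrder A]
    [NormedAddCommGroup M] [NormedSpace ℂ M] [HilbertModule A M]
    [NormedAddCommGroup M'] [NormedSpace ℂ M'] [HilbertModule A M'] :
    CoeFun (HilbertUnitary A M M') (fun _ => M → M') := ⟨fun W => W.toRightLinearMap⟩

/-! ### Normality and the topologies `τ₁`, `τ₂` -/

/-- A (positive linear) map is normal if it preserves suprema of bounded increasing nets of
self-adjoint elements; the range of such a net is a directed set. -/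
def IsNormalMap {R T : Type*} [Star R] [LE R] [LE T] (f : R → T) : Prop :=
  ∀ D : Set R, D.Nonempty → DirectedOn (· ≤ ·) D → (∀ d ∈ D, IsSelfAdjoint d) →
    ∀ x : R, IsLUB D x → IsLUB (f '' D) (f x)

/-- The positive cone of the predual of a W⋆-algebra: the normal positive linear functionals. -/
def predualCone (A : Type*) [CStarAlgebra A] [PartialOrder A] [StarOrderedRing A] :
    Set (A →ₚ[ℂ] ℂ) :=
  {φ | IsNormalMap φ}

section Topologies

variable (A L : Type*) [CStarAlgebra A] [PartialOrder A] [StarOrderedRing A]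
  [NormedAddCommGroup L] [NormedSpace ℂ L] [HilbertModule A L]

/-- The topology given by the seminorms `x ↦ √φ(⟨x | x⟩)`, `φ` a normal positive functional:
it is generated by the open balls of these seminorms. -/
@[reducible] def tau1 : TopologicalSpace L :=
  TopologicalSpace.generateFrom
    {s | ∃ φ ∈ predualCone A, ∃ (x₀ : L) (r : ℝ), 0 < r ∧
      s = {x : L | √‖φ (inner A (x - x₀) (x - x₀))‖ < r}}

/-- The topology given by the seminorms `x ↦ |φ(⟨y | x⟩)|`, `φ` a normal positive functional
and `y ∈ L`: it is generated by the open balls of these seminorms. -/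
@[reducible] def tau2 : TopologicalSpace L :=
  TopologicalSpace.generateFrom
    {s | ∃ φ ∈ predualCone A, ∃ (y x₀ : L) (r : ℝ), 0 < r ∧
      s = {x : L | ‖φ (inner A y (x - x₀))‖ < r}}

end Topologies

/-! ### Covariant completely positive maps and their dilations -/

section CP

variable {A B G V : Type*} [NonUnitalCStarAlgebra A] [PartialOrder A] [CStarAlgebra B] [Group G]
  [AddCommGroup V] [Module ℂ V] [RightModule A V]

/-- `S ∈ CP_β^U`: the linear map `b ↦ S_b` is completely positive and `(β, U)`-covariant. -/
structure IsCovariantCP (β : G →* (B ≃⋆ₐ[ℂ] B)) (U : G →* rightGL A V)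
    (S : B →ₗ[ℂ] sesqForms A V) : Prop where
  completely_positive (n : ℕ) (b : Fin n → B) (v : Fin n → V) :
    0 ≤ ∑ j, ∑ k, S (star (b j) * b k) (v j) (v k)
  covariant (g : G) (b : B) (v w : V) :
    S (β g b) v w = S b ((U g⁻¹).1 v) ((U g⁻¹).1 w)

/-- `S` is normal: `b ↦ S_b(v, v)` is normal for every `v`. -/
def IsNormalCP [PartialOrder B] (S : B →ₗ[ℂ] sesqForms A V) : Prop :=
  ∀ v : V, IsNormalMap (fun b : B => S b v v)

variable [StarOrderedRing A] {M : Type*} [NormedAddCommGroup M] [NormedSpace ℂ M]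
  [HilbertModule A M]

/-- `S_b(v, w) = ⟨Jv | π(b)Jw⟩`. -/
def Dilates (S : B →ₗ[ℂ] sesqForms A V) (π : B →⋆ₐ[ℂ] adjointable A M)
    (J : RightLinearMap A V M) : Prop :=
  ∀ (b : B) (v w : V), S b v w = inner A (J v) ((π b).1 (J w))

/-- The linear span of the vectors `π(b)Jv`. -/
def dilationSpan (π : B →⋆ₐ[ℂ] adjointable A M) (J : RightLinearMap A V M) : Submodule ℂ M :=
  Submodule.span ℂ {x | ∃ (b : B) (v : V), x = (π b).1 (J v)}

/-- `JU(g) = Ũ(g)J` and `Ũ(g)π(b) = π(β_g(b))Ũ(g)`. -/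
structure Intertwines (β : G →* (B ≃⋆ₐ[ℂ] B)) (U : G →* rightGL A V)
    (π : B →⋆ₐ[ℂ] adjointable A M) (J : RightLinearMap A V M)
    (Ut : G →* unitary (adjointable A M)) : Prop where
  map_J (g : G) (v : V) : J ((U g).1 v) = (Ut g).1.1 (J v)
  map_π (g : G) (b : B) : (Ut g).1 * π b = π (β g b) * (Ut g).1

/-- `W` is a unitary equivalence of the quadruples `(M, π, J, Ũ)` and `(M', π', J', Ũ')`. -/
structure IsEquivalence {M' : Type*} [NormedAddCommGroup M'] [NormedSpace ℂ M']
    [HilbertModule A M'] (W : HilbertUnitary A M M')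
    (π : B →⋆ₐ[ℂ] adjointable A M) (J : RightLinearMap A V M)
    (Ut : G →* unitary (adjointable A M))
    (π' : B →⋆ₐ[ℂ] adjointable A M') (J' : RightLinearMap A V M')
    (Ut' : G →* unitary (adjointable A M')) : Prop where
  map_J (v : V) : W (J v) = J' v
  map_π (b : B) (x : M) : W ((π b).1 x) = (π' b).1 (W x)
  map_U (g : G) (x : M) : W ((Ut g).1.1 x) = (Ut' g).1.1 (W x)

end CP

end

universe u v w t y z

/-! The dilation is the Stinespring–GNS construction with `A`-valued scalars. On formal sums of
pairs (b, v) the form ∑ S_{b_j⋆c_k}(v_j, w_k) is positive because S is completely positive, and its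
completion modulo null vectors is M. The algebra B acts by left multiplication on b, boundedly
because ‖b‖² - b⋆b has the form c⋆c; J v is the class of (1, v); covariance says precisely that (b,
v) ↦ (β_g b, U(g)v) preserves the form. Uniqueness holds because the inner products of the
generators π(b)Jv depend on S alone (`Dilates.inner_eq`). The converse (d) is a direct computation.

Over a W⋆-algebra, M is replaced by the module of bounded conjugate `A`-linear maps T : M → A, where
T plays the role of x ↦ ⟨x | T⟩. The decisive estimate is `HilbertModule.exists_approx`: in the
seminorm of a positive functional, T is close to some x ↦ ⟨x | m⟩ with ‖m‖ ≤ ‖T‖, uniformly on the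
unit ball, where m nearly minimizes a quadratic functional. Along an ultrafilter of such m, ⟨S | T⟩
is the weak limit of S(m)⋆; uniformity allows the interchange of limits that makes this form
hermitian. The same approximation yields τ₁-density of M (`tendsto_inner_embed_sub`) and
self-duality. Conversely, a self-dual module containing M with trivial orthogonal complement is this
completion (`selfDualCompletion.exists_unitary`). Density in τ₁ or τ₂ makes the complement of the
generators trivial, so any two self-dual dilations are completions of the same M.

Normality refers to the order, whereas a W⋆-algebra comes with a Banach space predual, so the two
must be compared. The predual is realized as a closed space Y of functionals with weakly compact
balls. C⋆-norm estimates show that the involution, positivity and multiplication by a fixed element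
are compatible with bounded weak limits. It follows that positive functionals in Y determine the
order, and that the order-normal positive functionals are exactly those in Y
(`IsPredual.isNormalMap_of_mem`, `IsPredual.mem_of_isNormalMap`). In (c), normality of S gives
convergence of π(d) to π(x) on generators, and τ₁-approximation with a uniform bound extends it to
L. In the other direction, a weak limit of the π(d) is an upper bound for them, hence dominates
π(x). -/

/-! ### Preduals of C⋆-algebras -/

section Predual

open Filter Topology

variable {A : Type*} [CStarAlgebra A]

/-- Convergence of a family in `A` against all functionals in `Y`. -/
def WeakTendsto {ι : Type*} (Y : Submodule ℂ (StrongDual ℂ A)) (l : Filter ι) (x : ι → A)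
    (a : A) : Prop :=
  ∀ ψ ∈ Y, Tendsto (fun i => ψ (x i)) l (𝓝 (ψ a))

/-- A norm closed separating space of functionals against which the balls of `A` are compact. -/
structure IsPredual (Y : Submodule ℂ (StrongDual ℂ A)) : Prop where
  isClosed : IsClosed (Y : Set (StrongDual ℂ A))
  separating (a : A) : (∀ ψ ∈ Y, ψ a = 0) → a = 0
  exists_lim (u : Ultrafilter A) (C : ℝ) :
    (∀ᶠ x in (u : Filter A), ‖x‖ ≤ C) → ∃ a : A, ‖a‖ ≤ C ∧ WeakTendsto Y u id a

/-- The functional on `A` defined by a point of a predual. -/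
noncomputable def predualEval {X : Type*} [NormedAddCommGroup X] [NormedSpace ℂ X]
    (e : StrongDual ℂ X ≃ₗᵢ⋆[ℂ] A) : X →+ StrongDual ℂ A where
  toFun x := LinearMap.mkContinuous
    { toFun := fun a => star (e.symm a x)
      map_add' := by simp
      map_smul' := fun c a => by simp [map_smulₛₗ e.symm] } ‖x‖ fun a => by
        simpa [mul_comm] using (e.symm a).le_opNorm x
  map_zero' := by ext; simp
  map_add' := by intros; ext; simp

lemma predualEval_apply {X : Type*} [NormedAddCommGroup X] [NormedSpace ℂ X]
    (e : StrongDual ℂ X ≃ₗᵢ⋆[ℂ] A) (x : X) (a : A) :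
    predualEval e x a = star (e.symm a x) := rfl

lemma isometry_predualEval {X : Type*} [NormedAddCommGroup X] [NormedSpace ℂ X]
    (e : StrongDual ℂ X ≃ₗᵢ⋆[ℂ] A) : Isometry (predualEval e) := by
  refine AddMonoidHomClass.isometry_of_norm _ fun x => le_antisymm ?_ ?_
  · refine ContinuousLinearMap.opNorm_le_bound _ (norm_nonneg x) fun a => ?_
    simpa [predualEval_apply, mul_comm] using (e.symm a).le_opNorm x
  · obtain ⟨g, hg, hgx⟩ := exists_dual_vector'' ℂ x
    have h := (predualEval e x).le_opNorm (e g)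
    rw [predualEval_apply, e.symm_apply_apply, hgx, e.norm_map] at h
    simp only [norm_star, RCLike.norm_ofReal, abs_norm] at h
    exact h.trans (mul_le_of_le_one_right (norm_nonneg _) hg)

-- Banach–Alaoglu in the dual of X supplies the weak limits. The image of X is norm closed because X
-- is complete and embeds isometrically.
variable (A) in
lemma exists_isPredual [WStarAlgebra A] : ∃ Y : Submodule ℂ (StrongDual ℂ A), IsPredual Y := by
  obtain ⟨X, _, _, _, ⟨e⟩⟩ := WStarAlgebra.exists_predual (M := A)
  have hsmul (c : ℂ) (x : X) : predualEval e (star c • x) = c • predualEval e x := by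
    ext a; simp [predualEval_apply]
  refine ⟨⟨(predualEval e).range.toAddSubmonoid, ?_⟩, ?_, ?_, ?_⟩
  · rintro c _ ⟨x, rfl⟩
    exact ⟨star c • x, hsmul c x⟩
  · exact (isometry_predualEval e).isClosedEmbedding.isClosed_range
  · intro a ha
    have : e.symm a = 0 := by
      ext x
      have := ha (predualEval e x) ⟨x, rfl⟩
      simpa [predualEval_apply] using this
    simpa using this
  · intro u C hC
    have hcomp := WeakDual.isCompact_closedBall (0 : StrongDual ℂ X) C
    let f : A → WeakDual ℂ X := fun a => StrongDual.toWeakDual (e.symm a)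
    have hu : (u.map f : Filter (WeakDual ℂ X)) ≤
        𝓟 (WeakDual.toStrongDual ⁻¹' Metric.closedBall (0 : StrongDual ℂ X) C) := by
      rw [le_principal_iff, Ultrafilter.coe_map, mem_map]
      filter_upwards [hC] with x hx
      simpa [f] using hx
    obtain ⟨g, hg, hgu⟩ := hcomp.ultrafilter_le_nhds _ hu
    refine ⟨e (WeakDual.toStrongDual g), by simpa using hg, ?_⟩
    rintro _ ⟨x, rfl⟩
    have h1 : Tendsto f u (𝓝 g) := hgu
    have h2 := ((WeakDual.eval_continuous x).tendsto g).comp h1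
    have h3 := (continuous_star.tendsto _).comp h2
    simpa [predualEval_apply] using! h3

namespace WeakTendsto

variable {ι : Type*} {Y : Submodule ℂ (StrongDual ℂ A)} {l : Filter ι} {x x' : ι → A} {a a' : A}

lemma congr' (h : WeakTendsto Y l x a) (hx : x =ᶠ[l] x') : WeakTendsto Y l x' a :=
  fun ψ hψ => (h ψ hψ).congr' (hx.mono fun i hi => by simp [hi])

lemma const (a : A) : WeakTendsto Y l (fun _ => a) a := fun _ _ => tendsto_const_nhds

lemma add (h : WeakTendsto Y l x a) (h' : WeakTendsto Y l x' a') :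
    WeakTendsto Y l (fun i => x i + x' i) (a + a') :=
  fun ψ hψ => by simpa using (h ψ hψ).add (h' ψ hψ)

lemma sub (h : WeakTendsto Y l x a) (h' : WeakTendsto Y l x' a') :
    WeakTendsto Y l (fun i => x i - x' i) (a - a') :=
  fun ψ hψ => by simpa using (h ψ hψ).sub (h' ψ hψ)

lemma smul (h : WeakTendsto Y l x a) (c : ℂ) : WeakTendsto Y l (fun i => c • x i) (c • a) :=
  fun ψ hψ => by simpa using (h ψ hψ).const_mul c

lemma unique [l.NeBot] (hY : IsPredual Y) (h : WeakTendsto Y l x a) (h' : WeakTendsto Y l x a') :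
    a = a' := sub_eq_zero.1 <| hY.separating _ fun ψ hψ => by
  rw [map_sub, tendsto_nhds_unique (h ψ hψ) (h' ψ hψ), sub_self]

end WeakTendsto

namespace IsPredual

variable {ι : Type*} {Y : Submodule ℂ (StrongDual ℂ A)}

lemma exists_weakTendsto (hY : IsPredual Y) (u : Ultrafilter ι) {x : ι → A} {C : ℝ}
    (hx : ∀ᶠ i in (u : Filter ι), ‖x i‖ ≤ C) : ∃ a : A, ‖a‖ ≤ C ∧ WeakTendsto Y u x a :=
  hY.exists_lim (u.map x) C hx

lemma norm_le (hY : IsPredual Y) {u : Ultrafilter ι} {x : ι → A} {C : ℝ}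
    (hx : ∀ᶠ i in (u : Filter ι), ‖x i‖ ≤ C) {a : A} (h : WeakTendsto Y u x a) : ‖a‖ ≤ C := by
  obtain ⟨b, hb, hub⟩ := hY.exists_weakTendsto u hx
  rwa [h.unique hY hub]

/-- A functional that is continuous along bounded weakly convergent ultrafilters is in the
predual. -/
lemma mem_of_forall_tendsto (hY : IsPredual Y) {ψ : StrongDual ℂ A}
    (h : ∀ u : Ultrafilter A, (∀ᶠ x in (u : Filter A), ‖x‖ ≤ 1) → WeakTendsto Y u id 0 →
      Tendsto ψ u (𝓝 0)) : ψ ∈ Y := by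
  -- Otherwise each finite F ⊆ Y has a vector of the unit ball that F kills and on which |ψ| exceeds
  -- ε. An ultrafilter of such vectors tends weakly to 0, although ψ does not tend to 0 along it.
  have key (ε : ℝ) (hε : 0 < ε) : ∃ F : Finset Y, ∀ a : A, ‖a‖ ≤ 1 → (∀ f ∈ F, f.1 a = 0) →
      ‖ψ a‖ ≤ ε := by
    by_contra! hcon
    let Z : Finset Y → Set A := fun F => {a | ‖a‖ ≤ 1 ∧ (∀ f ∈ F, f.1 a = 0) ∧ ε < ‖ψ a‖}
    have hmono : ∀ F F', F ⊆ F' → Z F' ⊆ Z F :=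
      fun F F' hF a ha => ⟨ha.1, fun f hf => ha.2.1 f (hF hf), ha.2.2⟩
    have : (⨅ F, 𝓟 (Z F)).NeBot := by
      classical
      refine iInf_neBot_of_directed' (fun F F' => ⟨F ∪ F', ?_, ?_⟩) fun F => ?_
      · exact principal_mono.2 (hmono _ _ Finset.subset_union_left)
      · exact principal_mono.2 (hmono _ _ Finset.subset_union_right)
      · obtain ⟨a, h1, h2, h3⟩ := hcon F
        exact principal_neBot_iff.2 ⟨a, h1, h2, h3⟩
    let u := Ultrafilter.of (⨅ F, 𝓟 (Z F))
    have hu (F : Finset Y) : ∀ᶠ a in (u : Filter A), a ∈ Z F :=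
      (Ultrafilter.of_le _).trans (iInf_le _ F) (mem_principal_self _)
    have h1 := h u ((hu ∅).mono fun a ha => ha.1) fun f hf => by
      refine tendsto_const_nhds.congr' ?_
      filter_upwards [hu {⟨f, hf⟩}] with a ha
      rw [map_zero]
      exact (ha.2.1 ⟨f, hf⟩ (Finset.mem_singleton_self _)).symm
    have h2 := (h1.norm.eventually (gt_mem_nhds (by simpa using hε)))
    obtain ⟨a, ha, ha'⟩ := (h2.and (hu ∅)).exists
    exact lt_asymm ha ha'.2.2
  rw [← SetLike.mem_coe, ← hY.isClosed.closure_eq, Metric.mem_closure_iff]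
  intro ε hε
  obtain ⟨F, hF⟩ := key (ε / 2) (by positivity)
  -- The restriction of ψ to the common kernel N of F has norm at most ε / 2, and so does its
  -- Hahn–Banach extension g. As ψ - g vanishes on N, it is a combination of the functionals in F,
  -- hence an element of Y close to ψ.
  let N : Submodule ℂ A := ⨅ f : F, LinearMap.ker (f.1.1 : A →ₗ[ℂ] ℂ)
  have hN (a : A) : a ∈ N ↔ ∀ f ∈ F, f.1 a = 0 := by
    simp only [N, Submodule.mem_iInf, LinearMap.mem_ker, ContinuousLinearMap.coe_coe,
      Subtype.forall]
  obtain ⟨g, hg, hgn⟩ := exists_extension_norm_eq N (ψ.comp N.subtypeL)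
  have hle : ‖ψ.comp N.subtypeL‖ ≤ ε / 2 := by
    refine ContinuousLinearMap.opNorm_le_of_unit_norm (by positivity) fun x hx => ?_
    exact hF x.1 hx.le ((hN _).1 x.2)
  have hmem : ((ψ - g : StrongDual ℂ A) : A →ₗ[ℂ] ℂ) ∈
      Submodule.span ℂ (Set.range fun f : F => (f.1.1 : A →ₗ[ℂ] ℂ)) := by
    refine mem_span_of_iInf_ker_le_ker fun a ha => ?_
    have := hg ⟨a, ha⟩
    simp at this
    simp [this]
  have hsub : ψ - g ∈ Y := by
    have : Submodule.span ℂ (Set.range fun f : F => (f.1.1 : A →ₗ[ℂ] ℂ)) ≤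
        Y.map (ContinuousLinearMap.coeLM ℂ) := by
      refine Submodule.span_le.2 ?_
      rintro _ ⟨f, rfl⟩
      exact ⟨f.1.1, f.1.2, rfl⟩
    obtain ⟨f, hf, hfe⟩ := this hmem
    have : f = ψ - g := ContinuousLinearMap.coe_injective hfe
    exact this ▸ hf
  refine ⟨ψ - g, hsub, ?_⟩
  rw [dist_eq_norm, sub_sub_cancel, hgn]
  linarith

/-- Weak limits of elements of pA stay in pA. Weak continuity of multiplication is not yet
available, so the proof uses only the C⋆-identity and the weak lower semicontinuity of the norm. -/
lemma mul_eq_self_of_isStarProjection (hY : IsPredual Y) {p : A} (hp : IsStarProjection p)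
    {u : Ultrafilter ι} {x : ι → A} {C : ℝ} (hx : ∀ᶠ i in (u : Filter ι), ‖x i‖ ≤ C) {y : A}
    (h : WeakTendsto Y u (fun i => p * x i) y) : (1 - p) * y = 0 := by
  set q := 1 - p
  have hq : IsStarProjection q := hp.one_sub
  have hpq : p * q = 0 := hp.mul_one_sub_self
  set t := ‖q * y‖
  obtain ⟨i₀, hi₀⟩ := hx.exists
  have hC : 0 ≤ C := (norm_nonneg _).trans hi₀
  have hpn : ‖p‖ ≤ 1 := hp.norm_le
  have hqn : ‖q‖ ≤ 1 := hq.norm_le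
  -- Adding n(1 - p)y to p x_i is an orthogonal perturbation, so its squared norm is at most C² +
  -- n²t². The limit y + n(1 - p)y has the component (n + 1)(1 - p)y, of norm (n + 1)t. Letting n
  -- grow forces t = 0.
  have key (n : ℕ) : (n + 1) ^ 2 * t ^ 2 ≤ C ^ 2 + n ^ 2 * t ^ 2 := by
    have h1 : ‖y + (n : ℂ) • (q * y)‖ ≤ √(C ^ 2 + n ^ 2 * t ^ 2) := by
      refine hY.norm_le (u := u) (x := fun i => p * x i + (n : ℂ) • (q * y)) ?_ (h.add (.const _))
      filter_upwards [hx] with i hi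
      refine Real.le_sqrt_of_sq_le ?_
      have hz : star (p * x i + (n : ℂ) • (q * y)) * (p * x i + (n : ℂ) • (q * y)) =
          star (p * x i) * (p * x i) + ((n : ℂ) ^ 2) • (star (q * y) * (q * y)) := by
        have e1 : star (p * x i) * (q * y) = 0 := by
          rw [star_mul, hp.isSelfAdjoint.star_eq, mul_assoc, ← mul_assoc p, hpq, zero_mul, mul_zero]
        have e2 : star (q * y) * (p * x i) = 0 := by
          have := congrArg star e1
          rwa [star_mul, star_star, star_zero] at this
        rw [star_add, add_mul, mul_add, mul_add, mul_smul_comm, e1, star_smul, smul_mul_assoc, e2,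
          smul_mul_smul_comm]
        simp [sq]
      rw [sq, ← CStarRing.norm_star_mul_self, hz]
      refine (norm_add_le _ _).trans (add_le_add ?_ ?_)
      · rw [CStarRing.norm_star_mul_self, ← sq]
        have : ‖p * x i‖ ≤ C := (norm_mul_le _ _).trans (by
          calc ‖p‖ * ‖x i‖ ≤ 1 * C := by gcongr
            _ = C := one_mul C)
        gcongr
      · rw [norm_smul, CStarRing.norm_star_mul_self, ← sq]
        simp [t]
    have h2 : (n + 1) * t ≤ ‖y + (n : ℂ) • (q * y)‖ := by
      have : q * (y + (n : ℂ) • (q * y)) = ((n : ℂ) + 1) • (q * y) := by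
        rw [mul_add, mul_smul_comm, ← mul_assoc, hq.isIdempotentElem.eq]
        module
      calc (n + 1) * t = ‖q * (y + (n : ℂ) • (q * y))‖ := by
            rw [this, norm_smul]
            congr 1
            norm_cast
        _ ≤ ‖q‖ * ‖y + (n : ℂ) • (q * y)‖ := norm_mul_le _ _
        _ ≤ 1 * ‖y + (n : ℂ) • (q * y)‖ := by gcongr
        _ = _ := one_mul _
    have h3 := (Real.le_sqrt (by positivity) (by positivity)).1 (h2.trans h1)
    linarith [mul_pow ((n : ℝ) + 1) t 2]
  have ht : t ^ 2 ≤ 0 := by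
    by_contra! hpos
    obtain ⟨n, hn⟩ := exists_nat_gt (C ^ 2 / t ^ 2)
    rw [div_lt_iff₀ hpos] at hn
    have := key n
    nlinarith
  have : t = 0 := by nlinarith [norm_nonneg (q * y)]
  exact norm_eq_zero.1 this

/-- The limits y of p x_i and z of (1 - p)x_i lie in pA and (1 - p)A and add up to a, so y = pa. -/
lemma weakTendsto_isStarProjection_mul (hY : IsPredual Y) {p : A} (hp : IsStarProjection p)
    {u : Ultrafilter ι} {x : ι → A} {C : ℝ} (hx : ∀ᶠ i in (u : Filter ι), ‖x i‖ ≤ C) {a : A}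
    (h : WeakTendsto Y u x a) : WeakTendsto Y u (fun i => p * x i) (p * a) := by
  have hb (q : A) (hq : IsStarProjection q) : ∀ᶠ i in (u : Filter ι), ‖q * x i‖ ≤ C := by
    filter_upwards [hx] with i hi
    refine (norm_mul_le _ _).trans ?_
    calc ‖q‖ * ‖x i‖ ≤ 1 * ‖x i‖ := by gcongr; exact hq.norm_le
      _ ≤ C := by rwa [one_mul]
  obtain ⟨y, -, hy⟩ := hY.exists_weakTendsto u (hb p hp)
  obtain ⟨z, -, hz⟩ := hY.exists_weakTendsto u (hb (1 - p) hp.one_sub)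
  have h1 := hY.mul_eq_self_of_isStarProjection hp hx hy
  have h2 := hY.mul_eq_self_of_isStarProjection hp.one_sub hx hz
  have h3 : y + z = a := by
    refine (hy.add hz).unique hY ?_
    simpa [← add_mul] using h
  rw [sub_sub_cancel] at h2
  rw [sub_mul, one_mul, sub_eq_zero] at h1
  rw [← h3, mul_add, h2, add_zero, ← h1]
  exact hy

end IsPredual

end Predual

/-! ### Weak limits, the involution and the order -/

section PredualOrder

open Filter Topology

lemma nonpos_of_forall_nat_smul_le {A : Type*} [NonUnitalCStarAlgebra A] [PartialOrder A]
    [StarOrderedRing A] {y c : A} (h : ∀ n : ℕ, (n : ℝ) • y ≤ c) : y ≤ 0 := by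
  have h0 : Tendsto (fun n : ℕ => ((n : ℝ) + 1)⁻¹ • c) atTop (𝓝 0) := by
    have := (tendsto_one_div_add_atTop_nhds_zero_nat (𝕜 := ℝ)).smul_const c
    simpa using this
  refine ge_of_tendsto' h0 fun n => ?_
  have h1 := smul_le_smul_of_nonneg_left (h (n + 1))
    (inv_nonneg.2 (by positivity : 0 ≤ (n : ℝ) + 1))
  rwa [smul_smul, Nat.cast_add, Nat.cast_one, inv_mul_cancel₀ (by positivity), one_smul] at h1

variable {A : Type*} [CStarAlgebra A]

/-- The functional `a ↦ star (ψ (star a))`. -/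
noncomputable def starFunctional (ψ : StrongDual ℂ A) : StrongDual ℂ A :=
  LinearMap.mkContinuous
    { toFun := fun a => star (ψ (star a))
      map_add' := by simp
      map_smul' := fun c a => by simp } ‖ψ‖ fun a => by
        simpa using ψ.le_opNorm (star a)

@[simp] lemma starFunctional_apply (ψ : StrongDual ℂ A) (a : A) :
    starFunctional ψ a = star (ψ (star a)) := rfl

variable [PartialOrder A] [StarOrderedRing A]

namespace IsPredual

variable {ι : Type*} {Y : Submodule ℂ (StrongDual ℂ A)}

/-- For self-adjoint x one has ‖x + in‖² ≤ ‖x‖² + n², which survives in the limit. Expanding the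
square at a, the term linear in n is n·i(a⋆ - a); it stays below C² for every real n, hence
vanishes. -/
lemma isSelfAdjoint_of_weakTendsto (hY : IsPredual Y) {u : Ultrafilter ι} {x : ι → A} {C : ℝ}
    (hx : ∀ᶠ i in (u : Filter ι), ‖x i‖ ≤ C)
    (hsa : ∀ᶠ i in (u : Filter ι), IsSelfAdjoint (x i)) {a : A} (h : WeakTendsto Y u x a) :
    IsSelfAdjoint a := by
  obtain _ | _ := subsingleton_or_nontrivial A
  · exact Subsingleton.elim _ _
  obtain ⟨i₀, hi₀⟩ := hx.exists
  have hC : 0 ≤ C := (norm_nonneg _).trans hi₀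
  set y : A := Complex.I • (star a - a) with hy
  have hexp (b : A) (n : ℝ) : star (b + (Complex.I * n) • (1 : A)) * (b + (Complex.I * n) • (1 : A))
      = star b * b + n • (Complex.I • (star b - b)) + algebraMap ℝ A (n ^ 2) := by
    simp only [star_add, star_smul, star_one, add_mul, mul_add, smul_mul_assoc, mul_smul_comm,
      one_mul, mul_one, star_mul', RCLike.star_def, Complex.conj_I, Complex.conj_ofReal,
      smul_sub, Algebra.algebraMap_eq_smul_one]
    rw [show ((n ^ 2 : ℝ) • (1 : A)) = ((n : ℂ) ^ 2) • (1 : A) by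
        rw [← Complex.coe_smul]; push_cast; rfl,
      ← Complex.coe_smul n, ← Complex.coe_smul n, smul_smul, smul_smul]
    have hI : -Complex.I * n * (Complex.I * n) = (n : ℂ) ^ 2 := by
      linear_combination (-(n : ℂ) ^ 2) * Complex.I_mul_I
    rw [← hI]
    module
  have key (n : ℝ) : n • y ≤ algebraMap ℝ A (C ^ 2) := by
    have h1 : ‖a + (Complex.I * n) • (1 : A)‖ ≤ √(C ^ 2 + n ^ 2) := by
      refine hY.norm_le (u := u) (x := fun i => x i + (Complex.I * n) • (1 : A)) ?_
        (h.add (.const _))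
      filter_upwards [hx, hsa] with i hi hi'
      refine Real.le_sqrt_of_sq_le ?_
      rw [sq, ← CStarRing.norm_star_mul_self, hexp, hi'.star_eq, sub_self, smul_zero, smul_zero,
        add_zero]
      refine (norm_add_le _ _).trans (add_le_add ?_ ?_)
      · refine (norm_mul_le _ _).trans ?_
        rw [sq]; gcongr
      · rw [norm_algebraMap', Real.norm_of_nonneg (sq_nonneg n)]
    have h2 := CStarAlgebra.star_mul_le_algebraMap_norm_sq (a := a + (Complex.I * n) • (1 : A))
    rw [hexp, ← hy] at h2
    have h3 : algebraMap ℝ A (‖a + (Complex.I * n) • (1 : A)‖ ^ 2) ≤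
        algebraMap ℝ A (C ^ 2 + n ^ 2) :=
      algebraMap_mono A ((Real.le_sqrt (norm_nonneg _) (by positivity)).1 h1)
    rw [map_add] at h3
    have h4 := le_of_add_le_add_right (h2.trans h3)
    exact (le_add_of_nonneg_left (star_mul_self_nonneg a)).trans h4
  have hy1 : y ≤ 0 := nonpos_of_forall_nat_smul_le fun n => key n
  have hy2 : -y ≤ 0 := nonpos_of_forall_nat_smul_le fun n => by
    simpa using key (-n)
  have hy0 : y = 0 := le_antisymm hy1 (by simpa using hy2)
  have := (smul_eq_zero.1 hy0).resolve_left Complex.I_ne_zero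
  exact sub_eq_zero.1 this

/-- With z a limit of the adjoints, a + z and i(a - z) are limits of the self-adjoint families x +
x⋆ and i(x - x⋆), which forces z = a⋆. -/
lemma weakTendsto_star (hY : IsPredual Y) {u : Ultrafilter ι} {x : ι → A} {C : ℝ}
    (hx : ∀ᶠ i in (u : Filter ι), ‖x i‖ ≤ C) {a : A} (h : WeakTendsto Y u x a) :
    WeakTendsto Y u (fun i => star (x i)) (star a) := by
  have hx' : ∀ᶠ i in (u : Filter ι), ‖star (x i)‖ ≤ C := by simpa using hx
  obtain ⟨z, -, hz⟩ := hY.exists_weakTendsto u hx'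
  have h1 : IsSelfAdjoint (a + z) := by
    refine hY.isSelfAdjoint_of_weakTendsto (C := C + C) ?_ (.of_forall fun i => ?_) (h.add hz)
    · filter_upwards [hx, hx'] with i h1 h2 using (norm_add_le _ _).trans (add_le_add h1 h2)
    · exact IsSelfAdjoint.add_star_self _
  have h2 : IsSelfAdjoint (Complex.I • (a - z)) := by
    refine hY.isSelfAdjoint_of_weakTendsto (C := C + C) ?_ (.of_forall fun i => ?_)
      ((h.sub hz).smul Complex.I)
    · filter_upwards [hx, hx'] with i h1 h2
      rw [norm_smul, Complex.norm_I, one_mul]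
      exact (norm_sub_le _ _).trans (add_le_add h1 h2)
    · simp [isSelfAdjoint_iff, ← smul_neg]
  have h3 : star a + star z = a + z := by simpa using h1.star_eq
  have h4 : -(star a - star z) = a - z := by
    have := h2.star_eq
    rw [star_smul, RCLike.star_def, Complex.conj_I, neg_smul, ← smul_neg, star_sub] at this
    exact smul_right_injective A Complex.I_ne_zero this
  have : star a = z := by
    linear_combination (norm := module) (1 / 2 : ℂ) • h3 - (1 / 2 : ℂ) • h4
  rwa [this]

/-- For 0 ≤ x with ‖x‖ ≤ C, positivity is encoded in the norm bound ‖C - x‖ ≤ C, which passes to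
weak limits. -/
lemma nonneg_of_weakTendsto (hY : IsPredual Y) {u : Ultrafilter ι} {x : ι → A} {C : ℝ}
    (hx : ∀ᶠ i in (u : Filter ι), ‖x i‖ ≤ C)
    (hpos : ∀ᶠ i in (u : Filter ι), 0 ≤ x i) {a : A} (h : WeakTendsto Y u x a) : 0 ≤ a := by
  obtain ⟨i₀, hi₀⟩ := hx.exists
  have hC : 0 ≤ C := (norm_nonneg _).trans hi₀
  have hsa := hY.isSelfAdjoint_of_weakTendsto hx (hpos.mono fun i hi => .of_nonneg hi) h
  have h1 : ‖algebraMap ℝ A C - a‖ ≤ C := by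
    refine hY.norm_le (u := u) (x := fun i => algebraMap ℝ A C - x i) ?_
      ((WeakTendsto.const _).sub h)
    filter_upwards [hx, hpos] with i hi hi'
    have h2 : x i ≤ algebraMap ℝ A C := (CStarAlgebra.norm_le_iff_le_algebraMap _ hC).1 hi
    exact (CStarAlgebra.norm_le_iff_le_algebraMap _ hC (sub_nonneg.2 h2)).2 (sub_le_self _ hi')
  have h2 : IsSelfAdjoint (algebraMap ℝ A C - a) := (IsSelfAdjoint.algebraMap A (.all _)).sub hsa
  have h3 := h2.le_algebraMap_norm_self.trans (algebraMap_mono A h1)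
  simpa using h3

lemma le_of_weakTendsto (hY : IsPredual Y) {u : Ultrafilter ι} {x x' : ι → A} {C C' : ℝ}
    (hx : ∀ᶠ i in (u : Filter ι), ‖x i‖ ≤ C) (hx' : ∀ᶠ i in (u : Filter ι), ‖x' i‖ ≤ C')
    (hle : ∀ᶠ i in (u : Filter ι), x i ≤ x' i) {a a' : A} (h : WeakTendsto Y u x a)
    (h' : WeakTendsto Y u x' a') : a ≤ a' := by
  rw [← sub_nonneg]
  refine hY.nonneg_of_weakTendsto (C := C' + C) ?_ (hle.mono fun i hi => sub_nonneg.2 hi) (h'.sub h)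
  filter_upwards [hx, hx'] with i h1 h2 using (norm_sub_le _ _).trans (add_le_add h2 h1)

lemma starFunctional_mem (hY : IsPredual Y) {ψ : StrongDual ℂ A} (hψ : ψ ∈ Y) :
    starFunctional ψ ∈ Y := by
  refine hY.mem_of_forall_tendsto fun u hu h => ?_
  have := hY.weakTendsto_star (x := id) hu h ψ hψ
  simpa using! (continuous_star.tendsto _).comp this

/-- A bounded directed set has a supremum, which is the limit of the tails. -/
lemma exists_isLUB (hY : IsPredual Y) {D : Set A} (hne : D.Nonempty)
    (hD : DirectedOn (· ≤ ·) D) (hb : BddAbove D) :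
    ∃ a, IsLUB D a ∧ ∃ u : Ultrafilter A, WeakTendsto Y u id a ∧
      (∃ C, ∀ᶠ x in (u : Filter A), ‖x‖ ≤ C) ∧ ∀ d ∈ D, ∀ᶠ x in (u : Filter A), x ∈ D ∧ d ≤ x := by
  obtain ⟨b, hb⟩ := hb
  obtain ⟨d₀, hd₀⟩ := hne
  have : Nonempty D := ⟨⟨d₀, hd₀⟩⟩
  have : (⨅ d : D, 𝓟 {x | x ∈ D ∧ d.1 ≤ x}).NeBot := by
    refine iInf_neBot_of_directed' (fun d d' => ?_) fun d =>
      principal_neBot_iff.2 ⟨d, d.2, le_rfl⟩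
    obtain ⟨e, he, h1, h2⟩ := hD d d.2 d' d'.2
    exact ⟨⟨e, he⟩, principal_mono.2 fun x hx => ⟨hx.1, h1.trans hx.2⟩,
      principal_mono.2 fun x hx => ⟨hx.1, h2.trans hx.2⟩⟩
  let u := Ultrafilter.of (⨅ d : D, 𝓟 {x | x ∈ D ∧ d.1 ≤ x})
  have hu (d : A) (hd : d ∈ D) : ∀ᶠ x in (u : Filter A), x ∈ D ∧ d ≤ x :=
    (Ultrafilter.of_le _).trans (iInf_le _ ⟨d, hd⟩) (mem_principal_self _)
  have hbd : ∀ᶠ x in (u : Filter A), ‖x‖ ≤ ‖d₀‖ + ‖b - d₀‖ := by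
    filter_upwards [hu d₀ hd₀] with x hx
    have := CStarAlgebra.norm_le_norm_of_nonneg_of_le (sub_nonneg.2 hx.2)
      (sub_le_sub_right (hb hx.1) d₀)
    calc ‖x‖ = ‖d₀ + (x - d₀)‖ := by simp
      _ ≤ _ := (norm_add_le _ _).trans (by gcongr)
  obtain ⟨a, -, ha⟩ := hY.exists_weakTendsto u (x := id) hbd
  refine ⟨a, ⟨fun d hd => ?_, fun c hc => ?_⟩, u, ha, ⟨_, hbd⟩, hu⟩
  · exact hY.le_of_weakTendsto (.of_forall fun _ => le_rfl) hbd
      ((hu d hd).mono fun x hx => hx.2) (.const d) ha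
  · exact hY.le_of_weakTendsto hbd (.of_forall fun _ => le_rfl)
      ((hu d₀ hd₀).mono fun x hx => hc hx.1) ha (.const c)

end IsPredual

end PredualOrder

/-! ### Projections, and stability of the predual under multiplication -/

section PredualModule

open Filter Topology

variable {A : Type*} [CStarAlgebra A] [PartialOrder A] [StarOrderedRing A]

lemma mul_eq_zero_of_star_conjugate_eq_zero {q z : A} (hq : 0 ≤ q) (h : star z * q * z = 0) :
    q * z = 0 := by
  have hs : star (CFC.sqrt q) = CFC.sqrt q := (IsSelfAdjoint.of_nonneg (CFC.sqrt_nonneg q)).star_eq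
  have h1 : star (CFC.sqrt q * z) * (CFC.sqrt q * z) = 0 := by
    rw [star_mul, hs, mul_assoc, ← mul_assoc (CFC.sqrt q), CFC.sqrt_mul_sqrt_self q, ← mul_assoc, h]
  rw [CStarRing.star_mul_self_eq_zero_iff] at h1
  rw [← CFC.sqrt_mul_sqrt_self q, mul_assoc, h1, mul_zero]

namespace IsPredual

variable {ι : Type*} {Y : Submodule ℂ (StrongDual ℂ A)}

/-- Between `b` and `1 + b` there is a projection: the spectral projection of `b` for `(0, ∞)`. -/
lemma exists_isStarProjection_between (hY : IsPredual Y) {b : A} (hb : IsSelfAdjoint b)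
    (h1 : -1 ≤ b) (h2 : b ≤ 1) : ∃ p : A, IsStarProjection p ∧ b ≤ p ∧ p ≤ 1 + b := by
  have hspec1 : ∀ t ∈ spectrum ℝ b, t ≤ 1 := by
    rw [← le_algebraMap_iff_spectrum_le (ha := hb), map_one]; exact h2
  have hspec2 : ∀ t ∈ spectrum ℝ b, -1 ≤ t := by
    rw [← algebraMap_le_iff_le_spectrum (ha := hb), map_neg, map_one]; exact h1
  -- These functions increase to the indicator of (0, ∞). Since Borel functional calculus is
  -- replaced by suprema, p is the supremum of the f m (b).
  let f : ℕ → ℝ → ℝ := fun m t => max 0 (min 1 (m * t))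
  have hf (m : ℕ) : Continuous (f m) := by fun_prop
  have hf0 (m : ℕ) (t : ℝ) : 0 ≤ f m t := le_max_left _ _
  have hf1 (m : ℕ) (t : ℝ) : f m t ≤ 1 := max_le zero_le_one (min_le_left _ _)
  let x : ℕ → A := fun m => cfc (f m) b
  have hx0 (m : ℕ) : 0 ≤ x m := cfc_nonneg fun t _ => hf0 m t
  have hx1 (m : ℕ) : x m ≤ 1 := cfc_le_one _ _ fun t _ => hf1 m t
  have hmono : Monotone x := fun m m' hm =>
    cfc_mono (fun t _ => by
      have : (m : ℝ) ≤ m' := by exact_mod_cast hm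
      rcases le_total 0 t with ht | ht
      · exact max_le_max le_rfl (min_le_min le_rfl (by gcongr))
      · have : (m : ℝ) * t ≤ 0 := mul_nonpos_of_nonneg_of_nonpos (by positivity) ht
        simp only [f]
        rw [max_eq_left ((min_le_right _ _).trans this)]
        exact le_max_left _ _) (hf m).continuousOn (hf m').continuousOn
  obtain ⟨p, hp, -⟩ := hY.exists_isLUB (Set.range_nonempty x)
    hmono.directed_le.directedOn_range ⟨1, by rintro _ ⟨m, rfl⟩; exact hx1 m⟩
  have hxp (m : ℕ) : x m ≤ p := hp.1 ⟨m, rfl⟩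
  have hp0 : 0 ≤ p := (hx0 0).trans (hxp 0)
  have hp1 : p ≤ 1 := hp.2 (by rintro _ ⟨m, rfl⟩; exact hx1 m)
  have hpsa : IsSelfAdjoint p := .of_nonneg hp0
  have hxsa (n : ℕ) : IsSelfAdjoint (x n) := .of_nonneg (hx0 n)
  -- Since 1 - p ≤ 1 - x m, it suffices that f n (1 - f m) f n ≤ n / m pointwise: where 1 - f m does
  -- not vanish and t > 0, one has t < 1 / m and f n t ≤ n t.
  have hkey (n : ℕ) : (1 - p) * x n = 0 := by
    refine mul_eq_zero_of_star_conjugate_eq_zero (sub_nonneg.2 hp1) (le_antisymm ?_ ?_)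
    · refine nonpos_of_forall_nat_smul_le (c := algebraMap ℝ A n) fun m => ?_
      have h3 : star (x n) * (1 - p) * x n ≤ star (x n) * (1 - x m) * x n :=
        star_left_conjugate_le_conjugate (sub_le_sub_left (hxp m) 1) _
      refine (smul_le_smul_of_nonneg_left h3 (by positivity : (0 : ℝ) ≤ m)).trans ?_
      rw [(hxsa n).star_eq]
      have h4 : (m : ℝ) • (x n * (1 - x m) * x n) =
          cfc (fun t => (m : ℝ) * (f n t * (1 - f m t) * f n t)) b := by
        rw [cfc_const_mul _ _ b (by fun_prop), cfc_mul _ _ b (by fun_prop) (by fun_prop),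
          cfc_mul _ _ b (by fun_prop) (by fun_prop), cfc_sub _ _ b (by fun_prop) (by fun_prop),
          cfc_const_one ℝ b]
      rw [h4]
      refine cfc_le_algebraMap _ _ _ (fun t _ => ?_) (by fun_prop)
      rcases le_total t 0 with ht | ht
      · have h5 : (n : ℝ) * t ≤ 0 := mul_nonpos_of_nonneg_of_nonpos (by positivity) ht
        have h6 : f n t = 0 := max_eq_left ((min_le_right _ _).trans h5)
        simp [h6]
      rcases le_total 1 (m * t) with h5 | h5
      · have h6 : f m t = 1 := by simp [f, min_eq_left h5]
        simp [h6]
      · have h6 : f m t = m * t := by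
          have : 0 ≤ (m : ℝ) * t := by positivity
          simp [f, min_eq_right h5, this]
        have h7 : f n t ≤ n * t := max_le (by positivity) (min_le_right _ _)
        have h8 := hf0 n t
        have h9 := hf1 n t
        rw [h6]
        have h10 : 0 ≤ (m : ℝ) * t := by positivity
        have h11 : f n t * (1 - m * t) * f n t ≤ n * t := by
          calc f n t * (1 - m * t) * f n t ≤ 1 * 1 * (n * t) := by
                gcongr
                linarith
            _ = n * t := by ring
        calc (m : ℝ) * (f n t * (1 - m * t) * f n t) ≤ m * (n * t) := by gcongr
          _ = n * (m * t) := by ring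
          _ ≤ n * 1 := by gcongr
          _ = n := mul_one _
    · exact star_left_conjugate_nonneg (sub_nonneg.2 hp1) _
  have hpx (n : ℕ) : p * x n = x n := by
    have := hkey n
    rw [sub_mul, one_mul, sub_eq_zero] at this
    exact this.symm
  have hxp' (n : ℕ) : x n * p = x n := by
    have := congrArg star (hpx n)
    rwa [star_mul, (hxsa n).star_eq, hpsa.star_eq] at this
  have hpp : p ≤ p * p := hp.2 <| by
    rintro _ ⟨n, rfl⟩
    have := star_left_conjugate_le_conjugate (hx1 n) p
    rwa [hpsa.star_eq, hpx, hxp', mul_one] at this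
  have hpp' : p * p ≤ p := by
    have := CStarAlgebra.pow_antitone hp0 hp1 (show 1 ≤ 2 by norm_num)
    simpa [sq] using this
  refine ⟨p, ⟨le_antisymm hpp' hpp, hpsa⟩, ?_, hp.2 ?_⟩
  · refine le_trans ?_ (hxp 1)
    conv_lhs => rw [← cfc_id ℝ b]
    refine cfc_mono (fun t ht => ?_) (by fun_prop) (by fun_prop)
    simp [f, hspec1 t ht]
  · rintro _ ⟨m, rfl⟩
    have h3 : 1 + b = cfc (fun t : ℝ => 1 + t) b := by
      rw [cfc_add b (fun _ => 1) (fun t => t) (by fun_prop) (by fun_prop),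
        cfc_const_one ℝ b, cfc_id' ℝ b]
    rw [h3]
    refine cfc_mono (fun t ht => max_le (by linarith [hspec2 t ht]) ?_) (by fun_prop) (by fun_prop)
    rcases le_total 0 t with h0 | h0
    · exact (min_le_left _ _).trans (by linarith)
    · refine (min_le_right _ _).trans ?_
      have := mul_nonpos_of_nonneg_of_nonpos (Nat.cast_nonneg (α := ℝ) m) h0
      linarith [hspec2 t ht]

/-- One step of a binary expansion: p is the first digit of a, and the remainder 2a - p lies again
in [0, 1]. -/
lemma exists_isStarProjection_le_two_smul (hY : IsPredual Y) {a : A} (h0 : 0 ≤ a) (h1 : a ≤ 1) :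
    ∃ p : A, IsStarProjection p ∧ p ≤ (2 : ℝ) • a ∧ (2 : ℝ) • a - 1 ≤ p := by
  have h2 : (0 : A) ≤ (2 : ℝ) • a := smul_nonneg (by norm_num) h0
  obtain ⟨p, hp, h3, h4⟩ := hY.exists_isStarProjection_between (b := (2 : ℝ) • a - 1)
    ((IsSelfAdjoint.of_nonneg h2).sub (.one A)) (by simpa using h2) (by
      have := smul_le_smul_of_nonneg_left h1 (by norm_num : (0 : ℝ) ≤ 2)
      rw [sub_le_iff_le_add]
      refine this.trans (le_of_eq ?_)
      rw [two_smul])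
  exact ⟨p, hp, by simpa using h4, h3⟩

/-- Iterating the binary expansion approximates every element of [0, 1] in norm by combinations of
projections, with error 2⁻ⁿ; positive elements span A. -/
lemma eq_top_of_isStarProjection_mem (hY : IsPredual Y) {S : Submodule ℂ A}
    (hS : IsClosed (S : Set A)) (h : ∀ p : A, IsStarProjection p → p ∈ S) : S = ⊤ := by
  have key (n : ℕ) : ∀ a : A, 0 ≤ a → a ≤ 1 → ∃ s ∈ S, ‖a - s‖ ≤ (1 / 2) ^ n := by
    induction n with
    | zero => exact fun a h0 h1 => ⟨0, S.zero_mem, by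
        simpa using (CStarAlgebra.norm_le_one_iff_of_nonneg a).2 h1⟩
    | succ n ih =>
      intro a h0 h1
      obtain ⟨p, hp, h2, h3⟩ := hY.exists_isStarProjection_le_two_smul h0 h1
      obtain ⟨s, hs, hs'⟩ := ih ((2 : ℝ) • a - p) (sub_nonneg.2 h2) (by
        rw [sub_le_iff_le_add] at h3 ⊢; rwa [add_comm])
      refine ⟨(2⁻¹ : ℂ) • (p + s), S.smul_mem _ (S.add_mem (h p hp) hs), ?_⟩
      have : a - (2⁻¹ : ℂ) • (p + s) = (2⁻¹ : ℂ) • ((2 : ℝ) • a - p - s) := by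
        rw [← Complex.coe_smul]
        push_cast
        module
      rw [this, norm_smul, pow_succ']
      norm_num
      linarith
  have hmem1 (a : A) (h0 : 0 ≤ a) (h1 : a ≤ 1) : a ∈ S := by
    rw [← SetLike.mem_coe, ← hS.closure_eq, Metric.mem_closure_iff]
    intro ε hε
    obtain ⟨n, hn⟩ := exists_pow_lt_of_lt_one hε (by norm_num : (1 / 2 : ℝ) < 1)
    obtain ⟨s, hs, hs'⟩ := key n a h0 h1
    exact ⟨s, hs, by rw [dist_eq_norm]; exact hs'.trans_lt hn⟩
  have hmem (a : A) (h0 : 0 ≤ a) : a ∈ S := by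
    rcases eq_or_ne a 0 with rfl | ha
    · exact S.zero_mem
    have hn : 0 < ‖a‖ := norm_pos_iff.2 ha
    have h1 := hmem1 (‖a‖⁻¹ • a) (smul_nonneg (by positivity) h0) (by
      rw [← CStarAlgebra.norm_le_one_iff_of_nonneg _ (smul_nonneg (by positivity) h0), norm_smul,
        norm_inv, norm_norm, inv_mul_cancel₀ hn.ne'])
    have h2 := S.smul_mem ((‖a‖ : ℝ) : ℂ) h1
    rwa [Complex.coe_smul, smul_smul, mul_inv_cancel₀ hn.ne', one_smul] at h2
  rw [eq_top_iff, ← CStarAlgebra.span_nonneg]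
  exact Submodule.span_le.2 fun a ha => hmem a ha

/-- The functional `a ↦ ψ (c * a)`. -/
lemma comp_mulLeft_mem (hY : IsPredual Y) {ψ : StrongDual ℂ A} (hψ : ψ ∈ Y) (c : A) :
    ψ.comp (ContinuousLinearMap.mul ℂ A c) ∈ Y := by
  let T : A →L[ℂ] StrongDual ℂ A :=
    (ContinuousLinearMap.compL ℂ A A ℂ ψ).comp (ContinuousLinearMap.mul ℂ A)
  -- The admissible multipliers c form a closed subspace, so projections suffice; these are handled
  -- by `weakTendsto_isStarProjection_mul`.
  have h1 : Y.comap (T : A →ₗ[ℂ] StrongDual ℂ A) = ⊤ := by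
    refine hY.eq_top_of_isStarProjection_mem (hY.isClosed.preimage T.continuous) fun p hp => ?_
    refine hY.mem_of_forall_tendsto fun u hu h => ?_
    have := hY.weakTendsto_isStarProjection_mul hp (x := id) hu h ψ hψ
    simpa using! this
  have h2 : c ∈ Y.comap (T : A →ₗ[ℂ] StrongDual ℂ A) := h1 ▸ Submodule.mem_top
  exact h2

lemma comp_mulRight_mem (hY : IsPredual Y) {ψ : StrongDual ℂ A} (hψ : ψ ∈ Y) (c : A) :
    ψ.comp ((ContinuousLinearMap.mul ℂ A).flip c) ∈ Y := by
  have := hY.starFunctional_mem (hY.comp_mulLeft_mem (hY.starFunctional_mem hψ) (star c))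
  convert this using 1
  ext a
  simp

lemma _root_.WeakTendsto.mul_left (hY : IsPredual Y) {l : Filter ι} {x : ι → A} {a : A}
    (h : WeakTendsto Y l x a) (c : A) : WeakTendsto Y l (fun i => c * x i) (c * a) :=
  fun _ hψ => h _ (hY.comp_mulLeft_mem hψ c)

lemma _root_.WeakTendsto.mul_right (hY : IsPredual Y) {l : Filter ι} {x : ι → A} {a : A}
    (h : WeakTendsto Y l x a) (c : A) : WeakTendsto Y l (fun i => x i * c) (a * c) :=
  fun _ hψ => h _ (hY.comp_mulRight_mem hψ c)

end IsPredual

end PredualModule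

/-! ### Positive sesquilinear forms -/

section PositiveForm

variable {V : Type*} [AddCommGroup V] [Module ℂ V] {s : V →ₗ⋆[ℂ] V →ₗ[ℂ] ℂ}

lemma star_apply_of_forall_nonneg (hs : ∀ x, 0 ≤ s x x) (x y : V) : star (s x y) = s y x := by
  have him (z : V) : (s z z).im = 0 := ((Complex.le_def.1 (hs z)).2).symm
  have h1 := him (x + y)
  have h2 := him (x + Complex.I • y)
  simp [him x, him y] at h1 h2
  refine Complex.ext ?_ ?_ <;> simp <;> linarith

/-- A near-minimizer of the quadratic functional nearly represents the linear functional. -/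
lemma norm_sub_apply_sq_le_of_forall_le (hs : ∀ x, 0 ≤ s x x) (g : V →ₗ[ℂ] ℂ) {y : V} {ε : ℝ}
    (hmin : ∀ z, (s y y).re - 2 * (g y).re ≤ (s z z).re - 2 * (g z).re + ε) (x : V) :
    ‖g x - s y x‖ ^ 2 ≤ ε * (s x x).re := by
  set w := g x - s y x with hw
  have hsymm := star_apply_of_forall_nonneg hs
  have hX : 0 ≤ (s x x).re := (Complex.le_def.1 (hs x)).1
  -- Comparing y with y + t w̄ x makes the near-minimality a quadratic inequality in t; its
  -- discriminant gives the estimate.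
  have key (t : ℝ) : 0 ≤ (‖w‖ ^ 2 * (s x x).re) * (t * t) + (-2 * ‖w‖ ^ 2) * t + ε := by
    have h := hmin (y + (t * star w) • x)
    have h1 : (s (y + (t * star w) • x) (y + (t * star w) • x)).re =
        (s y y).re + 2 * (t * star w * s y x).re + t * t * ‖w‖ ^ 2 * (s x x).re := by
      have e1 : s x y = star (s y x) := (hsymm y x).symm
      have e2 : (s x x).im = 0 := ((Complex.le_def.1 (hs x)).2).symm
      simp only [map_add, LinearMap.add_apply, map_smulₛₗ, LinearMap.smul_apply, smul_eq_mul,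
        e1]
      rw [Complex.sq_norm, Complex.normSq_apply]
      simp [e2]
      ring
    have h2 : (g (y + (t * star w) • x)).re = (g y).re + (t * star w * g x).re := by
      simp
    have h3 : (t * star w * g x).re - (t * star w * s y x).re = t * ‖w‖ ^ 2 := by
      rw [← Complex.sub_re, ← mul_sub, ← hw, mul_assoc, Complex.sq_norm]
      simp [Complex.normSq_apply]
    rw [h1, h2] at h
    nlinarith
  have hd := discrim_le_zero key
  rw [discrim] at hd
  rcases (sq_nonneg ‖w‖).eq_or_lt with h0 | h0
  · have := key 0
    rw [← h0]
    have : 0 ≤ ε := by simpa using this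
    positivity
  · have : ‖w‖ ^ 2 * ‖w‖ ^ 2 ≤ ‖w‖ ^ 2 * (ε * (s x x).re) := by nlinarith
    exact le_of_mul_le_mul_left this h0

lemma norm_apply_sq_le (hs : ∀ x, 0 ≤ s x x) (x y : V) :
    ‖s x y‖ ^ 2 ≤ (s x x).re * (s y y).re := by
  have := norm_sub_apply_sq_le_of_forall_le hs 0 (y := x) (ε := (s x x).re) (fun z => by
    have := (Complex.le_def.1 (hs z)).1
    simp at this ⊢
    linarith) y
  simpa using this

/-- Together with the preceding estimate this is an approximate Riesz representation, requiring no
Hilbert space completion: the bound on g makes the quadratic functional bounded below by -K. -/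
lemma exists_norm_sub_apply_sq_le (hs : ∀ x, 0 ≤ s x x) (g : V →ₗ[ℂ] ℂ) {K : ℝ} (hK : 0 ≤ K)
    (hg : ∀ x, ‖g x‖ ^ 2 ≤ K * (s x x).re) {ε : ℝ} (hε : 0 < ε) :
    ∃ y, ∀ z, (s y y).re - 2 * (g y).re ≤ (s z z).re - 2 * (g z).re + ε := by
  have hbdd : BddBelow (Set.range fun z => (s z z).re - 2 * (g z).re) := by
    refine ⟨-K, ?_⟩
    rintro _ ⟨z, rfl⟩
    have h1 : (g z).re ≤ ‖g z‖ := Complex.re_le_norm _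
    have h2 := hg z
    have h3 : 0 ≤ (s z z).re := (Complex.le_def.1 (hs z)).1
    have h4 : 2 * ‖g z‖ ≤ (s z z).re + K := by
      refine (sq_le_sq₀ (by positivity) (by positivity)).1 ?_
      nlinarith [sq_nonneg ((s z z).re - K)]
    dsimp only
    linarith
  obtain ⟨_, ⟨y, rfl⟩, hy⟩ := Real.lt_sInf_add_pos
    (Set.range_nonempty fun z => (s z z).re - 2 * (g z).re) hε
  exact ⟨y, fun z => by
    have := csInf_le hbdd ⟨z, rfl⟩
    dsimp only at hy this ⊢
    linarith⟩

end PositiveForm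

/-! ### Positive functionals in the predual determine the order -/

section PredualPositive

open Filter Topology

variable {A : Type*} [CStarAlgebra A]

/-- The functional `a ↦ ψ (star b * a * b)`. -/
noncomputable def conjFunctional (b : A) (ψ : StrongDual ℂ A) : StrongDual ℂ A :=
  (ψ.comp (ContinuousLinearMap.mul ℂ A (star b))).comp ((ContinuousLinearMap.mul ℂ A).flip b)

@[simp] lemma conjFunctional_apply (b : A) (ψ : StrongDual ℂ A) (a : A) :
    conjFunctional b ψ a = ψ (star b * a * b) := by
  simp [conjFunctional, mul_assoc]

/-- The sesquilinear form `(x, y) ↦ ψ (star x * y)`. -/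
noncomputable def gnsForm (ψ : A →ₗ[ℂ] ℂ) : A →ₗ⋆[ℂ] A →ₗ[ℂ] ℂ :=
  LinearMap.mk₂'ₛₗ (starRingEnd ℂ) (RingHom.id ℂ) (fun x y => ψ (star x * y))
    (by simp [add_mul]) (by simp) (by simp [mul_add]) (by simp)

@[simp] lemma gnsForm_apply (ψ : A →ₗ[ℂ] ℂ) (x y : A) : gnsForm ψ x y = ψ (star x * y) := rfl

variable [PartialOrder A] [StarOrderedRing A]

lemma norm_apply_star_mul_sq_le {ψ : A →ₗ[ℂ] ℂ} (hψ : ∀ a, 0 ≤ a → 0 ≤ ψ a) (x y : A) :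
    ‖ψ (star x * y)‖ ^ 2 ≤ (ψ (star x * x)).re * (ψ (star y * y)).re :=
  norm_apply_sq_le (s := gnsForm ψ) (fun x => hψ _ (star_mul_self_nonneg x)) x y

lemma apply_mono_of_nonneg {ψ : A →ₗ[ℂ] ℂ} (hψ : ∀ a, 0 ≤ a → 0 ≤ ψ a) {a b : A} (h : a ≤ b) :
    ψ a ≤ ψ b := by
  have := hψ _ (sub_nonneg.2 h)
  rwa [map_sub, sub_nonneg] at this

namespace IsPredual

variable {Y : Submodule ℂ (StrongDual ℂ A)}

lemma conjFunctional_mem (hY : IsPredual Y) {ψ : StrongDual ℂ A} (hψ : ψ ∈ Y) (b : A) :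
    conjFunctional b ψ ∈ Y :=
  hY.comp_mulRight_mem (hY.comp_mulLeft_mem hψ _) _

/-- If ψ(p) ≠ 0, rotating ψ by the conjugate of ψ(p) and adding the adjoint functional gives a
hermitian functional with value 2|ψ(p)|² at p. -/
lemma exists_starFunctional_eq (hY : IsPredual Y) {p : A} (hp : IsSelfAdjoint p) (hp0 : p ≠ 0) :
    ∃ ψ ∈ Y, starFunctional ψ = ψ ∧ 0 < (ψ p).re := by
  obtain ⟨ψ, hψ, hψp⟩ : ∃ ψ ∈ Y, ψ p ≠ 0 := by
    by_contra! h
    exact hp0 (hY.separating p h)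
  have h1 : star (ψ p) • ψ ∈ Y := Y.smul_mem _ hψ
  refine ⟨star (ψ p) • ψ + starFunctional (star (ψ p) • ψ),
    Y.add_mem h1 (hY.starFunctional_mem h1), ?_, ?_⟩
  · ext a; simp [add_comm]
  · have h2 : 0 < Complex.normSq (ψ p) := Complex.normSq_pos.2 hψp
    rw [Complex.normSq_apply] at h2
    simp [hp.star_eq]
    linarith

/-- The positive functionals in the predual separate the positive elements from `0`. -/
lemma exists_nonneg_apply_ne_zero (hY : IsPredual Y) {c : A} (hc : 0 ≤ c) (hc0 : c ≠ 0) :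
    ∃ ψ ∈ Y, (∀ a, 0 ≤ a → 0 ≤ ψ a) ∧ ψ c ≠ 0 := by
  have hn : 0 < ‖c‖ := norm_pos_iff.2 hc0
  have ha0 : 0 ≤ ‖c‖⁻¹ • c := smul_nonneg (by positivity) hc
  have hna : ‖‖c‖⁻¹ • c‖ = 1 := by rw [norm_smul, norm_inv, norm_norm, inv_mul_cancel₀ hn.ne']
  obtain ⟨p, hp, hp1, hp2⟩ := hY.exists_isStarProjection_le_two_smul ha0
    ((CStarAlgebra.norm_le_one_iff_of_nonneg _ ha0).1 hna.le)
  have hpne : p ≠ 0 := by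
    rintro rfl
    rw [sub_nonpos] at hp2
    have h1 := (CStarAlgebra.norm_le_one_iff_of_nonneg _ (smul_nonneg (by norm_num) ha0)).2 hp2
    rw [norm_smul, hna] at h1
    norm_num at h1
  have hp0 : 0 ≤ p := hp.nonneg
  obtain ⟨ψ, hψ, hψs, hψp⟩ := hY.exists_starFunctional_eq hp.isSelfAdjoint hpne
  have hreal (x : A) (hx : IsSelfAdjoint x) : (ψ x).im = 0 := by
    have h1 := DFunLike.congr_fun hψs x
    rw [starFunctional_apply, hx.star_eq] at h1
    exact Complex.conj_eq_iff_im.1 h1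
  -- A Hahn decomposition of ψ: weak compactness gives a maximizer x₀ of Re ψ on [0, p], and
  -- compressing ψ by √x₀ makes it positive.
  let K : Set A := {x | 0 ≤ x ∧ x ≤ p}
  have hKb : BddAbove ((fun x => (ψ x).re) '' K) := by
    refine ⟨‖ψ‖ * ‖p‖, ?_⟩
    rintro _ ⟨x, hx, rfl⟩
    refine (Complex.re_le_norm _).trans ((ψ.le_opNorm x).trans ?_)
    gcongr
    exact CStarAlgebra.norm_le_norm_of_nonneg_of_le hx.1 hx.2
  obtain ⟨r, -, hr, hrK⟩ := exists_seq_tendsto_sSup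
    (Set.Nonempty.image (fun x => (ψ x).re) (⟨p, hp0, le_rfl⟩ : K.Nonempty)) hKb
  choose x hxK hxr using hrK
  let u : Ultrafilter ℕ := hyperfilter ℕ
  have hu : (u : Filter ℕ) ≤ atTop := Nat.hyperfilter_le_atTop
  have hxb : ∀ᶠ i in (u : Filter ℕ), ‖x i‖ ≤ ‖p‖ :=
    .of_forall fun i => CStarAlgebra.norm_le_norm_of_nonneg_of_le (hxK i).1 (hxK i).2
  obtain ⟨x₀, -, hx₀⟩ := hY.exists_weakTendsto u hxb
  have hx₀0 : 0 ≤ x₀ := hY.nonneg_of_weakTendsto hxb (.of_forall fun i => (hxK i).1) hx₀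
  have hx₀p : x₀ ≤ p := hY.le_of_weakTendsto hxb (.of_forall fun _ => le_rfl)
    (.of_forall fun i => (hxK i).2) hx₀ (.const p)
  have hmax (y : A) (hy : y ∈ K) : (ψ y).re ≤ (ψ x₀).re := by
    have h1 : Tendsto (fun i => (ψ (x i)).re) u (𝓝 (ψ x₀).re) :=
      (Complex.continuous_re.tendsto _).comp (hx₀ ψ hψ)
    have h2 : Tendsto (fun i => (ψ (x i)).re) u (𝓝 (sSup ((fun x => (ψ x).re) '' K))) := by
      simpa [hxr] using! hr.mono_left hu
    rw [tendsto_nhds_unique h1 h2]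
    exact le_csSup hKb ⟨y, hy, rfl⟩
  set s := CFC.sqrt x₀ with hs
  have hss : s * s = x₀ := CFC.sqrt_mul_sqrt_self x₀
  have hsa : star s = s := (IsSelfAdjoint.of_nonneg (CFC.sqrt_nonneg x₀)).star_eq
  -- Subtracting √x₀ y √x₀ / ‖y‖ from x₀ does not leave [0, p], so by maximality it cannot increase
  -- Re ψ.
  have hpos (y : A) (hy : 0 ≤ y) : 0 ≤ conjFunctional s ψ y := by
    have h0 : 0 ≤ star s * y * s := star_left_conjugate_nonneg hy s
    rw [conjFunctional_apply, Complex.le_def]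
    refine ⟨?_, (hreal _ (.of_nonneg h0)).symm⟩
    rcases eq_or_ne y 0 with rfl | hy0
    · simp
    have hyn : 0 < ‖y‖ := norm_pos_iff.2 hy0
    have h1 : star s * y * s ≤ ‖y‖ • x₀ := by
      have := CStarAlgebra.star_left_conjugate_le_norm_smul (a := s) (b := y)
      rw [hsa, hss] at this
      rwa [hsa]
    have h2 : ‖y‖⁻¹ • (star s * y * s) ≤ x₀ := by
      have := smul_le_smul_of_nonneg_left h1 (inv_nonneg.2 hyn.le)
      rwa [smul_smul, inv_mul_cancel₀ hyn.ne', one_smul] at this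
    have h3 := hmax (x₀ - ‖y‖⁻¹ • (star s * y * s)) ⟨sub_nonneg.2 h2,
      (sub_le_self _ (smul_nonneg (by positivity) h0)).trans hx₀p⟩
    rw [map_sub, ← Complex.coe_smul, map_smul] at h3
    simp only [Complex.sub_re, smul_eq_mul, Complex.re_ofReal_mul] at h3
    have h4 : 0 ≤ ‖y‖⁻¹ * (ψ (star s * y * s)).re := by linarith
    exact nonneg_of_mul_nonneg_right h4 (by positivity)
  refine ⟨conjFunctional s ψ, hY.conjFunctional_mem hψ s, hpos, fun h0 => ?_⟩
  -- As √x₀ lives under p, the compressed functional takes at p the value ψ(x₀), whose real part is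
  -- at least Re ψ(p) > 0. Since p ≤ 2c / ‖c‖, it cannot vanish at c.
  have hsp : s * (1 - p) = 0 := by
    rw [← CStarRing.star_mul_self_eq_zero_iff, star_mul, hsa, mul_assoc, ← mul_assoc s, hss,
      mul_sub, mul_one, (hp.mul_right_and_mul_left_of_nonneg_of_le hx₀0 hx₀p).1, sub_self, mul_zero]
  have h1 : conjFunctional s ψ p = ψ x₀ := by
    rw [mul_sub, mul_one, sub_eq_zero] at hsp
    rw [conjFunctional_apply, hsa, ← hsp, hss]
  have h2 := apply_mono_of_nonneg (ψ := (conjFunctional s ψ : A →ₗ[ℂ] ℂ)) hpos hp1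
  rw [ContinuousLinearMap.coe_coe, h1, smul_smul, ← Complex.coe_smul, map_smul, h0,
    smul_zero] at h2
  have h3 := (Complex.le_def.1 h2).1
  have h4 := hmax p ⟨hp0, le_rfl⟩
  simp at h3
  linarith

/-- With n the negative part of a, n a n = -n³. Compressing by n keeps a functional positive and in
Y, so ψ(n³) = 0 for all positive ψ in Y, whence n = 0. -/
lemma nonneg_of_forall (hY : IsPredual Y) {a : A} (ha : IsSelfAdjoint a)
    (h : ∀ ψ ∈ Y, (∀ b, 0 ≤ b → 0 ≤ ψ b) → 0 ≤ ψ a) : 0 ≤ a := by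
  rw [← CFC.negPart_eq_zero_iff a]
  set n := a⁻ with hn
  have hn0 : 0 ≤ n := CFC.negPart_nonneg a
  have hnsa : star n = n := (IsSelfAdjoint.of_nonneg hn0).star_eq
  have h1 : n * a * n = -(n * n * n) := by
    have h2 : a = a⁺ - n := (CFC.posPart_sub_negPart a).symm
    conv_lhs => rw [h2, mul_sub, CFC.negPart_mul_posPart, zero_sub, neg_mul]
  have h3 : 0 ≤ n * n * n := by simpa [pow_succ] using CStarAlgebra.pow_nonneg hn0 3
  have h4 : n * n * n = 0 := by
    by_contra h5
    obtain ⟨ψ, hψ, hpos, hne⟩ := hY.exists_nonneg_apply_ne_zero h3 h5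
    have h6 := h _ (hY.conjFunctional_mem hψ n) fun b hb => by
      rw [conjFunctional_apply]
      exact hpos _ (star_left_conjugate_nonneg hb n)
    rw [conjFunctional_apply, hnsa, h1, map_neg, neg_nonneg] at h6
    exact hne (le_antisymm h6 (hpos _ h3))
  have h5 : n * n = 0 := by
    rw [← CStarRing.star_mul_self_eq_zero_iff, star_mul, hnsa, ← mul_assoc, h4, zero_mul]
  rwa [← CStarRing.star_mul_self_eq_zero_iff, hnsa]

end IsPredual

end PredualPositive

/-! ### Order-normal functionals are the positive functionals of the predual -/

section NormalFunctionals

open Filter Topology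

lemma PositiveLinearMap.re_nonneg {A : Type*} [CStarAlgebra A] [PartialOrder A]
    (φ : A →ₚ[ℂ] ℂ) {a : A} (ha : 0 ≤ a) : 0 ≤ (φ a).re :=
  (Complex.le_def.1 (map_nonneg φ ha)).1

variable {A : Type*} [CStarAlgebra A] [PartialOrder A] [StarOrderedRing A]

/-- A positive functional as a bounded functional. -/
noncomputable def positiveCLM (φ : A →ₚ[ℂ] ℂ) : StrongDual ℂ A :=
  ⟨φ.toLinearMap, map_continuous φ⟩

@[simp] lemma positiveCLM_apply (φ : A →ₚ[ℂ] ℂ) (a : A) : positiveCLM φ a = φ a := rfl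

namespace IsPredual

variable {Y : Submodule ℂ (StrongDual ℂ A)}

lemma exists_ultrafilter_of_isLUB (hY : IsPredual Y) {D : Set A} (hne : D.Nonempty)
    (hD : DirectedOn (· ≤ ·) D) {x : A} (hx : IsLUB D x) :
    ∃ u : Ultrafilter A, WeakTendsto Y u id x ∧
      (∃ C, ∀ᶠ x in (u : Filter A), ‖x‖ ≤ C) ∧
      ∀ d ∈ D, ∀ᶠ x in (u : Filter A), x ∈ D ∧ d ≤ x := by
  obtain ⟨a, ha, h⟩ := hY.exists_isLUB hne hD hx.bddAbove
  rwa [← ha.unique hx]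

lemma isNormalMap_of_mem (hY : IsPredual Y) {φ : A →ₚ[ℂ] ℂ} (hφ : positiveCLM φ ∈ Y) :
    IsNormalMap φ := by
  intro D hne hD _ x hx
  obtain ⟨u, hu, -, htail⟩ := hY.exists_ultrafilter_of_isLUB hne hD hx
  refine ⟨?_, fun c hc => ?_⟩
  · rintro _ ⟨d, hd, rfl⟩
    exact OrderHomClass.mono φ (hx.1 hd)
  · obtain ⟨d, hd⟩ := hne
    exact le_of_tendsto (hu _ hφ) ((htail d hd).mono fun y hy => hc ⟨y, hy.1, rfl⟩)

/-- A functional that is dominated by the form of a positive functional in the predual is in the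
predual. -/
lemma mem_of_norm_sq_le (hY : IsPredual Y) {ψ : StrongDual ℂ A} (hψ : ψ ∈ Y)
    (hpos : ∀ a, 0 ≤ a → 0 ≤ ψ a) {g : StrongDual ℂ A} {K : ℝ} (hK : 0 ≤ K)
    (hg : ∀ x, ‖g x‖ ^ 2 ≤ K * (ψ (star x * x)).re) : g ∈ Y := by
  have hs : ∀ x, 0 ≤ gnsForm (ψ : A →ₗ[ℂ] ℂ) x x := fun x => hpos _ (star_mul_self_nonneg x)
  rw [← SetLike.mem_coe, ← hY.isClosed.closure_eq, Metric.mem_closure_iff]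
  intro ε hε
  -- An approximate Riesz vector y for g: ψ(y⋆ ·) is in Y, and the tolerance is chosen so that it
  -- differs from g by at most ε / 2 in norm.
  obtain ⟨y, hy⟩ := exists_norm_sub_apply_sq_le hs (g : A →ₗ[ℂ] ℂ) hK hg
    (ε := ε ^ 2 / (4 * (‖ψ‖ + 1))) (by positivity)
  refine ⟨_, hY.comp_mulLeft_mem hψ (star y), ?_⟩
  rw [dist_eq_norm]
  refine lt_of_le_of_lt (ContinuousLinearMap.opNorm_le_bound _ (by positivity) fun x => ?_)
    (half_lt_self hε)
  have h1 := norm_sub_apply_sq_le_of_forall_le hs (g : A →ₗ[ℂ] ℂ) hy x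
  refine (sq_le_sq₀ (norm_nonneg _) (by positivity)).1 (h1.trans ?_)
  have h2 : (gnsForm (ψ : A →ₗ[ℂ] ℂ) x x).re ≤ (‖ψ‖ + 1) * ‖x‖ ^ 2 := by
    refine (Complex.re_le_norm _).trans ((ψ.le_opNorm _).trans ?_)
    rw [CStarRing.norm_star_mul_self, ← sq]
    gcongr
    linarith
  calc ε ^ 2 / (4 * (‖ψ‖ + 1)) * (gnsForm (ψ : A →ₗ[ℂ] ℂ) x x).re
      ≤ ε ^ 2 / (4 * (‖ψ‖ + 1)) * ((‖ψ‖ + 1) * ‖x‖ ^ 2) := by gcongr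
    _ = (ε / 2 * ‖x‖) ^ 2 := by
      have : ‖ψ‖ + 1 ≠ 0 := by positivity
      field_simp
      ring

variable (φ : A →ₚ[ℂ] ℂ)

/-- Above a positive functional `φ` on a part of the interval `[0, c]` there is a functional in the
predual. -/
lemma exists_dominating (hY : IsPredual Y) {c : A} (hc : 0 ≤ c)
    (hc0 : c ≠ 0) : ∃ ψ ∈ Y, (∀ a, 0 ≤ a → 0 ≤ ψ a) ∧ ∃ e, 0 ≤ e ∧ e ≤ c ∧ e ≠ 0 ∧
      ∀ f, 0 ≤ f → f ≤ e → (φ f).re ≤ (ψ f).re := by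
  obtain ⟨ψ₀, hψ₀, hpos₀, hne⟩ := hY.exists_nonneg_apply_ne_zero hc hc0
  have hc1 : 0 < (ψ₀ c).re := by
    have h := Complex.le_def.1 (hpos₀ c hc)
    refine lt_of_le_of_ne h.1 fun h0 => hne (Complex.ext h0.symm h.2.symm)
  -- ψ₀ is scaled so that ψ(c) > φ(c). A maximal d ≤ c with ψ(d) ≤ φ(d) is then different from c.
  obtain ⟨N, hN⟩ := exists_nat_gt ((φ c).re / (ψ₀ c).re)
  rw [div_lt_iff₀ hc1] at hN
  let ψ : StrongDual ℂ A := (N : ℂ) • ψ₀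
  have hψ : ψ ∈ Y := Y.smul_mem _ hψ₀
  have hpos (a : A) (ha : 0 ≤ a) : 0 ≤ ψ a :=
    mul_nonneg (by exact_mod_cast Nat.zero_le N) (hpos₀ a ha)
  have hlt : (φ c).re < (ψ c).re := by simpa [ψ] using hN
  let ψ' : A →ₚ[ℂ] ℂ := PositiveLinearMap.mk₀ (ψ : A →ₗ[ℂ] ℂ) hpos
  have hψ' : IsNormalMap ψ' := hY.isNormalMap_of_mem (φ := ψ') hψ
  let D : Set A := {d | 0 ≤ d ∧ d ≤ c ∧ (ψ d).re ≤ (φ d).re}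
  -- Chains have upper bounds in D because ψ is normal and φ is monotone. By maximality of d, no
  -- nonzero f ≤ c - d can have ψ(f) < φ(f).
  obtain ⟨d, -, hd⟩ := zorn_le_nonempty₀ D (fun C hCD hC y hy => by
    have hb : BddAbove C := ⟨c, fun z hz => (hCD hz).2.1⟩
    obtain ⟨s, hs, -⟩ := hY.exists_isLUB ⟨y, hy⟩ hC.directedOn hb
    have hsa : ∀ z ∈ C, IsSelfAdjoint z := fun z hz => .of_nonneg (hCD hz).1
    refine ⟨s, ⟨(hCD hy).1.trans (hs.1 hy), hs.2 fun z hz => (hCD hz).2.1, ?_⟩, fun z hz => hs.1 hz⟩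
    have h1 := hψ' C ⟨y, hy⟩ hC.directedOn hsa s hs
    have h2 : ψ s ≤ ((φ s).re : ℂ) := h1.2 <| by
      rintro _ ⟨z, hz, rfl⟩
      have h3 := hCD hz
      have h4 := Complex.le_def.1 (OrderHomClass.mono φ (hs.1 hz))
      have h5 := Complex.le_def.1 (hpos z h3.1)
      exact Complex.le_def.2 ⟨h3.2.2.trans h4.1, h5.2.symm⟩
    simpa using (Complex.le_def.1 h2).1) 0 ⟨le_rfl, hc, by simp⟩
  have hdD := hd.prop
  refine ⟨ψ, hψ, hpos, c - d, sub_nonneg.2 hdD.2.1, sub_le_self _ hdD.1, fun h0 => ?_,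
    fun f hf hfe => ?_⟩
  · rw [sub_eq_zero] at h0
    rw [h0] at hlt
    exact absurd hdD.2.2 (not_le.2 hlt)
  · by_contra! hcon
    have h1 : d + f ∈ D := ⟨add_nonneg hdD.1 hf, by rwa [le_sub_iff_add_le'] at hfe, by
      simp only [map_add, Complex.add_re]
      linarith [hdD.2.2]⟩
    have h2 := hd.le_of_ge h1 (le_add_of_nonneg_right hf)
    have h3 : f = 0 := le_antisymm (by simpa using h2) hf
    simp [h3] at hcon

/-- Order-normal positive functionals belong to the predual. -/
lemma mem_of_isNormalMap (hY : IsPredual Y) (hφ : IsNormalMap φ) : positiveCLM φ ∈ Y := by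
  have hφp : ∀ a, 0 ≤ a → 0 ≤ φ.toLinearMap a := fun a ha => map_nonneg φ ha
  let R : A → StrongDual ℂ A := fun a => (positiveCLM φ).comp ((ContinuousLinearMap.mul ℂ A).flip a)
  have hR (a x : A) : R a x = φ (x * a) := rfl
  have hRadd (a b : A) : R (a + b) = R a + R b := by ext; simp [hR, mul_add]
  have hRsub (a b : A) : R (a - b) = R a - R b := by ext; simp [hR, mul_sub]
  -- Cauchy–Schwarz for φ, applied to x√a and √a, turns smallness of φ(a) into smallness of the norm
  -- of φ(· a).
  have hbound (a : A) (ha : 0 ≤ a) (ha1 : a ≤ 1) : ‖R a‖ ≤ √((φ 1).re * (φ a).re) := by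
    have hsq := CFC.sqrt_mul_sqrt_self a
    set s := CFC.sqrt a with hs
    have hsa : star s = s := (IsSelfAdjoint.of_nonneg (CFC.sqrt_nonneg a)).star_eq
    refine ContinuousLinearMap.opNorm_le_bound _ (Real.sqrt_nonneg _) fun x => ?_
    refine (sq_le_sq₀ (norm_nonneg _) (by positivity)).1 ?_
    rw [mul_pow, Real.sq_sqrt (mul_nonneg (φ.re_nonneg zero_le_one) (φ.re_nonneg ha)), hR]
    have h1 := norm_apply_star_mul_sq_le hφp (s * star x) s
    rw [star_mul, star_star, hsa, mul_assoc, hsq] at h1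
    refine h1.trans ?_
    have h2 : x * s * (s * star x) ≤ algebraMap ℝ A (‖x‖ ^ 2) := by
      rw [mul_assoc, ← mul_assoc s, hsq, ← mul_assoc]
      calc x * a * star x ≤ x * 1 * star x := star_right_conjugate_le_conjugate ha1 x
        _ ≤ _ := by rw [mul_one]; exact CStarAlgebra.mul_star_le_algebraMap_norm_sq
    have h3 := (Complex.le_def.1 (apply_mono_of_nonneg hφp h2)).1
    have h4 : (φ.toLinearMap (algebraMap ℝ A (‖x‖ ^ 2))).re = ‖x‖ ^ 2 * (φ 1).re := by
      rw [Algebra.algebraMap_eq_smul_one, ← Complex.coe_smul, map_smul, smul_eq_mul,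
        Complex.re_ofReal_mul]
      rfl
    rw [h4] at h3
    have h5 := φ.re_nonneg ha
    calc _ ≤ ‖x‖ ^ 2 * (φ 1).re * (φ a).re := mul_le_mul_of_nonneg_right h3 h5
      _ = _ := by ring
  let E : Set A := {a | 0 ≤ a ∧ a ≤ 1 ∧ R a ∈ Y}
  -- The supremum s of a chain stays in E: normality makes φ(s - z) arbitrarily small, so R z comes
  -- within ε of R s in norm by `hbound`, and Y is closed. A maximal a is then shown to be 1.
  obtain ⟨a, -, ha⟩ := zorn_le_nonempty₀ E (fun C hCE hC y hy => by
    have hb : BddAbove C := ⟨1, fun z hz => (hCE hz).2.1⟩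
    obtain ⟨s, hs, -⟩ := hY.exists_isLUB ⟨y, hy⟩ hC.directedOn hb
    have hsa : ∀ z ∈ C, IsSelfAdjoint z := fun z hz => .of_nonneg (hCE hz).1
    have hs0 : 0 ≤ s := (hCE hy).1.trans (hs.1 hy)
    have hs1 : s ≤ 1 := hs.2 fun z hz => (hCE hz).2.1
    refine ⟨s, ⟨hs0, hs1, ?_⟩, fun z hz => hs.1 hz⟩
    rw [← SetLike.mem_coe, ← hY.isClosed.closure_eq, Metric.mem_closure_iff]
    intro ε hε
    have h1 := hφ C ⟨y, hy⟩ hC.directedOn hsa s hs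
    set K := (φ 1).re + 1
    have hK : 0 < K := by have := φ.re_nonneg (zero_le_one (α := A)); positivity
    obtain ⟨z, hz, hzs⟩ : ∃ z ∈ C, (φ s).re - (φ z).re < ε ^ 2 / K := by
      by_contra! hcon
      have h2 : φ s ≤ (((φ s).re - ε ^ 2 / K : ℝ) : ℂ) := h1.2 <| by
        rintro _ ⟨z, hz, rfl⟩
        have h5 := Complex.le_def.1 (map_nonneg φ (hCE hz).1)
        refine Complex.le_def.2 ⟨?_, h5.2.symm⟩
        rw [Complex.ofReal_re]
        linarith [hcon z hz]
      have h3 := (Complex.le_def.1 h2).1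
      have : 0 < ε ^ 2 / K := by positivity
      rw [Complex.ofReal_re] at h3
      linarith
    refine ⟨R z, (hCE hz).2.2, ?_⟩
    rw [dist_eq_norm, ← hRsub]
    have hsz : 0 ≤ s - z := sub_nonneg.2 (hs.1 hz)
    refine (hbound _ hsz ((sub_le_self _ (hCE hz).1).trans hs1)).trans_lt ?_
    rw [Real.sqrt_lt' hε, map_sub, Complex.sub_re]
    have h6 : 0 ≤ (φ s).re - (φ z).re := by simpa using φ.re_nonneg hsz
    calc (φ 1).re * ((φ s).re - (φ z).re) ≤ K * ((φ s).re - (φ z).re) := by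
          gcongr
          simp [K]
      _ < K * (ε ^ 2 / K) := by gcongr
      _ = ε ^ 2 := by field_simp) 0 ⟨le_rfl, zero_le_one, by
        have : R 0 = 0 := by ext; simp [hR]
        rw [this]; exact Y.zero_mem⟩
  have haE := ha.prop
  by_cases hc0 : 1 - a = 0
  · have : R a = positiveCLM φ := by
      rw [sub_eq_zero] at hc0
      ext; simp [hR, ← hc0]
    exact this ▸ haE.2.2
  obtain ⟨ψ, hψ, hpos, e, he0, hec, hene, hdom⟩ :=
    hY.exists_dominating φ (sub_nonneg.2 haE.2.1) hc0
  exfalso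
  have hsq := CFC.sqrt_mul_sqrt_self e
  set s := CFC.sqrt e with hs
  have hsa : star s = s := (IsSelfAdjoint.of_nonneg (CFC.sqrt_nonneg e)).star_eq
  -- Since φ ≤ ψ on [0, e], |φ(x√e)|² ≤ φ(1) ψ(√e x⋆x √e): a bound by the form of a functional in Y.
  -- Hence φ(· √e), and so φ(· e), lies in Y, and a + e contradicts maximality.
  have hRs : R s ∈ Y := by
    refine hY.mem_of_norm_sq_le (hY.conjFunctional_mem hψ s) (fun b hb => by
      rw [conjFunctional_apply]; exact hpos _ (star_left_conjugate_nonneg hb s))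
      (φ.re_nonneg (zero_le_one (α := A))) fun x => ?_
    have h1 := norm_apply_star_mul_sq_le hφp 1 (x * s)
    simp only [star_one, one_mul] at h1
    rw [hR, conjFunctional_apply]
    refine h1.trans (mul_le_mul_of_nonneg_left ?_ (φ.re_nonneg zero_le_one))
    rw [star_mul]
    have h2 : star s * star x * (x * s) = star s * (star x * x) * s := by simp only [mul_assoc]
    rw [h2]
    set y := star x * x
    have hy0 : 0 ≤ y := star_mul_self_nonneg x
    rcases eq_or_ne y 0 with hy | hy
    · simp [hy]
    have hyn : 0 < ‖y‖ := norm_pos_iff.2 hy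
    have h3 : star s * y * s ≤ ‖y‖ • e := by
      have := CStarAlgebra.star_left_conjugate_le_norm_smul (a := s) (b := y)
      rw [hsa, hsq] at this
      rwa [hsa]
    have h4 : ‖y‖⁻¹ • (star s * y * s) ≤ e := by
      have := smul_le_smul_of_nonneg_left h3 (inv_nonneg.2 hyn.le)
      rwa [smul_smul, inv_mul_cancel₀ hyn.ne', one_smul] at this
    have h5 := hdom _ (smul_nonneg (by positivity) (star_left_conjugate_nonneg hy0 s)) h4
    rw [← Complex.coe_smul, map_smul, map_smul, smul_eq_mul, smul_eq_mul, Complex.re_ofReal_mul,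
      Complex.re_ofReal_mul] at h5
    exact le_of_mul_le_mul_left h5 (by positivity)
  have hRe : R e ∈ Y := by
    have := hY.comp_mulRight_mem hRs s
    convert this using 1
    ext x
    simp [hR, mul_assoc, hsq]
  have h1 : a + e ∈ E := ⟨add_nonneg haE.1 he0, by rwa [le_sub_iff_add_le'] at hec, by
    rw [hRadd]; exact Y.add_mem haE.2.2 hRe⟩
  have h2 := ha.le_of_ge h1 (le_add_of_nonneg_right he0)
  exact hene (le_antisymm (by simpa using h2) he0)

end IsPredual

end NormalFunctionals

/-! ### Positive `A`-sesquilinear forms -/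

namespace IsSesquilinearForm

variable {A E : Type*} [NonUnitalCStarAlgebra A] [AddCommGroup E] [Module ℂ E] [RightModule A E]
  {s : E → E → A}

lemma add_right (hs : IsSesquilinearForm A E s) (x y z : E) : s x (y + z) = s x y + s x z := by
  simpa using hs.right_linear x y z 1

lemma add_left (hs : IsSesquilinearForm A E s) (x y z : E) : s (x + y) z = s x z + s y z := by
  simpa using hs.left_conj_linear z x y 1

lemma zero_right (hs : IsSesquilinearForm A E s) (x : E) : s x 0 = 0 := by
  simpa using hs.add_right x 0 0

lemma zero_left (hs : IsSesquilinearForm A E s) (x : E) : s 0 x = 0 := by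
  simpa using hs.add_left 0 0 x

lemma smul_right (hs : IsSesquilinearForm A E s) (c : ℂ) (x y : E) : s x (c • y) = c • s x y := by
  simpa [hs.zero_right] using hs.right_linear x 0 y c

lemma smul_left (hs : IsSesquilinearForm A E s) (c : ℂ) (x y : E) :
    s (c • x) y = star c • s x y := by
  simpa [hs.zero_left] using hs.left_conj_linear y 0 x c

lemma neg_right (hs : IsSesquilinearForm A E s) (x y : E) : s x (-y) = -s x y := by
  simpa using hs.smul_right (-1) x y

lemma neg_left (hs : IsSesquilinearForm A E s) (x y : E) : s (-x) y = -s x y := by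
  simpa using hs.smul_left (-1) x y

lemma sub_right (hs : IsSesquilinearForm A E s) (x y z : E) : s x (y - z) = s x y - s x z := by
  rw [sub_eq_add_neg, hs.add_right, hs.neg_right, sub_eq_add_neg]

lemma sub_left (hs : IsSesquilinearForm A E s) (x y z : E) : s (x - y) z = s x z - s y z := by
  rw [sub_eq_add_neg, hs.add_left, hs.neg_left, sub_eq_add_neg]

lemma norm_rsmul_le (hs : IsSesquilinearForm A E s) (x : E) (a : A) :
    √‖s (x <• a) (x <• a)‖ ≤ ‖a‖ * √‖s x x‖ := by
  refine Real.sqrt_le_iff.2 ⟨by positivity, ?_⟩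
  rw [hs.left_rsmul, hs.right_rsmul, mul_pow, Real.sq_sqrt (norm_nonneg _)]
  calc ‖star a * (s x x * a)‖ ≤ ‖star a‖ * (‖s x x‖ * ‖a‖) :=
        (norm_mul_le _ _).trans (by gcongr; exact norm_mul_le _ _)
    _ = ‖a‖ ^ 2 * ‖s x x‖ := by rw [norm_star]; ring

variable [PartialOrder A] [StarOrderedRing A]

lemma star_apply (hs : IsSesquilinearForm A E s) (hpos : ∀ x, 0 ≤ s x x) (x y : E) :
    star (s x y) = s y x := by
  have hsa : ∀ z : E, star (s z z) = s z z := fun z => (hpos z).isSelfAdjoint.star_eq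
  have h1 := hsa (x + y)
  have h2 := congrArg (Complex.I • ·) (hsa (x + Complex.I • y))
  simp only [hs.add_left, hs.add_right, hs.smul_left, hs.smul_right, star_add, star_smul,
    hsa, smul_add, smul_smul, RCLike.star_def, Complex.conj_I, neg_neg, smul_neg,
    Complex.I_mul_I, star_neg, one_smul, neg_smul, neg_mul] at h1 h2
  linear_combination (norm := module) (1 / 2 : ℂ) • h1 + (1 / 2 : ℂ) • h2

/-- The Cauchy–Schwarz inequality. -/
lemma apply_mul_apply_le (hs : IsSesquilinearForm A E s) (hpos : ∀ x, 0 ≤ s x x) (x y : E) :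
    s y x * s x y ≤ ‖s x x‖ • s y y := by
  have hst := hs.star_apply hpos
  -- Positivity at y - x·(t s(x, y)). The best choice is t = 1 / ‖s x x‖; when s x x = 0, large t =
  -- n / 2 shows instead that s(y, x)s(x, y) ≤ 0.
  have key (t : ℝ) : (2 * t - t ^ 2 * ‖s x x‖) • (s y x * s x y) ≤ s y y := by
    have h := hpos (y - x <• ((t : ℂ) • s x y))
    have h1 : s (y - x <• ((t : ℂ) • s x y)) (y - x <• ((t : ℂ) • s x y)) =
        s y y - (2 * t) • (s y x * s x y) + (t ^ 2) • (star (s x y) * s x x * s x y) := by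
      rw [hs.sub_left, hs.sub_right, hs.sub_right, hs.right_rsmul, hs.right_rsmul, hs.left_rsmul,
        hs.left_rsmul, star_smul, hst x y]
      simp only [smul_mul_assoc, mul_smul_comm, RCLike.star_def, Complex.conj_ofReal,
        Complex.coe_smul, smul_smul, mul_assoc]
      module
    have h2 := smul_le_smul_of_nonneg_left (CStarAlgebra.star_left_conjugate_le_norm_smul
      (a := s x y) (b := s x x) (hpos x).isSelfAdjoint) (sq_nonneg t)
    rw [h1] at h
    rw [hst x y] at h h2
    rw [sub_smul, mul_smul (t ^ 2)]
    rw [sub_add, sub_nonneg] at h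
    have h3 := sub_le_sub_left h2 ((2 * t) • (s y x * s x y))
    exact h3.trans h
  rcases (norm_nonneg (s x x)).eq_or_lt with h0 | h0
  · rw [← h0, zero_smul]
    refine nonpos_of_forall_nat_smul_le (c := s y y) fun n => ?_
    have := key (n / 2)
    rwa [← h0, mul_zero, sub_zero, mul_div_cancel₀ _ two_ne_zero] at this
  · have h1 := smul_le_smul_of_nonneg_left (key (‖s x x‖⁻¹)) h0.le
    rw [smul_smul] at h1
    have : ‖s x x‖ * (2 * ‖s x x‖⁻¹ - ‖s x x‖⁻¹ ^ 2 * ‖s x x‖) = 1 := by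
      field_simp
      norm_num
    rwa [this, one_smul] at h1

lemma norm_apply_sq_le (hs : IsSesquilinearForm A E s) (hpos : ∀ x, 0 ≤ s x x) (x y : E) :
    ‖s x y‖ ^ 2 ≤ ‖s x x‖ * ‖s y y‖ := by
  have h := hs.apply_mul_apply_le hpos x y
  rw [← hs.star_apply hpos x y] at h
  have h1 := CStarAlgebra.norm_le_norm_of_nonneg_of_le (star_mul_self_nonneg _) h
  rwa [CStarRing.norm_star_mul_self, norm_smul, norm_norm, ← sq] at h1

lemma norm_apply_le (hs : IsSesquilinearForm A E s) (hpos : ∀ x, 0 ≤ s x x) (x y : E) :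
    ‖s x y‖ ≤ √‖s x x‖ * √‖s y y‖ := by
  rw [← Real.sqrt_mul (norm_nonneg _)]
  exact Real.le_sqrt_of_sq_le (hs.norm_apply_sq_le hpos x y)

/-- The seminorm `x ↦ √‖s x x‖`. -/
noncomputable def seminorm (hs : IsSesquilinearForm A E s) (hpos : ∀ x, 0 ≤ s x x) :
    Seminorm ℂ E :=
  Seminorm.of (fun x => √‖s x x‖)
    (fun x y => by
      refine Real.sqrt_le_iff.2 ⟨by positivity, ?_⟩
      rw [hs.add_left, hs.add_right, hs.add_right]
      have h1 := hs.norm_apply_le hpos x y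
      have h2 := hs.norm_apply_le hpos y x
      have h3 := Real.sq_sqrt (norm_nonneg (s x x))
      have h4 := Real.sq_sqrt (norm_nonneg (s y y))
      have h5 := norm_add₃_le (a := s x x) (b := s x y) (c := s y x)
      have h6 := norm_add_le (s x x + s x y) (s y x + s y y)
      have h7 := norm_add_le (s x x) (s x y)
      have h8 := norm_add_le (s y x) (s y y)
      nlinarith)
    (fun c x => by
      rw [hs.smul_left, hs.smul_right, norm_smul, norm_smul, norm_star, ← mul_assoc, ← sq,
        Real.sqrt_mul (sq_nonneg _), Real.sqrt_sq (norm_nonneg _)])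

/-- Only the additive structure enters the extension, which avoids separate treatment of the
conjugate linear variable; the algebraic identities are recovered later by density. -/
lemma exists_continuous_extension {A E M : Type*} [NonUnitalCStarAlgebra A]
    [SeminormedAddCommGroup E] [NormedSpace ℂ E] [RightModule A E] [NormedAddCommGroup M]
    [NormedSpace ℂ M] {s : E → E → A} (hs : IsSesquilinearForm A E s)
    (hbd : ∀ x y, ‖s x y‖ ≤ ‖x‖ * ‖y‖) (j : E →ₗᵢ[ℂ] M) (hj : DenseRange j) :
    ∃ ip : M → M → A, Continuous (fun p : M × M => ip p.1 p.2) ∧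
      ∀ x y : E, ip (j x) (j y) = s x y := by
  let sL : E →ₗ⋆[ℂ] E →ₗ[ℂ] A := LinearMap.mk₂'ₛₗ (starRingEnd ℂ) (RingHom.id ℂ) s
    hs.add_left hs.smul_left hs.add_right hs.smul_right
  let sC : E →L⋆[ℂ] E →L[ℂ] A := sL.mkContinuous₂ 1 fun x y => by
    rw [one_mul]; exact hbd x y
  have hsC : Continuous fun p : E × E => s p.1 p.2 := by
    have : Continuous fun p : E × E => sC p.1 p.2 := by fun_prop
    exact this
  let φ : E →+ E →+ A := AddMonoidHom.mk' (fun x => AddMonoidHom.mk' (s x) (hs.add_right x))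
    fun x y => by ext z; exact hs.add_left x y z
  have hd : IsDenseInducing (j.toLinearMap.toAddMonoidHom : E →+ M) :=
    ⟨j.isometry.isUniformInducing.isInducing, hj⟩
  exact ⟨fun x y => (hd.prodMap hd).extend (fun p : E × E => φ p.1 p.2) (x, y),
    IsDenseInducing.extend_Z_bilin (φ := φ) hd hd hsC,
    fun x y => IsDenseInducing.extend_eq (hd.prodMap hd) hsC (x, y)⟩

/-- The Hilbert module structure on a space in which the domain of a form is dense. -/
lemma exists_hilbertModule {A E M : Type*} [NonUnitalCStarAlgebra A]
    [SeminormedAddCommGroup E] [NormedSpace ℂ E] [RightModule A E] [PartialOrder A]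
    [StarOrderedRing A] [NormedAddCommGroup M] [NormedSpace ℂ M] [CompleteSpace M] {s : E → E → A}
    (hs : IsSesquilinearForm A E s) (hpos : ∀ x, 0 ≤ s x x) (hnorm : ∀ x, ‖x‖ = √‖s x x‖)
    (j : E →ₗᵢ[ℂ] M) (hj : DenseRange j) :
    ∃ _ : HilbertModule A M, (∀ (x : E) (a : A), j (x <• a) = j x <• a) ∧
      ∀ x y, inner A (j x) (j y) = s x y := by
  obtain ⟨ip, hipc, hip⟩ := hs.exists_continuous_extension (fun x y => by
    rw [hnorm, hnorm]; exact hs.norm_apply_le hpos x y) j hj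
  have hc {T : Type _} [TopologicalSpace T] {f g : T → M} (hf : Continuous f)
      (hg : Continuous g) : Continuous fun t => ip (f t) (g t) := hipc.comp (hf.prodMk hg)
  let R₀ (a : A) : E →ₗ[ℂ] M := j.toLinearMap ∘ₗ
    { toFun := fun x => x <• a
      map_add' := fun x y => RightModule.add_rsmul x y a
      map_smul' := fun c x => RightModule.smul_rsmul c x a }
  -- The right action on M is the continuous extension of the one on E, bounded by `norm_rsmul_le`.
  -- The remaining axioms are closed conditions checked on the dense image.
  let R (a : A) : M →L[ℂ] M := (R₀ a).extendOfNorm j.toLinearMap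
  have hR (a : A) (x : E) : R a (j x) = j (x <• a) :=
    LinearMap.extendOfNorm_eq (e := j.toLinearMap) hj ⟨‖a‖, fun x => by
      change ‖j (x <• a)‖ ≤ ‖a‖ * ‖j x‖
      rw [j.norm_map, j.norm_map, hnorm, hnorm]
      exact hs.norm_rsmul_le x a⟩ x
  have hnormM (x : M) : ‖x‖ = √‖ip x x‖ :=
    hj.induction_on x (isClosed_eq continuous_norm (hc continuous_id continuous_id).norm.sqrt)
      fun x => by rw [hip, j.norm_map, hnorm]
  have hRadd (v : M) (a b : A) : R (a + b) v = R a v + R b v :=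
    hj.induction_on v (isClosed_eq (R _).continuous ((R a).continuous.add (R b).continuous))
      fun v => by rw [hR, hR, hR, RightModule.rsmul_add, map_add]
  have hRmul (v : M) (a b : A) : R (a * b) v = R b (R a v) :=
    hj.induction_on v (isClosed_eq (R _).continuous ((R b).continuous.comp (R a).continuous))
      fun v => by rw [hR, hR, hR, RightModule.rsmul_mul]
  have hRsmul (c : ℂ) (v : M) (a : A) : R (c • a) v = c • R a v :=
    hj.induction_on v (isClosed_eq (R _).continuous ((R a).continuous.const_smul c))
      fun v => by rw [hR, hR, RightModule.rsmul_smul, map_smul]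
  have hright (u v w : M) (c : ℂ) : ip u (v + c • w) = ip u v + c • ip u w := by
    refine hj.induction_on₃ (p := fun u v w => ip u (v + c • w) = ip u v + c • ip u w)
      (isClosed_eq (hc (by fun_prop) (by fun_prop))
        ((hc (by fun_prop) (by fun_prop)).add ((hc (by fun_prop) (by fun_prop)).const_smul c)))
      (fun u v w => ?_) u v w
    rw [← map_smul, ← map_add, hip, hip, hip, hs.right_linear]
  have hleft (u v w : M) (c : ℂ) : ip (v + c • w) u = ip v u + star c • ip w u := by
    refine hj.induction_on₃ (p := fun u v w => ip (v + c • w) u = ip v u + star c • ip w u)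
      (isClosed_eq (hc (by fun_prop) (by fun_prop))
        ((hc (by fun_prop) (by fun_prop)).add ((hc (by fun_prop) (by fun_prop)).const_smul _)))
      (fun u v w => ?_) u v w
    rw [← map_smul, ← map_add, hip, hip, hip, hs.left_conj_linear]
  have hrightR (u v : M) (a : A) : ip u (R a v) = ip u v * a := by
    refine hj.induction_on₂ (p := fun u v => ip u (R a v) = ip u v * a)
      (isClosed_eq (hc (by fun_prop) (by fun_prop))
        ((hc (by fun_prop) (by fun_prop)).mul continuous_const)) (fun u v => ?_) u v
    rw [hR, hip, hip, hs.right_rsmul]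
  have hleftR (u v : M) (a : A) : ip (R a u) v = star a * ip u v := by
    refine hj.induction_on₂ (p := fun u v => ip (R a u) v = star a * ip u v)
      (isClosed_eq (hc (by fun_prop) (by fun_prop))
        (continuous_const.mul (hc (by fun_prop) (by fun_prop)))) (fun u v => ?_) u v
    rw [hR, hip, hip, hs.left_rsmul]
  have hnonneg (x : M) : 0 ≤ ip x x :=
    hj.induction_on x (isClosed_le continuous_const (hc continuous_id continuous_id))
      fun x => by rw [hip]; exact hpos x
  let H : RightModule A M :=
    { smul := fun a x => R a.unop x
      add_rsmul := fun v w a => map_add _ v w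
      rsmul_add := hRadd
      rsmul_mul := hRmul
      smul_rsmul := fun c v a => map_smul _ c v
      rsmul_smul := hRsmul }
  refine ⟨{ toRightModule := H
            inner := ip
            sesquilinear := ⟨hright, hleft, hrightR, hleftR⟩
            inner_self_nonneg := hnonneg
            eq_zero_of_inner_self := fun x hx => ?_
            norm_eq := hnormM
            complete := inferInstance }, fun x a => (hR a x).symm, hip⟩
  change ip x x = 0 at hx
  rw [← norm_eq_zero, hnormM, hx, norm_zero, Real.sqrt_zero]

/-- A positive sesquilinear form has a Hilbert module completion. -/
theorem exists_completion.{u₁, u₂} {A : Type u₁} {E : Type u₂}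
    [NonUnitalCStarAlgebra A] [AddCommGroup E] [Module ℂ E]
    [RightModule A E] [PartialOrder A] [StarOrderedRing A] {s : E → E → A}
    (hs : IsSesquilinearForm A E s) (hpos : ∀ x, 0 ≤ s x x) :
    ∃ (M : Type u₂) (_ : NormedAddCommGroup M) (_ : NormedSpace ℂ M) (_ : HilbertModule A M)
      (j : RightLinearMap A E M), DenseRange j ∧ ∀ x y, inner A (j x) (j y) = s x y := by
  -- The completion of a seminormed space is separated, so null vectors of s need not be divided out
  -- beforehand.
  let _ : SeminormedAddCommGroup E :=
    (hs.seminorm hpos).toAddGroupSeminorm.toSeminormedAddCommGroup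
  let _ : NormedSpace ℂ E := ⟨fun c x => (map_smul_eq_mul (hs.seminorm hpos) c x).le⟩
  obtain ⟨H, hj, hip⟩ := hs.exists_hilbertModule hpos (fun _ => rfl)
    (UniformSpace.Completion.toComplₗᵢ : E →ₗᵢ[ℂ] UniformSpace.Completion E)
    UniformSpace.Completion.denseRange_coe
  exact ⟨UniformSpace.Completion E, inferInstance, inferInstance, H,
    ⟨(UniformSpace.Completion.toComplₗᵢ : E →ₗᵢ[ℂ] UniformSpace.Completion E).toLinearMap, hj⟩,
    UniformSpace.Completion.denseRange_coe, hip⟩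

end IsSesquilinearForm

/-! ### Maps between Hilbert modules -/

lemma RightModule.zero_rsmul {A V : Type*} [NonUnitalRing A] [Module ℂ A] [AddCommGroup V]
    [Module ℂ V] [RightModule A V] (a : A) : (0 : V) <• a = 0 := by
  simpa using RightModule.add_rsmul (0 : V) 0 a

namespace HilbertModule

variable {A M N : Type*} [NonUnitalCStarAlgebra A] [PartialOrder A]
  [NormedAddCommGroup M] [NormedSpace ℂ M] [HilbertModule A M]
  [NormedAddCommGroup N] [NormedSpace ℂ N] [HilbertModule A N]

variable (A) in
lemma norm_sq_eq (x : M) : ‖x‖ ^ 2 = ‖inner A x x‖ := by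
  rw [HilbertModule.norm_eq (A := A) x, Real.sq_sqrt (norm_nonneg _)]

lemma inner_sub_right (x y z : M) : inner A x (y - z) = inner A x y - inner A x z :=
  (HilbertModule.sesquilinear (A := A) (M := M)).sub_right x y z

lemma inner_sub_left (x y z : M) : inner A (x - y) z = inner A x z - inner A y z :=
  (HilbertModule.sesquilinear (A := A) (M := M)).sub_left x y z

lemma inner_rsmul_right (x y : M) (a : A) : inner A x (y <• a) = inner A x y * a :=
  (HilbertModule.sesquilinear (A := A) (M := M)).right_rsmul x y a

lemma inner_rsmul_left (x y : M) (a : A) : inner A (x <• a) y = star a * inner A x y :=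
  (HilbertModule.sesquilinear (A := A) (M := M)).left_rsmul x y a

lemma norm_map_of_inner_map {T : M → N} (h : ∀ x y, inner A (T x) (T y) = inner A x y) (x : M) :
    ‖T x‖ = ‖x‖ := by
  rw [HilbertModule.norm_eq (A := A), h, ← HilbertModule.norm_eq]

/-- A map that preserves inner products is `A`-linear. -/
lemma map_rsmul_of_inner_map {T : M → N} (h : ∀ x y, inner A (T x) (T y) = inner A x y)
    (x : M) (a : A) : T (x <• a) = T x <• a := by
  rw [← sub_eq_zero]
  refine HilbertModule.eq_zero_of_inner_self (A := A) _ ?_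
  simp only [inner_sub_left, inner_sub_right, inner_rsmul_left, inner_rsmul_right, h, mul_assoc,
    sub_self, zero_mul]

variable [StarOrderedRing A]

lemma norm_inner_le (x y : M) : ‖inner A x y‖ ≤ ‖x‖ * ‖y‖ := by
  rw [HilbertModule.norm_eq (A := A) x, HilbertModule.norm_eq (A := A) y]
  exact (HilbertModule.sesquilinear (A := A) (M := M)).norm_apply_le
    HilbertModule.inner_self_nonneg x y

variable (A) in
/-- The bounded map `⟨x | ·⟩`. -/
noncomputable def innerCLM (x : M) : M →L[ℂ] A :=
  LinearMap.mkContinuous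
    { toFun := fun y => inner A x y
      map_add' := inner_add_right' x
      map_smul' := fun c y => inner_smul_right' c x y } ‖x‖ (norm_inner_le x)

lemma continuous_inner_right (x : M) : Continuous fun y : M => inner A x y :=
  (innerCLM A x).continuous

lemma continuous_inner_left (y : M) : Continuous fun x : M => inner A x y := by
  simpa [HilbertModule.star_inner'] using (continuous_inner_right (A := A) y).star

lemma ext_right {x y : M} (h : ∀ z : M, inner A z x = inner A z y) : x = y :=
  HilbertModule.ext_left (A := A) fun z => by
    rw [← HilbertModule.star_inner' z x, h, HilbertModule.star_inner']

lemma ext_right_of_denseRange {ι : Type*} {j : ι → M} (hj : DenseRange j) {x y : M}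
    (h : ∀ i, inner A (j i) x = inner A (j i) y) : x = y :=
  ext_right (A := A) fun z => hj.induction_on z
    (isClosed_eq (continuous_inner_left x) (continuous_inner_left y)) h

/-- A linear map with an adjoint is `A`-linear. -/
lemma map_rsmul_of_inner {T : M → N} {T' : N → M}
    (h : ∀ x y, inner A x (T y) = inner A (T' x) y) (x : M) (a : A) : T (x <• a) = T x <• a :=
  ext_right (A := A) fun z => by rw [h, inner_rsmul_right, inner_rsmul_right, h]

/-- An isometric map on a dense set of generators extends. -/
lemma exists_extension_of_inner {E : Type*} [AddCommGroup E] [Module ℂ E] {j : E →ₗ[ℂ] M}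
    (hj : DenseRange j) (T : E →ₗ[ℂ] N)
    (hT : ∀ x y, inner A (T x) (T y) = inner A (j x) (j y)) :
    ∃ W : RightLinearMap A M N, (∀ x, W (j x) = T x) ∧
      ∀ x y, inner A (W x) (W y) = inner A x y := by
  have : CompleteSpace N := HilbertModule.complete (A := A)
  have hW (x : E) : T.extendOfNorm j (j x) = T x := LinearMap.extendOfNorm_eq hj ⟨1, fun x => by
    rw [one_mul, HilbertModule.norm_eq (A := A) (T x), HilbertModule.norm_eq (A := A) (j x), hT]⟩ x
  have hin (x y : M) : inner A (T.extendOfNorm j x) (T.extendOfNorm j y) = inner A x y := by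
    refine hj.induction_on x (isClosed_eq
      ((continuous_inner_left _).comp (T.extendOfNorm j).continuous) (continuous_inner_left _))
      fun x => ?_
    refine hj.induction_on y (isClosed_eq
      ((continuous_inner_right _).comp (T.extendOfNorm j).continuous) (continuous_inner_right _))
      fun y => ?_
    rw [hW, hW, hT]
  exact ⟨⟨(T.extendOfNorm j : M →ₗ[ℂ] N), map_rsmul_of_inner_map hin⟩, hW, hin⟩

end HilbertModule

namespace adjointable

variable {A M : Type*} [NonUnitalCStarAlgebra A] [PartialOrder A]
  [NormedAddCommGroup M] [NormedSpace ℂ M] [HilbertModule A M]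

lemma ext_of_denseRange {ι : Type*} {j : ι → M} (hj : DenseRange j) {S T : adjointable A M}
    (h : ∀ i, S.1 (j i) = T.1 (j i)) : S = T :=
  Subtype.ext <| ContinuousLinearMap.ext fun x =>
    hj.induction_on x (isClosed_eq S.1.continuous T.1.continuous) h

variable [StarOrderedRing A]

/-- An operator with an adjoint, as an element of `adjointable`. -/
def ofIsAdjointOf (T T' : M →L[ℂ] M) (h : IsAdjointOf (A := A) T' T) : adjointable A M :=
  ⟨T, HilbertModule.map_rsmul_of_inner h, T', HilbertModule.map_rsmul_of_inner h.symm, h⟩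

lemma inner_apply_right (T : adjointable A M) (x y : M) :
    inner A x (T.1 y) = inner A ((star T).1 x) y := isAdjointOf_star T x y

lemma inner_apply_left (T : adjointable A M) (x y : M) :
    inner A (T.1 x) y = inner A x ((star T).1 y) := (isAdjointOf_star T).symm x y |>.symm

lemma star_eq_of_inner {T T' : adjointable A M}
    (h : ∀ x y, inner A x (T.1 y) = inner A (T'.1 x) y) : star T = T' :=
  Subtype.ext ((isAdjointOf_star T).unique h)

/-- A bounded map on generators extends to M, but adjointability must come from a formal adjoint T'
that is bounded on the generators as well. -/
lemma exists_of_dense {E : Type*} [AddCommGroup E] [Module ℂ E] {j : E →ₗ[ℂ] M}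
    (hj : DenseRange j) (T T' : E →ₗ[ℂ] E) (C C' : ℝ) (hT : ∀ x, ‖j (T x)‖ ≤ C * ‖j x‖)
    (hT' : ∀ x, ‖j (T' x)‖ ≤ C' * ‖j x‖)
    (h : ∀ x y, inner A (j x) (j (T y)) = inner A (j (T' x)) (j y)) :
    ∃ P : adjointable A M, ∀ x, P.1 (j x) = j (T x) := by
  have : CompleteSpace M := HilbertModule.complete (A := A)
  have h1 (x : E) : (j ∘ₗ T).extendOfNorm j (j x) = j (T x) :=
    LinearMap.extendOfNorm_eq (f := j ∘ₗ T) hj ⟨C, hT⟩ x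
  have h2 (x : E) : (j ∘ₗ T').extendOfNorm j (j x) = j (T' x) :=
    LinearMap.extendOfNorm_eq (f := j ∘ₗ T') hj ⟨C', hT'⟩ x
  refine ⟨ofIsAdjointOf ((j ∘ₗ T).extendOfNorm j) ((j ∘ₗ T').extendOfNorm j) fun x y => ?_, h1⟩
  refine hj.induction_on x (isClosed_eq (HilbertModule.continuous_inner_left _)
    ((HilbertModule.continuous_inner_left _).comp ((j ∘ₗ T').extendOfNorm j).continuous))
    fun x => ?_
  refine hj.induction_on y (isClosed_eq
    ((HilbertModule.continuous_inner_right _).comp ((j ∘ₗ T).extendOfNorm j).continuous)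
    (HilbertModule.continuous_inner_right _)) fun y => ?_
  rw [h1, h2, h]

end adjointable

/-! ### The minimal dilation -/

section FinsuppModule

variable {A V ι : Type*} [NonUnitalRing A] [Module ℂ A] [AddCommGroup V] [Module ℂ V]
  [RightModule A V]

noncomputable instance : RightModule A (ι →₀ V) where
  smul a x := x.mapRange (fun v => v <• a.unop) (RightModule.zero_rsmul _)
  add_rsmul x y a := Finsupp.ext fun i => RightModule.add_rsmul (x i) (y i) a
  rsmul_add x a b := Finsupp.ext fun i => RightModule.rsmul_add (x i) a b
  rsmul_mul x a b := Finsupp.ext fun i => RightModule.rsmul_mul (x i) a b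
  smul_rsmul c x a := Finsupp.ext fun i => RightModule.smul_rsmul c (x i) a
  rsmul_smul c x a := Finsupp.ext fun i => RightModule.rsmul_smul c (x i) a

lemma Finsupp.rsmul_def (x : ι →₀ V) (a : A) :
    x <• a = x.mapRange (fun v => v <• a) (RightModule.zero_rsmul _) := rfl

lemma Finsupp.single_rsmul (i : ι) (v : V) (a : A) :
    (Finsupp.single i v : ι →₀ V) <• a = Finsupp.single i (v <• a) := by
  rw [Finsupp.rsmul_def, Finsupp.mapRange_single]

end FinsuppModule

/-- Additive functions of formal sums that agree on generators are equal. -/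
lemma Finsupp.biadditive_induction {ι V A : Type*} [AddCommGroup V] [AddCommGroup A]
    {F F' : (ι →₀ V) → (ι →₀ V) → A}
    (h₁ : ∀ x y z, F (x + y) z = F x z + F y z) (h₂ : ∀ x y z, F x (y + z) = F x y + F x z)
    (h₁' : ∀ x y z, F' (x + y) z = F' x z + F' y z) (h₂' : ∀ x y z, F' x (y + z) = F' x y + F' x z)
    (h : ∀ b c v w, F (.single b v) (.single c w) = F' (.single b v) (.single c w))
    (x y : ι →₀ V) : F x y = F' x y := by
  have e (z) : F 0 z = 0 := by simpa using h₁ 0 0 z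
  have e' (z) : F' 0 z = 0 := by simpa using h₁' 0 0 z
  have f (z) : F z 0 = 0 := by simpa using h₂ z 0 0
  have f' (z) : F' z 0 = 0 := by simpa using h₂' z 0 0
  induction x using Finsupp.induction_linear with
  | zero => rw [e, e']
  | add x x' hx hx' => rw [h₁, h₁', hx, hx']
  | single b v =>
    induction y using Finsupp.induction_linear with
    | zero => rw [f, f']
    | add y y' hy hy' => rw [h₂, h₂', hy, hy']
    | single c w => exact h b c v w

/-! ### The form on formal sums and the actions of `B` and `G` -/

section DilationForm

variable {A : Type u} {B : Type v} {V : Type w} [NonUnitalCStarAlgebra A] [CStarAlgebra B]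
  [AddCommGroup V] [Module ℂ V] [RightModule A V]

/-- The form `∑ S_{b⋆c}(v, w)` on formal sums of pairs `(b, v)`. -/
noncomputable def dilationForm (S : B →ₗ[ℂ] sesqForms A V) (x y : ULift.{u} B →₀ V) : A :=
  x.sum fun b v => y.sum fun c w => S (star b.down * c.down) v w

variable (S : B →ₗ[ℂ] sesqForms A V)

lemma dilationForm_single (b c : ULift.{u} B) (v w : V) :
    dilationForm S (.single b v) (.single c w) = S (star b.down * c.down) v w := by
  rw [dilationForm, Finsupp.sum_single_index, Finsupp.sum_single_index]
  · exact (S _).2.zero_right v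
  · exact Finset.sum_eq_zero fun c _ => (S _).2.zero_left _

lemma isSesquilinearForm_dilationForm :
    IsSesquilinearForm A (ULift.{u} B →₀ V) (dilationForm S) where
  right_linear x y z c := by
    simp only [dilationForm]
    rw [Finsupp.smul_sum, ← Finsupp.sum_add]
    refine Finsupp.sum_congr fun b _ => ?_
    rw [Finsupp.sum_add_index' (fun d => (S _).2.zero_right _)
      (fun d v w => (S _).2.add_right _ v w), Finsupp.sum_smul_index'
      (fun d => (S _).2.zero_right _), Finsupp.smul_sum]
    congr 1
    exact Finsupp.sum_congr fun d _ => (S _).2.smul_right _ _ _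
  left_conj_linear x y z c := by
    simp only [dilationForm]
    rw [Finsupp.sum_add_index' (fun b => Finset.sum_eq_zero fun d _ => (S _).2.zero_left _)
      (fun b v w => by
        rw [← Finsupp.sum_add]
        exact Finsupp.sum_congr fun d _ => (S _).2.add_left v w _),
      Finsupp.sum_smul_index' (fun b => Finset.sum_eq_zero fun d _ => (S _).2.zero_left _),
      Finsupp.smul_sum]
    congr 1
    refine Finsupp.sum_congr fun b _ => ?_
    rw [Finsupp.smul_sum]
    exact Finsupp.sum_congr fun d _ => (S _).2.smul_left _ _ _
  right_rsmul x y a := by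
    simp only [dilationForm, Finsupp.rsmul_def]
    rw [Finsupp.sum, Finsupp.sum, Finset.sum_mul]
    refine Finset.sum_congr rfl fun b _ => ?_
    rw [Finsupp.sum_mapRange_index (fun d => (S _).2.zero_right _), Finsupp.sum, Finsupp.sum,
      Finset.sum_mul]
    exact Finset.sum_congr rfl fun d _ => (S _).2.right_rsmul _ _ _
  left_rsmul x y a := by
    simp only [dilationForm, Finsupp.rsmul_def]
    rw [Finsupp.sum_mapRange_index (fun b => Finset.sum_eq_zero fun d _ => (S _).2.zero_left _),
      Finsupp.sum, Finsupp.sum, Finset.mul_sum]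
    refine Finset.sum_congr rfl fun b _ => ?_
    rw [Finsupp.sum, Finsupp.sum, Finset.mul_sum]
    exact Finset.sum_congr rfl fun d _ => (S _).2.left_rsmul _ _ _

lemma dilationForm_self_nonneg [PartialOrder A]
    (hS : ∀ (n : ℕ) (b : Fin n → B) (v : Fin n → V),
      0 ≤ ∑ j, ∑ k, S (star (b j) * b k) (v j) (v k)) (x : ULift.{u} B →₀ V) :
    0 ≤ dilationForm S x x := by
  let e := x.support.equivFin.symm
  have h := hS x.support.card (fun i => (e i).1.down) fun i => x (e i).1
  convert h using 1
  rw [dilationForm, Finsupp.sum, ← Finset.sum_coe_sort, ← e.sum_comp]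
  refine Finset.sum_congr rfl fun i _ => ?_
  rw [Finsupp.sum, ← Finset.sum_coe_sort, ← e.sum_comp]

/-- The action of `B` on formal sums. -/
noncomputable def dilationMul (b : B) : (ULift.{u} B →₀ V) →ₗ[ℂ] (ULift.{u} B →₀ V) :=
  Finsupp.lmapDomain V ℂ fun c => ⟨b * c.down⟩

lemma dilationMul_single (b : B) (c : ULift.{u} B) (v : V) :
    dilationMul b (.single c v) = .single ⟨b * c.down⟩ v := by
  simp [dilationMul, Finsupp.mapDomain_single]

lemma dilationMul_one (x : ULift.{u} B →₀ V) : dilationMul 1 x = x := by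
  induction x using Finsupp.induction_linear with
  | zero => simp
  | add x y hx hy => rw [map_add, hx, hy]
  | single c v => simp [dilationMul_single]

lemma dilationMul_mul (b c : B) (x : ULift.{u} B →₀ V) :
    dilationMul (b * c) x = dilationMul b (dilationMul c x) := by
  induction x using Finsupp.induction_linear with
  | zero => simp
  | add x y hx hy => simp only [map_add, hx, hy]
  | single d v => simp [dilationMul_single, mul_assoc]

lemma dilationForm_dilationMul_right (b : B) (x y : ULift.{u} B →₀ V) :
    dilationForm S x (dilationMul b y) = dilationForm S (dilationMul (star b) x) y := by
  have hs := isSesquilinearForm_dilationForm S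
  refine Finsupp.biadditive_induction (F := fun x y => dilationForm S x (dilationMul b y))
    (F' := fun x y => dilationForm S (dilationMul (star b) x) y)
    (fun _ _ _ => hs.add_left _ _ _) (fun _ _ _ => by rw [map_add, hs.add_right])
    (fun _ _ _ => by rw [map_add, hs.add_left]) (fun _ _ _ => hs.add_right _ _ _)
    (fun c d v w => ?_) x y
  simp only [dilationMul_single, dilationForm_single, star_mul, star_star, mul_assoc]

/-- `dilationMul` is not additive in b on formal sums: (b + c, v) differs from (b, v) + (c, v). The
difference is invisible to the form, so additivity can hold after completion. -/
lemma dilationForm_dilationMul_add (b c : B) (x y : ULift.{u} B →₀ V) :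
    dilationForm S x (dilationMul (b + c) y) =
      dilationForm S x (dilationMul b y) + dilationForm S x (dilationMul c y) := by
  have hs := isSesquilinearForm_dilationForm S
  refine Finsupp.biadditive_induction (F := fun x y => dilationForm S x (dilationMul (b + c) y))
    (F' := fun x y => dilationForm S x (dilationMul b y) + dilationForm S x (dilationMul c y))
    (fun _ _ _ => hs.add_left _ _ _) (fun _ _ _ => by rw [map_add, hs.add_right])
    (fun _ _ _ => by rw [hs.add_left, hs.add_left]; abel)
    (fun _ _ _ => by rw [map_add, map_add, hs.add_right, hs.add_right]; abel)
    (fun d e v w => ?_) x y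
  simp only [dilationMul_single, dilationForm_single, add_mul, mul_add, map_add]
  rfl

lemma dilationForm_dilationMul_algebraMap (r : ℂ) (x y : ULift.{u} B →₀ V) :
    dilationForm S x (dilationMul (algebraMap ℂ B r) y) = r • dilationForm S x y := by
  have hs := isSesquilinearForm_dilationForm S
  refine Finsupp.biadditive_induction
    (F := fun x y => dilationForm S x (dilationMul (algebraMap ℂ B r) y))
    (F' := fun x y => r • dilationForm S x y)
    (fun _ _ _ => hs.add_left _ _ _) (fun _ _ _ => by rw [map_add, hs.add_right])
    (fun _ _ _ => by rw [hs.add_left, smul_add]) (fun _ _ _ => by rw [hs.add_right, smul_add])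
    (fun d e v w => ?_) x y
  simp only [dilationMul_single, dilationForm_single, Algebra.algebraMap_eq_smul_one,
    smul_mul_assoc, one_mul, mul_smul_comm, map_smul]
  rfl

/-- Writing ‖b‖² - b⋆b = c⋆c gives ‖b‖²⟨x, x⟩ = ⟨bx, bx⟩ + ⟨cx, cx⟩, and the last term is positive.
-/
lemma dilationForm_dilationMul_self_le [PartialOrder A] [StarOrderedRing A]
    (hpos : ∀ x, 0 ≤ dilationForm S x x) (b : B) (x : ULift.{u} B →₀ V) :
    dilationForm S (dilationMul b x) (dilationMul b x) ≤ (‖b‖ ^ 2) • dilationForm S x x := by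
  let _ := CStarAlgebra.spectralOrder B
  have := CStarAlgebra.spectralOrderedRing B
  obtain ⟨c, hc⟩ := CStarAlgebra.nonneg_iff_eq_star_mul_self.1
    (sub_nonneg.2 (CStarAlgebra.star_mul_le_algebraMap_norm_sq (a := b)))
  have key (d : B) : dilationForm S (dilationMul d x) (dilationMul d x) =
      dilationForm S x (dilationMul (star d * d) x) := by
    rw [dilationMul_mul, dilationForm_dilationMul_right S (star d), star_star]
  have h1 := hpos (dilationMul c x)
  have h2 : algebraMap ℝ B (‖b‖ ^ 2) = algebraMap ℂ B ((‖b‖ ^ 2 : ℝ) : ℂ) := by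
    rw [Algebra.algebraMap_eq_smul_one, Algebra.algebraMap_eq_smul_one, Complex.coe_smul]
  rw [sub_eq_iff_eq_add, h2] at hc
  have h3 := dilationForm_dilationMul_algebraMap S ((‖b‖ ^ 2 : ℝ) : ℂ) x x
  rw [hc, dilationForm_dilationMul_add, ← key, ← key, Complex.coe_smul] at h3
  rw [← h3]
  exact le_add_of_nonneg_left h1

variable {G : Type*} [Group G] (β : G →* (B ≃⋆ₐ[ℂ] B)) (U : G →* rightGL A V)

/-- The action of `G` on formal sums. -/
noncomputable def dilationU (g : G) : (ULift.{u} B →₀ V) →ₗ[ℂ] (ULift.{u} B →₀ V) :=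
  Finsupp.lmapDomain V ℂ (fun c => ⟨β g c.down⟩) ∘ₗ
    Finsupp.mapRange.linearMap ((U g).1 : V →ₗ[ℂ] V)

lemma dilationU_single (g : G) (c : ULift.{u} B) (v : V) :
    dilationU β U g (.single c v) = .single ⟨β g c.down⟩ ((U g).1 v) := by
  simp [dilationU, Finsupp.mapDomain_single]

lemma dilationU_mul (g h : G) (x : ULift.{u} B →₀ V) :
    dilationU β U (g * h) x = dilationU β U g (dilationU β U h x) := by
  induction x using Finsupp.induction_linear with
  | zero => simp
  | add x y hx hy => simp only [map_add, hx, hy]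
  | single d v => simp [dilationU_single]

lemma dilationU_one (x : ULift.{u} B →₀ V) : dilationU β U 1 x = x := by
  induction x using Finsupp.induction_linear with
  | zero => simp
  | add x y hx hy => simp only [map_add, hx, hy]
  | single d v => simp [dilationU_single]

lemma dilationU_dilationMul (g : G) (b : B) (x : ULift.{u} B →₀ V) :
    dilationU β U g (dilationMul b x) = dilationMul (β g b) (dilationU β U g x) := by
  induction x using Finsupp.induction_linear with
  | zero => simp
  | add x y hx hy => simp only [map_add, hx, hy]
  | single d v => simp [dilationU_single, dilationMul_single]

lemma dilationForm_dilationU [PartialOrder A] (hS : IsCovariantCP β U S) (g : G)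
    (x y : ULift.{u} B →₀ V) :
    dilationForm S (dilationU β U g x) (dilationU β U g y) = dilationForm S x y := by
  have hs := isSesquilinearForm_dilationForm S
  refine Finsupp.biadditive_induction
    (F := fun x y => dilationForm S (dilationU β U g x) (dilationU β U g y))
    (F' := dilationForm S) (fun _ _ _ => by rw [map_add, hs.add_left])
    (fun _ _ _ => by rw [map_add, hs.add_right]) hs.add_left hs.add_right
    (fun d e v w => ?_) x y
  have hU (v : V) : (U g⁻¹).1 ((U g).1 v) = v := by
    rw [map_inv]
    exact LinearEquiv.symm_apply_apply _ _
  simp only [dilationU_single, dilationForm_single, ← map_star, ← map_mul]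
  rw [hS.covariant, hU, hU]

end DilationForm

/-! ### Existence of the minimal dilation -/

section Existence

variable {A : Type u} {B : Type v} {V : Type w} [NonUnitalCStarAlgebra A] [CStarAlgebra B]
  [AddCommGroup V] [Module ℂ V] [RightModule A V] [PartialOrder A] [StarOrderedRing A]
  {G : Type*} [Group G] {β : G →* (B ≃⋆ₐ[ℂ] B)} {U : G →* rightGL A V}
  {S : B →ₗ[ℂ] sesqForms A V}

/-- Every covariant completely positive map has a minimal covariant dilation. -/
theorem IsCovariantCP.exists_minimal_dilation (hS : IsCovariantCP β U S) :
    ∃ (M : Type (max u v w)) (_ : NormedAddCommGroup M) (_ : NormedSpace ℂ M)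
      (_ : HilbertModule A M) (π : B →⋆ₐ[ℂ] adjointable A M) (J : RightLinearMap A V M)
      (Ut : G →* unitary (adjointable A M)),
      Dilates S π J ∧ Dense (dilationSpan π J : Set M) ∧ Intertwines β U π J Ut := by
  have hs := isSesquilinearForm_dilationForm S
  have hpos := dilationForm_self_nonneg S hS.completely_positive
  -- The completion lives in the universe of the formal sums; the lift of B places it in `Type (max
  -- u v w)`.
  obtain ⟨M, _, _, _, j, hj, hin⟩ := hs.exists_completion hpos
  have hnorm (x) : ‖j x‖ ^ 2 = ‖dilationForm S x x‖ := by
    rw [HilbertModule.norm_sq_eq A, hin]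
  have hmul (b : B) (x) : ‖j (dilationMul b x)‖ ≤ ‖b‖ * ‖j x‖ := by
    refine le_of_sq_le_sq ?_ (by positivity)
    rw [mul_pow, hnorm, hnorm]
    refine (CStarAlgebra.norm_le_norm_of_nonneg_of_le (hpos _)
      (dilationForm_dilationMul_self_le S hpos b x)).trans ?_
    rw [norm_smul, Real.norm_of_nonneg (by positivity)]
  have hP (b : B) : ∃ P : adjointable A M, ∀ x, P.1 (j x) = j (dilationMul b x) :=
    adjointable.exists_of_dense (j := j.toLinearMap) hj (dilationMul b) (dilationMul (star b))
      ‖b‖ ‖star b‖ (hmul b) (hmul (star b)) fun x y => by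
        rw [hin, hin, dilationForm_dilationMul_right]
  choose P hP using hP
  -- Operator identities are tested inside inner products of dense vectors, since several of them
  -- hold on formal sums only up to null vectors.
  have hext {T T' : adjointable A M} (h : ∀ x y, inner A (j x) (T.1 (j y)) =
      inner A (j x) (T'.1 (j y))) : T = T' :=
    adjointable.ext_of_denseRange hj fun y => HilbertModule.ext_right_of_denseRange (A := A) hj
      fun x => h x y
  let π : B →⋆ₐ[ℂ] adjointable A M :=
    { toFun := P
      map_one' := hext fun x y => by rw [hP, dilationMul_one]; rfl
      map_mul' := fun b c => hext fun x y => by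
        rw [hP, dilationMul_mul, ← hP, ← hP]; rfl
      map_zero' := hext fun x y => by
        have h := dilationForm_dilationMul_algebraMap S 0 x y
        rw [map_zero, zero_smul] at h
        rw [hP, hin, h]
        exact (HilbertModule.inner_zero_right' _).symm
      map_add' := fun b c => hext fun x y => by
        change _ = inner A (j x) ((P b).1 (j y) + (P c).1 (j y))
        rw [HilbertModule.inner_add_right', hP, hP, hP, hin, hin, hin,
          dilationForm_dilationMul_add]
      commutes' := fun r => hext fun x y => by
        change _ = inner A (j x) (r • j y)
        rw [HilbertModule.inner_smul_right', hP, hin, hin, dilationForm_dilationMul_algebraMap]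
      map_star' := fun b => (adjointable.star_eq_of_inner fun x y => by
        refine hj.induction_on x (isClosed_eq (HilbertModule.continuous_inner_left _)
          ((HilbertModule.continuous_inner_left _).comp (P _).1.continuous)) fun x => ?_
        refine hj.induction_on y (isClosed_eq
          ((HilbertModule.continuous_inner_right _).comp (P _).1.continuous)
          (HilbertModule.continuous_inner_right _)) fun y => ?_
        rw [hP, hP, hin, hin, dilationForm_dilationMul_right]).symm }
  have hπ (b : B) (x) : (π b).1 (j x) = j (dilationMul b x) := hP b x
  let J : RightLinearMap A V M :=
    { toLinearMap := j.toLinearMap ∘ₗ Finsupp.lsingle ⟨1⟩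
      map_rsmul := fun v a => by
        change j (Finsupp.single _ (v <• a)) = j (Finsupp.single _ v) <• a
        rw [← Finsupp.single_rsmul]
        exact j.map_rsmul _ a }
  have hJ (v : V) : J v = j (.single ⟨1⟩ v) := rfl
  have hπJ (b : B) (v : V) : (π b).1 (J v) = j (.single ⟨b⟩ v) := by
    rw [hJ, hπ, dilationMul_single]
    simp
  have hUin (g : G) (x y) : inner A (j x) (j (dilationU β U g y)) =
      inner A (j (dilationU β U g⁻¹ x)) (j y) := by
    rw [hin, hin, ← dilationForm_dilationU S β U hS g (dilationU β U g⁻¹ x),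
      ← dilationU_mul, mul_inv_cancel, dilationU_one]
  have hUnorm (g : G) (x) : ‖j (dilationU β U g x)‖ ≤ 1 * ‖j x‖ := by
    refine le_of_sq_le_sq ?_ (by positivity)
    rw [one_mul, hnorm, hnorm, dilationForm_dilationU S β U hS]
  have hQ (g : G) : ∃ P : adjointable A M, ∀ x, P.1 (j x) = j (dilationU β U g x) :=
    adjointable.exists_of_dense (j := j.toLinearMap) hj (dilationU β U g) (dilationU β U g⁻¹)
      1 1 (hUnorm g) (hUnorm g⁻¹) (hUin g)
  choose Q hQ using hQ
  have hQ1 : Q 1 = 1 := hext fun x y => by rw [hQ, dilationU_one]; rfl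
  have hQmul (g h : G) : Q (g * h) = Q g * Q h := hext fun x y => by
    rw [hQ, dilationU_mul, ← hQ, ← hQ]; rfl
  have hQstar (g : G) : star (Q g) = Q g⁻¹ := adjointable.star_eq_of_inner fun x y => by
    refine hj.induction_on x (isClosed_eq (HilbertModule.continuous_inner_left _)
      ((HilbertModule.continuous_inner_left _).comp (Q _).1.continuous)) fun x => ?_
    refine hj.induction_on y (isClosed_eq
      ((HilbertModule.continuous_inner_right _).comp (Q _).1.continuous)
      (HilbertModule.continuous_inner_right _)) fun y => ?_
    rw [hQ, hQ, hUin]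
  let Ut : G →* unitary (adjointable A M) :=
    { toFun := fun g => ⟨Q g, Unitary.mem_iff.2 ⟨by rw [hQstar, ← hQmul, inv_mul_cancel, hQ1],
        by rw [hQstar, ← hQmul, mul_inv_cancel, hQ1]⟩⟩
      map_one' := Subtype.ext hQ1
      map_mul' := fun g h => Subtype.ext (hQmul g h) }
  refine ⟨M, _, _, _, π, J, Ut, fun b v w => ?_, ?_, fun g v => ?_, fun g b => ?_⟩
  · rw [hπJ, hJ, hin, dilationForm_single, star_one, one_mul]
  · refine hj.mono ?_
    rintro _ ⟨x, rfl⟩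
    induction x using Finsupp.induction_linear with
    | zero => exact (map_zero j.toLinearMap).symm ▸ zero_mem _
    | add x y hx hy => exact (map_add j.toLinearMap x y).symm ▸ add_mem hx hy
    | single b v => exact Submodule.subset_span ⟨b.down, v, (hπJ _ _).symm⟩
  · change _ = (Q g).1 _
    rw [hJ, hJ, hQ, dilationU_single]
    simp
  · refine hext fun x y => ?_
    change inner A (j x) ((Q g).1 ((π b).1 (j y))) = inner A (j x) ((π (β g b)).1 ((Q g).1 (j y)))
    rw [hQ, hπ, hQ, hπ, dilationU_dilationMul]

end Existence

/-! ### Uniqueness of the minimal dilation, and the converse -/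

section Uniqueness

variable {A B V G M N : Type*} [NonUnitalCStarAlgebra A] [CStarAlgebra B]
  [AddCommGroup V] [Module ℂ V] [RightModule A V] [PartialOrder A] [StarOrderedRing A]
  [Group G] {β : G →* (B ≃⋆ₐ[ℂ] B)} {U : G →* rightGL A V} {S : B →ₗ[ℂ] sesqForms A V}
  [NormedAddCommGroup M] [NormedSpace ℂ M] [HilbertModule A M]
  [NormedAddCommGroup N] [NormedSpace ℂ N] [HilbertModule A N]
  {π : B →⋆ₐ[ℂ] adjointable A M} {J : RightLinearMap A V M} {Ut : G →* unitary (adjointable A M)}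
  {π' : B →⋆ₐ[ℂ] adjointable A N} {J' : RightLinearMap A V N}
  {Ut' : G →* unitary (adjointable A N)}

/-- The Gram kernel of the generators is determined by S; all uniqueness statements rest on this. -/
lemma Dilates.inner_eq (h : Dilates S π J) (b c : B) (v w : V) :
    inner A ((π b).1 (J v)) ((π c).1 (J w)) = S (star b * c) v w := by
  rw [h, map_mul, map_star, adjointable.inner_apply_left]
  rfl

/-- Density is needed only in the source. The target may be any dilation, so the minimal one also
embeds into each self-dual dilation. -/
lemma Dilates.exists_isometry (h : Dilates S π J) (hd : Dense (dilationSpan π J : Set M))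
    (h' : Dilates S π' J') :
    ∃ W : RightLinearMap A M N, (∀ b v, W ((π b).1 (J v)) = (π' b).1 (J' v)) ∧
      ∀ x y, inner A (W x) (W y) = inner A x y := by
  let j : (B →₀ V) →ₗ[ℂ] M := Finsupp.lsum ℂ fun b => ((π b).1 : M →ₗ[ℂ] M) ∘ₗ J.toLinearMap
  let T : (B →₀ V) →ₗ[ℂ] N := Finsupp.lsum ℂ fun b => ((π' b).1 : N →ₗ[ℂ] N) ∘ₗ J'.toLinearMap
  have hj (b : B) (v : V) : j (.single b v) = (π b).1 (J v) := by simp [j]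
  have hT (b : B) (v : V) : T (.single b v) = (π' b).1 (J' v) := by simp [T]
  have hdj : DenseRange j := by
    refine hd.mono ?_
    rw [← LinearMap.coe_range]
    refine Submodule.span_le.2 ?_
    rintro _ ⟨b, v, rfl⟩
    exact ⟨_, hj b v⟩
  obtain ⟨W, hW, hWi⟩ := HilbertModule.exists_extension_of_inner (A := A) hdj T fun x y => by
    refine Finsupp.biadditive_induction (F := fun x y => inner A (T x) (T y))
      (F' := fun x y => inner A (j x) (j y)) ?_ ?_ ?_ ?_ ?_ x y
    · intro x y z; rw [map_add, HilbertModule.inner_add_left']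
    · intro x y z; rw [map_add, HilbertModule.inner_add_right']
    · intro x y z; rw [map_add, HilbertModule.inner_add_left']
    · intro x y z; rw [map_add, HilbertModule.inner_add_right']
    · intro b c v w; rw [hj, hj, hT, hT, h.inner_eq, h'.inner_eq]
  exact ⟨W, fun b v => by rw [← hj, hW, hT], hWi⟩

/-- A unitary map that matches the generating vectors is an equivalence of quadruples, as soon as
the generating vectors separate the points of the target. -/
lemma isEquivalence_of_map_generators (hi : Intertwines β U π J Ut)
    (hi' : Intertwines β U π' J' Ut')
    (hsep : ∀ x : N, (∀ b v, inner A ((π' b).1 (J' v)) x = 0) → x = 0) (W : HilbertUnitary A M N)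
    (hW : ∀ b v, W ((π b).1 (J v)) = (π' b).1 (J' v)) : IsEquivalence W π J Ut π' J' Ut' := by
  -- Operators are moved by their adjoints onto the generators, where W is known. No norm density is
  -- used, so the argument also covers τ₁- and τ₂-dense spans.
  have hext {x y : N} (h : ∀ b v, inner A ((π' b).1 (J' v)) x = inner A ((π' b).1 (J' v)) y) :
      x = y := sub_eq_zero.1 (hsep _ fun b v => by
        rw [HilbertModule.inner_sub_right, h, sub_self])
  have hWi (x y : M) : inner A (W x) (W y) = inner A x y := W.inner_map x y
  have hgen (b : B) (v : V) (g : G) :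
      (Ut g).1.1 ((π b).1 (J v)) = (π (β g b)).1 (J ((U g).1 v)) := by
    rw [hi.map_J]
    exact congrArg (fun T => T.1 (J v)) (hi.map_π g b)
  have hgen' (b : B) (v : V) (g : G) :
      (Ut' g).1.1 ((π' b).1 (J' v)) = (π' (β g b)).1 (J' ((U g).1 v)) := by
    rw [hi'.map_J]
    exact congrArg (fun T => T.1 (J' v)) (hi'.map_π g b)
  have hstar (g : G) : star (Ut g).1 = (Ut g⁻¹).1 := by rw [map_inv]; rfl
  have hstar' (g : G) : star (Ut' g).1 = (Ut' g⁻¹).1 := by rw [map_inv]; rfl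
  refine ⟨fun v => ?_, fun b x => hext fun c v => ?_, fun g x => hext fun c v => ?_⟩
  · have h := hW 1 v
    rw [map_one, map_one] at h
    exact h
  · rw [← hW, hWi, adjointable.inner_apply_right, adjointable.inner_apply_right, ← map_star,
      ← map_star]
    have e : (π (star b)).1 ((π c).1 (J v)) = (π (star b * c)).1 (J v) := by rw [map_mul]; rfl
    have e' : (π' (star b)).1 (W ((π c).1 (J v))) = (π' (star b * c)).1 (J' v) := by
      rw [hW, map_mul]; rfl
    rw [e, e', ← hW, hWi]
  · rw [← hW, hWi, adjointable.inner_apply_right, adjointable.inner_apply_right, hstar, hstar',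
      hgen, hW, hgen', ← hW, hWi]

theorem Dilates.exists_equivalence (h : Dilates S π J) (hd : Dense (dilationSpan π J : Set M))
    (hi : Intertwines β U π J Ut) (h' : Dilates S π' J')
    (hd' : Dense (dilationSpan π' J' : Set N)) (hi' : Intertwines β U π' J' Ut') :
    ∃ W : HilbertUnitary A M N, IsEquivalence W π J Ut π' J' Ut' := by
  have : CompleteSpace M := HilbertModule.complete (A := A)
  obtain ⟨W, hW, hWi⟩ := h.exists_isometry hd h'
  have hiso : Isometry W.toLinearMap :=
    AddMonoidHomClass.isometry_of_norm _ (HilbertModule.norm_map_of_inner_map hWi)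
  have hsurj : Function.Surjective W.toLinearMap := by
    have hsub : dilationSpan π' J' ≤ LinearMap.range W.toLinearMap := Submodule.span_le.2 (by
      rintro _ ⟨b, v, rfl⟩
      exact ⟨_, hW b v⟩)
    have hcl : IsClosed (Set.range W.toLinearMap) := hiso.isClosedEmbedding.isClosed_range
    exact Set.range_eq_univ.1 (hcl.closure_eq.symm.trans
      (hd'.mono (fun _ hx => hsub hx)).closure_eq)
  refine ⟨⟨W, ⟨hiso.injective, hsurj⟩, hWi⟩, isEquivalence_of_map_generators hi hi' ?_ _ hW⟩
  intro x hx
  refine HilbertModule.ext_left (A := A) fun z => ?_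
  rw [HilbertModule.inner_zero_left', ← HilbertModule.star_inner' z x, star_eq_zero]
  refine hd'.induction (fun z hz => ?_) (isClosed_eq (HilbertModule.continuous_inner_left _)
    continuous_const) z
  induction hz using Submodule.span_induction with
  | mem z hz => obtain ⟨b, v, rfl⟩ := hz; exact hx b v
  | zero => exact HilbertModule.inner_zero_left' x
  | add y z _ _ hy hz => rw [HilbertModule.inner_add_left', hy, hz, add_zero]
  | smul c z _ hz => rw [HilbertModule.inner_smul_left', hz, smul_zero]

/-- A covariant quadruple defines a covariant completely positive map. -/
theorem Intertwines.exists_isCovariantCP (hi : Intertwines β U π J Ut) :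
    ∃ S : B →ₗ[ℂ] sesqForms A V, Dilates S π J ∧ IsCovariantCP β U S := by
  have hJ (v : V) (a : A) : J (v <• a) = J v <• a := J.map_rsmul v a
  let S : B →ₗ[ℂ] sesqForms A V :=
    { toFun := fun b => ⟨fun v w => inner A (J v) ((π b).1 (J w)), by
        constructor
        · intro x y z c
          rw [map_add, map_smul, map_add, map_smul, HilbertModule.inner_add_right',
            HilbertModule.inner_smul_right']
        · intro x y z c
          rw [map_add, map_smul, HilbertModule.inner_add_left', HilbertModule.inner_smul_left']
        · intro x y a
          rw [hJ, (π b).2.1, HilbertModule.inner_rsmul_right]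
        · intro x y a
          rw [hJ, HilbertModule.inner_rsmul_left]⟩
      map_add' := fun b c => by
        refine Subtype.ext (funext₂ fun v w => ?_)
        change inner A _ _ = inner A _ _ + inner A _ _
        rw [map_add, ← HilbertModule.inner_add_right']
        rfl
      map_smul' := fun r b => by
        refine Subtype.ext (funext₂ fun v w => ?_)
        change inner A _ _ = r • inner A _ _
        rw [map_smul, ← HilbertModule.inner_smul_right']
        rfl }
  have hD : Dilates S π J := fun b v w => rfl
  have hstar (g : G) : star (Ut g).1 = (Ut g⁻¹).1 := by rw [map_inv]; rfl
  refine ⟨S, hD, fun n b v => ?_, fun g b v w => ?_⟩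
  · have h := HilbertModule.inner_self_nonneg (A := A) (∑ j, (π (b j)).1 (J (v j)))
    have hsum (s t : Finset (Fin n)) : inner A (∑ j ∈ s, (π (b j)).1 (J (v j)))
        (∑ k ∈ t, (π (b k)).1 (J (v k))) =
        ∑ j ∈ s, ∑ k ∈ t, S (star (b j) * b k) (v j) (v k) := by
      induction s using Finset.cons_induction with
      | empty => simp [HilbertModule.inner_zero_left']
      | cons i s hi ih =>
        rw [Finset.sum_cons, HilbertModule.inner_add_left', ih, Finset.sum_cons]
        congr 1
        exact (map_sum (HilbertModule.innerCLM A _) _ _).trans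
          (Finset.sum_congr rfl fun k _ => hD.inner_eq _ _ _ _)
    rwa [hsum] at h
  · rw [hD, hD, hi.map_J, hi.map_J, ← hstar, ← adjointable.inner_apply_right]
    have e : (Ut g).1 * (π b * star (Ut g).1) = π (β g b) := by
      rw [← mul_assoc, hi.map_π, mul_assoc, Unitary.mul_star_self_of_mem (Ut g).2, mul_one]
    rw [← e]
    rfl

end Uniqueness

/-! ### Approximation of bounded `A`-linear functionals -/

section Approximation

open Filter Topology

variable {A : Type*} [CStarAlgebra A] [PartialOrder A]

/-- The scalar form `(x, y) ↦ ψ ⟨x | y⟩`. -/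
noncomputable def HilbertModule.scalarForm (M : Type*) [NormedAddCommGroup M] [NormedSpace ℂ M]
    [HilbertModule A M] (ψ : A →ₗ[ℂ] ℂ) : M →ₗ⋆[ℂ] M →ₗ[ℂ] ℂ :=
  LinearMap.mk₂'ₛₗ (starRingEnd ℂ) (RingHom.id ℂ) (fun x y => ψ (inner A x y))
    (by simp [HilbertModule.inner_add_left']) (by simp [HilbertModule.inner_smul_left'])
    (by simp [HilbertModule.inner_add_right'])
    (by simp [HilbertModule.inner_smul_right'])

@[simp] lemma HilbertModule.scalarForm_apply {M : Type*} [NormedAddCommGroup M]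
    [NormedSpace ℂ M] [HilbertModule A M] (ψ : A →ₗ[ℂ] ℂ) (x y : M) :
    HilbertModule.scalarForm M ψ x y = ψ (inner A x y) := rfl

variable [StarOrderedRing A]

/-- An invertible square root of `N + δ`. -/
lemma exists_regularized_sqrt {N : A} (hN : 0 ≤ N) {δ : ℝ} (hδ : 0 < δ) :
    ∃ r s : A, star r = r ∧ star s = s ∧ r * s = 1 ∧ s * r = 1 ∧
      s * s = N + (δ : ℂ) • (1 : A) := by
  have hδ1 : 0 ≤ (δ : ℂ) • (1 : A) := by
    rw [Complex.coe_smul]; exact smul_nonneg hδ.le zero_le_one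
  have h0 : 0 ≤ N + (δ : ℂ) • (1 : A) := add_nonneg hN hδ1
  have hu : IsUnit (N + (δ : ℂ) • (1 : A)) := by
    refine CStarAlgebra.isUnit_of_le ((δ : ℂ) • (1 : A)) (le_add_of_nonneg_left hN)
      (h := ?_)
    rw [Complex.coe_smul, ← Algebra.algebraMap_eq_smul_one]
    exact isStrictlyPositive_algebraMap hδ
  set s := CFC.sqrt (N + (δ : ℂ) • (1 : A)) with hs
  have hss : s * s = N + (δ : ℂ) • (1 : A) := CFC.sqrt_mul_sqrt_self _ h0
  have hsa : star s = s := (IsSelfAdjoint.of_nonneg (CFC.sqrt_nonneg _)).star_eq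
  have hsu : IsUnit s := by
    rw [← hss] at hu
    exact (Commute.isUnit_mul_iff rfl).1 hu |>.1
  obtain ⟨v, hv⟩ := hsu
  refine ⟨↑v⁻¹, s, ?_, hsa, by simp [← hv], by simp [← hv], hss⟩
  rw [← Units.coe_star, star_inv]
  congr 2
  ext
  rw [Units.coe_star, hv, hsa]

/-- Positive functionals are hermitian. -/
lemma apply_star_of_nonneg {ψ : A →ₗ[ℂ] ℂ} (hψ : ∀ a, 0 ≤ a → 0 ≤ ψ a) (a : A) :
    ψ (star a) = star (ψ a) := by
  have h := star_apply_of_forall_nonneg (s := gnsForm ψ) (fun x => hψ _ (star_mul_self_nonneg x))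
    1 a
  simpa using h.symm

lemma apply_re_mono_of_nonneg {ψ : A →ₗ[ℂ] ℂ} (hψ : ∀ a, 0 ≤ a → 0 ≤ ψ a) {a b : A}
    (h : a ≤ b) : (ψ a).re ≤ (ψ b).re := (Complex.le_def.1 (apply_mono_of_nonneg hψ h)).1

variable {M : Type*} [NormedAddCommGroup M] [NormedSpace ℂ M] [HilbertModule A M]

namespace HilbertModule

lemma norm_le_of_inner_self_le {x : M} {c : ℝ} (hc : 0 ≤ c) {a : A} (h : inner A x x ≤ a)
    (ha : ‖a‖ ≤ c ^ 2) : ‖x‖ ≤ c := by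
  refine le_of_sq_le_sq ?_ hc
  rw [norm_sq_eq A]
  exact (CStarAlgebra.norm_le_norm_of_nonneg_of_le (inner_self_nonneg x) h).trans ha

lemma inner_self_le_one {x : M} (hx : ‖x‖ ≤ 1) : inner A x x ≤ 1 := by
  refine (CStarAlgebra.norm_le_one_iff_of_nonneg _ (inner_self_nonneg x)).1 ?_
  rw [← norm_sq_eq A]
  exact pow_le_one₀ (norm_nonneg x) hx

/-- Every vector is a normalized vector times an invertible one. -/
lemma exists_norm_le_one (x : M) {δ : ℝ} (hδ : 0 < δ) :
    ∃ r s : A, star r = r ∧ star s = s ∧ r * s = 1 ∧ s * r = 1 ∧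
      s * s = inner A x x + (δ : ℂ) • (1 : A) ∧ ‖x <• r‖ ≤ 1 := by
  obtain ⟨r, s, hr, hs, hrs, hsr, hss⟩ := exists_regularized_sqrt
    (inner_self_nonneg (A := A) x) hδ
  refine ⟨r, s, hr, hs, hrs, hsr, hss, norm_le_of_inner_self_le zero_le_one (A := A) (a := 1) ?_ ?_⟩
  · rw [inner_rsmul_left, inner_rsmul_right, hr, eq_sub_of_add_eq hss.symm]
    have e : r * ((s * s - (δ : ℂ) • (1 : A)) * r) = 1 - (δ : ℂ) • (star r * r) := by
      rw [sub_mul, mul_sub, mul_assoc s, hsr, mul_one, hrs, smul_mul_assoc, one_mul,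
        mul_smul_comm, hr]
    rw [e, Complex.coe_smul]
    exact sub_le_self _ (smul_nonneg hδ.le (star_mul_self_nonneg r))
  · rw [one_pow]
    exact (CStarAlgebra.norm_le_one_iff_of_nonneg 1 zero_le_one).2 le_rfl

/-- Bounded conjugate `A`-linear maps are approximated by vectors. -/
lemma exists_approx {ψ : StrongDual ℂ A} (hψ : ∀ a, 0 ≤ a → 0 ≤ ψ a) (T : M →L⋆[ℂ] A)
    (hT : ∀ (x : M) (a : A), T (x <• a) = star a * T x) {ε : ℝ} (hε : 0 < ε) :
    ∃ m : M, ‖m‖ ≤ ‖T‖ ∧ ∀ x : M, ‖x‖ ≤ 1 →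
      (ψ (star (T x - inner A x m) * (T x - inner A x m))).re ≤ ε := by
  let φ : A →ₗ[ℂ] ℂ := ψ.toLinearMap
  have hφ : ∀ a, 0 ≤ a → 0 ≤ φ a := hψ
  let g : M →ₗ[ℂ] ℂ :=
    { toFun := fun x => φ (star (T x))
      map_add' := by simp
      map_smul' := by simp }
  have hg (x : M) : g x = φ (star (T x)) := rfl
  have hs (x : M) : 0 ≤ scalarForm M φ x x := hφ _ (inner_self_nonneg x)
  -- The supremum κ of φ(T(x)⋆T(x)) over the unit ball is the squared norm of T in the φ-seminorm;
  -- -κ will bound the quadratic functional z ↦ φ⟨z | z⟩ - 2 Re φ(T(z)⋆) from below.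
  let R : Set ℝ := {c | ∃ x : M, ‖x‖ ≤ 1 ∧ c = (φ (star (T x) * T x)).re}
  have hRne : R.Nonempty := ⟨_, 0, by simp, rfl⟩
  have hRb : BddAbove R := by
    refine ⟨‖ψ‖ * (‖T‖ * ‖T‖), ?_⟩
    rintro _ ⟨x, hx, rfl⟩
    refine (Complex.re_le_norm _).trans ((ψ.le_opNorm _).trans ?_)
    have h1 : ‖T x‖ ≤ ‖T‖ := T.unit_le_opNorm x hx
    rw [CStarRing.norm_star_mul_self]
    gcongr
  set κ := sSup R with hκ
  -- Write z = (z·r)·s with z·r in the unit ball and s² = ⟨z | z⟩ + δ. With t = T(z·r), positivity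
  -- of φ((t - s)⋆(t - s)) is the bound up to δ φ(1), and δ is arbitrary.
  have hlow (z : M) : -κ ≤ (scalarForm M φ z z).re - 2 * (g z).re := by
    have hδ (δ : ℝ) (hδ : 0 < δ) :
        -κ ≤ (scalarForm M φ z z).re - 2 * (g z).re + δ * (φ 1).re := by
      obtain ⟨r, s, hr, hs', hrs, hsr, hss, hx⟩ := exists_norm_le_one (A := A) z hδ
      have h1 : (φ (star (T (z <• r)) * T (z <• r))).re ≤ κ := le_csSup hRb ⟨_, hx, rfl⟩
      set t := T (z <• r) with ht
      have hTz : T z = s * t := by rw [ht, hT, hr, ← mul_assoc, hsr, one_mul]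
      have h2 := (Complex.le_def.1 (hφ _ (star_mul_self_nonneg (t - s)))).1
      have h3 : star (t - s) * (t - s) = star t * t - star (T z) - T z +
          (inner A z z + (δ : ℂ) • (1 : A)) := by
        rw [hTz, star_mul, star_sub, hs', ← hss]; noncomm_ring
      have h4 : (φ (T z)).re = (g z).re := by
        rw [hg, apply_star_of_nonneg hφ]; simp
      rw [h3] at h2
      simp only [map_add, map_sub, map_smul, Complex.add_re, Complex.sub_re, smul_eq_mul,
        Complex.re_ofReal_mul, h4, ← hg, Complex.zero_re] at h2
      rw [scalarForm_apply]
      linarith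
    have hφ1 : 0 ≤ (φ 1).re := (Complex.le_def.1 (hφ 1 zero_le_one)).1
    refine le_of_forall_pos_le_add fun η hη => (hδ (η / ((φ 1).re + 1)) (by positivity)).trans ?_
    have : η / ((φ 1).re + 1) * (φ 1).re ≤ η := by
      rw [div_mul_eq_mul_div, div_le_iff₀ (by positivity)]
      nlinarith
    linarith
  -- For x almost attaining κ and t = T x, the vector m = x·t has ⟨m | m⟩ ≤ t⋆t and g(m) = φ(t⋆t).
  -- Its value is thus at most -φ(t⋆t) < -κ + ε: a near-minimizer of norm at most ‖T‖.
  obtain ⟨_, ⟨x, hx, rfl⟩, hxκ⟩ := exists_lt_of_lt_csSup hRne (sub_lt_self κ hε)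
  set t := T x with ht
  have hmm : inner A (x <• t) (x <• t) ≤ star t * t := by
    rw [inner_rsmul_left, inner_rsmul_right, ← mul_assoc]
    have := star_left_conjugate_le_conjugate (inner_self_le_one (A := A) hx) t
    rwa [mul_one] at this
  refine ⟨x <• t, norm_le_of_inner_self_le (norm_nonneg _) hmm ?_, fun y hy => ?_⟩
  · rw [CStarRing.norm_star_mul_self, sq]
    have h1 : ‖t‖ ≤ ‖T‖ := T.unit_le_opNorm x hx
    gcongr
  · have hmin (z : M) : (scalarForm M φ (x <• t) (x <• t)).re - 2 * (g (x <• t)).re ≤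
        (scalarForm M φ z z).re - 2 * (g z).re + ε := by
      have h1 := hlow z
      have h2 : g (x <• t) = φ (star t * t) := by rw [hg, hT, star_mul, star_star]
      have h3 := apply_re_mono_of_nonneg hφ hmm
      rw [scalarForm_apply, h2]
      linarith
    -- Testing on y·k with k = T y - ⟨y | m⟩ itself gives φ(k⋆k)² ≤ ε φ(⟨y·k | y·k⟩) ≤ ε φ(k⋆k),
    -- hence a bound uniform in y.
    have h := norm_sub_apply_sq_le_of_forall_le hs g hmin
      (y <• (T y - inner A y (x <• t)))
    set k := T y - inner A y (x <• t) with hk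
    have e : g (y <• k) - scalarForm M φ (x <• t) (y <• k) = φ (star k * k) := by
      rw [hg, scalarForm_apply, hT, star_mul, star_star, inner_rsmul_right, ← map_sub, ← sub_mul]
      congr 2
      rw [hk, star_sub, star_inner']
    have h2 : (scalarForm M φ (y <• k) (y <• k)).re ≤ (φ (star k * k)).re := by
      rw [scalarForm_apply, inner_rsmul_left, inner_rsmul_right, ← mul_assoc]
      refine apply_re_mono_of_nonneg hφ ?_
      have := star_left_conjugate_le_conjugate (inner_self_le_one (A := A) hy) k
      rwa [mul_one] at this
    rw [e] at h
    have h3 : (φ (star k * k)).re ≤ ‖φ (star k * k)‖ := Complex.re_le_norm _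
    have h4 : 0 ≤ (φ (star k * k)).re := (Complex.le_def.1 (hφ _ (star_mul_self_nonneg k))).1
    change (φ (star k * k)).re ≤ ε
    by_contra! hlt
    nlinarith

/-- The filter `l` of bounded sets of vectors converges to `T` in the predual of `A`, uniformly
on bounded sets. -/
def IsApprox (Y : Submodule ℂ (StrongDual ℂ A)) (T : M →L⋆[ℂ] A) (l : Filter M) : Prop :=
  (∀ᶠ m in l, ‖m‖ ≤ ‖T‖) ∧ ∀ ψ ∈ Y, (∀ a, 0 ≤ a → 0 ≤ ψ a) → ∀ C : ℝ, ∀ ε : ℝ, 0 < ε →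
    ∀ᶠ m in l, ∀ x : M, ‖x‖ ≤ C → ‖ψ (T x - inner A x m)‖ ≤ ε

lemma exists_isApprox (Y : Submodule ℂ (StrongDual ℂ A)) (T : M →L⋆[ℂ] A)
    (hT : ∀ (x : M) (a : A), T (x <• a) = star a * T x) :
    ∃ u : Ultrafilter M, IsApprox Y T (u : Filter M) := by
  let I := {p : StrongDual ℂ A × ℝ // p.1 ∈ Y ∧ (∀ a, 0 ≤ a → 0 ≤ p.1 a) ∧ 0 < p.2}
  let s : I → Set M := fun p => {m | ‖m‖ ≤ ‖T‖ ∧ ∀ x : M, ‖x‖ ≤ 1 →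
      (p.1.1 (star (T x - inner A x m) * (T x - inner A x m))).re ≤ p.1.2}
  have : Nonempty I := ⟨⟨(0, 1), Y.zero_mem, by simp, one_pos⟩⟩
  -- The sum of two functionals with the smaller tolerance controls both requirements at once.
  have hdir : Directed (· ≥ ·) fun p => 𝓟 (s p) := by
    rintro ⟨⟨ψ, ε⟩, hψ, hp, hε⟩ ⟨⟨ψ', ε'⟩, hψ', hp', hε'⟩
    refine ⟨⟨(ψ + ψ', min ε ε'), Y.add_mem hψ hψ', fun a ha => add_nonneg (hp a ha) (hp' a ha),
      lt_min hε hε'⟩, ?_, ?_⟩ <;>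
    · refine principal_mono.2 ?_
      rintro m ⟨h1, h2⟩
      refine ⟨h1, fun x hx => ?_⟩
      have h3 := h2 x hx
      have h4 := (Complex.le_def.1 (hp _ (star_mul_self_nonneg (T x - inner A x m)))).1
      have h5 := (Complex.le_def.1 (hp' _ (star_mul_self_nonneg (T x - inner A x m)))).1
      simp only [add_apply, Complex.add_re, le_min_iff, Complex.zero_re] at h3 h4 h5 ⊢
      linarith [h3.1, h3.2]
  have hne : (⨅ p, 𝓟 (s p)).NeBot := iInf_neBot_of_directed' hdir fun p => by
    obtain ⟨m, hm⟩ := exists_approx p.2.2.1 T hT p.2.2.2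
    exact principal_neBot_iff.2 ⟨m, hm⟩
  have hmem (p : I) : ∀ᶠ m in (Ultrafilter.of (⨅ p, 𝓟 (s p)) : Filter M), m ∈ s p :=
    (Ultrafilter.of_le _).trans (iInf_le _ p) (mem_principal_self _)
  refine ⟨Ultrafilter.of (⨅ p, 𝓟 (s p)), (hmem (Classical.arbitrary I)).mono fun m hm => hm.1,
    fun ψ hψ hp C ε hε => ?_⟩
  have hψ1 : 0 ≤ (ψ 1).re := (Complex.le_def.1 (hp 1 zero_le_one)).1
  set D := max C 1 with hD
  have hD0 : 0 < D := lt_max_of_lt_right one_pos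
  -- The tolerance is matched to |ψ(k)|² ≤ ψ(1)ψ(k⋆k) after rescaling x to the unit ball by D; the
  -- added 1 keeps the denominator positive.
  refine (hmem ⟨(ψ, (ε / D) ^ 2 / ((ψ 1).re + 1)), hψ, hp, by positivity⟩).mono fun m hm x hx => ?_
  have h1 := hm.2 (((D : ℂ)⁻¹) • x) (by
    rw [norm_smul, norm_inv, Complex.norm_real, Real.norm_of_nonneg hD0.le,
      inv_mul_le_iff₀ hD0, mul_one]
    exact hx.trans (le_max_left _ _))
  set k := T (((D : ℂ)⁻¹) • x) - inner A (((D : ℂ)⁻¹) • x) m with hk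
  have h2 := norm_apply_star_mul_sq_le (ψ := (ψ : A →ₗ[ℂ] ℂ)) hp 1 k
  simp only [star_one, one_mul, ContinuousLinearMap.coe_coe] at h2
  have h3 : ‖ψ k‖ ^ 2 ≤ (ε / D) ^ 2 := by
    refine h2.trans ((mul_le_mul_of_nonneg_left h1 hψ1).trans ?_)
    dsimp only
    rw [mul_div_assoc', div_le_iff₀ (by positivity)]
    nlinarith [sq_nonneg (ε / D)]
  have h4 : k = ((D : ℂ)⁻¹) • (T x - inner A x m) := by
    have e : star ((D : ℂ)⁻¹) = (D : ℂ)⁻¹ := by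
      rw [star_inv₀]; simp
    rw [hk, inner_smul_left', e, ContinuousLinearMap.map_smulₛₗ, smul_sub]
    congr 2
  have h5 := le_of_sq_le_sq h3 (by positivity)
  rw [h4, map_smul, norm_smul, norm_inv, Complex.norm_real, Real.norm_of_nonneg hD0.le,
    inv_mul_eq_div] at h5
  exact (div_le_div_iff_of_pos_right hD0).1 h5

end HilbertModule

end Approximation

/-! ### The self-dual completion of a Hilbert module over a W⋆-algebra -/

section SelfDual

open Filter Topology HilbertModule

section Predual

variable (A : Type*) [CStarAlgebra A] [WStarAlgebra A]

/-- A predual of a W⋆-algebra. -/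
noncomputable def predual : Submodule ℂ (StrongDual ℂ A) := (exists_isPredual A).choose

lemma isPredual_predual : IsPredual (predual A) := (exists_isPredual A).choose_spec

end Predual

section General

variable {A : Type*} [CStarAlgebra A] [PartialOrder A] [StarOrderedRing A]

/-- The positive functionals in a predual separate points. -/
lemma IsPredual.eq_zero_of_forall_nonneg {Y : Submodule ℂ (StrongDual ℂ A)} (hY : IsPredual Y)
    {a : A} (h : ∀ ψ ∈ Y, (∀ b, 0 ≤ b → 0 ≤ ψ b) → ψ a = 0) : a = 0 := by
  have hsa {b : A} (hb : IsSelfAdjoint b)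
      (h : ∀ ψ ∈ Y, (∀ b, 0 ≤ b → 0 ≤ ψ b) → ψ b = 0) : b = 0 :=
    le_antisymm (neg_nonneg.1 (hY.nonneg_of_forall hb.neg fun ψ hψ hp => by simp [h ψ hψ hp]))
      (hY.nonneg_of_forall hb fun ψ hψ hp => (h ψ hψ hp).ge)
  have hstar (ψ) (hψ : ψ ∈ Y) (hp : ∀ b, 0 ≤ b → 0 ≤ ψ b) : ψ (star a) = 0 := by
    have := apply_star_of_nonneg (ψ := (ψ : A →ₗ[ℂ] ℂ)) hp a
    simpa [h ψ hψ hp] using this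
  have h1 := hsa (b := a + star a) (by simp [IsSelfAdjoint, add_comm]) fun ψ hψ hp => by
    rw [map_add, h ψ hψ hp, hstar ψ hψ hp, add_zero]
  have h2 := hsa (b := Complex.I • (a - star a))
    (by simp [IsSelfAdjoint, star_smul, sub_eq_add_neg, add_comm]) fun ψ hψ hp => by
    rw [map_smul, map_sub, h ψ hψ hp, hstar ψ hψ hp, sub_zero, smul_zero]
  have h3 : a - star a = 0 := (smul_eq_zero.1 h2).resolve_left Complex.I_ne_zero
  have h4 : (2 : ℂ) • a = 0 := by
    rw [two_smul]
    nth_rewrite 2 [sub_eq_zero.1 h3]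
    exact h1
  exact (smul_eq_zero.1 h4).resolve_left two_ne_zero

lemma IsPredual.eq_of_forall_nonneg {Y : Submodule ℂ (StrongDual ℂ A)} (hY : IsPredual Y)
    {a b : A} (h : ∀ ψ ∈ Y, (∀ c, 0 ≤ c → 0 ≤ ψ c) → ψ a = ψ b) : a = b :=
  sub_eq_zero.1 (hY.eq_zero_of_forall_nonneg fun ψ hψ hp => by rw [map_sub, h ψ hψ hp, sub_self])

variable {M : Type*} [NormedAddCommGroup M] [NormedSpace ℂ M] [HilbertModule A M]

/-- Bounded `A`-linear maps are dominated by the inner product. -/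
lemma HilbertModule.apply_star_mul_self_le {ψ : A →ₗ[ℂ] ℂ} (hψ : ∀ a, 0 ≤ a → 0 ≤ ψ a)
    (F : M →L[ℂ] A) (hF : ∀ (x : M) (a : A), F (x <• a) = F x * a) (x : M) :
    (ψ (star (F x) * F x)).re ≤ ‖F‖ ^ 2 * (ψ (inner A x x)).re := by
  have hδ (δ : ℝ) (hδ : 0 < δ) : (ψ (star (F x) * F x)).re ≤
      ‖F‖ ^ 2 * (ψ (inner A x x)).re + δ * (‖F‖ ^ 2 * (ψ 1).re) := by
    obtain ⟨r, s, hr, hs, hrs, hsr, hss, hx⟩ := exists_norm_le_one (A := A) x hδ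
    have h1 : ‖F (x <• r)‖ ≤ ‖F‖ := F.unit_le_opNorm _ hx
    have h2 : F x = F (x <• r) * s := by rw [hF, mul_assoc, hrs, mul_one]
    have h3 : star (F (x <• r)) * F (x <• r) ≤ (‖F‖ ^ 2) • (1 : A) := by
      refine (CStarAlgebra.star_mul_le_algebraMap_norm_sq).trans ?_
      rw [← Algebra.algebraMap_eq_smul_one]
      exact algebraMap_mono A (by gcongr)
    have h4 : star (F x) * F x ≤ (‖F‖ ^ 2 : ℝ) • (inner A x x + (δ : ℂ) • (1 : A)) := by
      have := star_left_conjugate_le_conjugate h3 s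
      rw [h2, star_mul, ← hss]
      simpa [hs, mul_assoc] using this
    have h5 := apply_re_mono_of_nonneg hψ h4
    rw [← Complex.coe_smul, map_smul, map_add, map_smul] at h5
    simp only [smul_eq_mul, Complex.re_ofReal_mul, Complex.add_re] at h5
    linarith
  have hψ1 : 0 ≤ (ψ 1).re := (Complex.le_def.1 (hψ 1 zero_le_one)).1
  refine le_of_forall_pos_le_add fun η hη =>
    (hδ (η / (‖F‖ ^ 2 * (ψ 1).re + 1)) (by positivity)).trans ?_
  have : η / (‖F‖ ^ 2 * (ψ 1).re + 1) * (‖F‖ ^ 2 * (ψ 1).re) ≤ η := by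
    rw [div_mul_eq_mul_div, div_le_iff₀ (by positivity)]
    nlinarith
  linarith

end General

variable (A M : Type*) [CStarAlgebra A] [PartialOrder A] [NormedAddCommGroup M]
  [NormedSpace ℂ M] [HilbertModule A M]

/-- The bounded conjugate `A`-linear maps `M → A`. -/
def conjLinearMaps : Submodule ℂ (M →L⋆[ℂ] A) where
  carrier := {T | ∀ (x : M) (a : A), T (x <• a) = star a * T x}
  zero_mem' := fun x a => by simp
  add_mem' := fun {S T} hS hT x a => by simp [hS x a, hT x a, mul_add]
  smul_mem' := fun c T hT x a => by simp [hT x a]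

lemma isClosed_conjLinearMaps : IsClosed (conjLinearMaps A M : Set (M →L⋆[ℂ] A)) := by
  have : (conjLinearMaps A M : Set (M →L⋆[ℂ] A)) =
      ⋂ (x : M) (a : A), {T | T (x <• a) = star a * T x} := by
    ext T; simp [conjLinearMaps]
  rw [this]
  refine isClosed_iInter fun x => isClosed_iInter fun a => isClosed_eq ?_ ?_
  · fun_prop
  · fun_prop

/-- The self-dual completion of `M`: the bounded conjugate `A`-linear maps `M → A`, where a vector
`T` stands for the map `x ↦ ⟨x | T⟩`. -/
def selfDualCompletion : Type _ := conjLinearMaps A M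

namespace selfDualCompletion

variable {A M}

noncomputable instance : NormedAddCommGroup (selfDualCompletion A M) :=
  inferInstanceAs (NormedAddCommGroup (conjLinearMaps A M))

noncomputable instance : NormedSpace ℂ (selfDualCompletion A M) :=
  inferInstanceAs (NormedSpace ℂ (conjLinearMaps A M))

@[ext] lemma ext {S T : selfDualCompletion A M} (h : ∀ x, S.1 x = T.1 x) : S = T :=
  Subtype.ext (ContinuousLinearMap.ext h)

noncomputable instance : RightModule A (selfDualCompletion A M) where
  smul a T := (⟨((ContinuousLinearMap.mul ℂ A).flip a.unop).comp T.1, fun x b => by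
    simp [T.2 x b, mul_assoc]⟩ : conjLinearMaps A M)
  add_rsmul S T a := ext fun x => add_mul (S.1 x) (T.1 x) a
  rsmul_add T a b := ext fun x => mul_add (T.1 x) a b
  rsmul_mul T a b := ext fun x => (mul_assoc (T.1 x) a b).symm
  smul_rsmul c T a := ext fun x => smul_mul_assoc c (T.1 x) a
  rsmul_smul c T a := ext fun x => mul_smul_comm c (T.1 x) a

variable [StarOrderedRing A]

/-- A vector of a Hilbert module `L` containing `M` as a conjugate linear map on `M`. -/
noncomputable def ofInner {L : Type*} [NormedAddCommGroup L] [NormedSpace ℂ L] [HilbertModule A L]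
    (j : RightLinearMap A M L) (hj : ∀ x y, inner A (j x) (j y) = inner A x y) (l : L) :
    selfDualCompletion A M :=
  (⟨LinearMap.mkContinuous
    { toFun := fun x => inner A (j x) l
      map_add' := fun x y => by rw [map_add, inner_add_left']
      map_smul' := fun c x => by rw [map_smul, inner_smul_left']; rfl } ‖l‖ fun x => by
        rw [mul_comm, ← norm_map_of_inner_map hj x]
        exact norm_inner_le _ _,
    fun x a => by
      change inner A (j (x <• a)) l = star a * inner A (j x) l
      rw [show j (x <• a) = j x <• a from j.map_rsmul x a, inner_rsmul_left]⟩ : conjLinearMaps A M)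

lemma norm_ofInner_le {L : Type*} [NormedAddCommGroup L] [NormedSpace ℂ L] [HilbertModule A L]
    (j : RightLinearMap A M L) (hj : ∀ x y, inner A (j x) (j y) = inner A x y) (l : L) :
    ‖ofInner j hj l‖ ≤ ‖l‖ :=
  ContinuousLinearMap.opNorm_le_bound (ofInner j hj l).1 (norm_nonneg _) fun x => by
    rw [mul_comm, ← norm_map_of_inner_map hj x]
    exact norm_inner_le _ _

variable (A M) in
/-- The canonical map of `M` into its self-dual completion. -/
noncomputable def embed : RightLinearMap A M (selfDualCompletion A M) where
  toFun m := ofInner (A := A) ⟨LinearMap.id, fun _ _ => rfl⟩ (fun _ _ => rfl) m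
  map_add' m n := ext fun x => inner_add_right' x m n
  map_smul' c m := ext fun x => inner_smul_right' c x m
  map_rsmul m a := ext fun x => inner_rsmul_right x m a

lemma embed_apply (m x : M) : (embed A M m).1 x = inner A x m := rfl

lemma norm_embed_le (m : M) : ‖embed A M m‖ ≤ ‖m‖ :=
  norm_ofInner_le (A := A) ⟨LinearMap.id, fun _ _ => rfl⟩ (fun _ _ => rfl) m

variable [WStarAlgebra A]

/-- An ultrafilter of vectors converging to `T`. -/
noncomputable def approx (T : selfDualCompletion A M) : Ultrafilter M :=
  (exists_isApprox (predual A) T.1 T.2).choose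

lemma isApprox_approx (T : selfDualCompletion A M) : IsApprox (predual A) T.1 (approx T) :=
  (exists_isApprox (predual A) T.1 T.2).choose_spec

lemma exists_form (S T : selfDualCompletion A M) : ∃ a : A, ‖a‖ ≤ ‖S‖ * ‖T‖ ∧
    WeakTendsto (predual A) (approx T : Filter M) (fun m => star (S.1 m)) a :=
  (isPredual_predual A).exists_weakTendsto _ ((isApprox_approx T).1.mono fun m hm => by
    rw [norm_star]
    exact (S.1.le_opNorm m).trans (mul_le_mul_of_nonneg_left hm (norm_nonneg _)))

/-- The inner product of the self-dual completion. -/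
noncomputable def form (S T : selfDualCompletion A M) : A := (exists_form S T).choose

lemma norm_form_le (S T : selfDualCompletion A M) : ‖form S T‖ ≤ ‖S‖ * ‖T‖ :=
  (exists_form S T).choose_spec.1

lemma weakTendsto_form (S T : selfDualCompletion A M) :
    WeakTendsto (predual A) (approx T : Filter M) (fun m => star (S.1 m)) (form S T) :=
  (exists_form S T).choose_spec.2

lemma form_eq_of_weakTendsto {S T : selfDualCompletion A M} {a : A}
    (h : WeakTendsto (predual A) (approx T : Filter M) (fun m => star (S.1 m)) a) :
    form S T = a := (weakTendsto_form S T).unique (isPredual_predual A) h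

/-- Choose m near T and n near S. Then ψ(T n) ≈ ψ⟨n | m⟩ and ψ(S m) ≈ ψ⟨m | n⟩, because the
approximations are uniform on bounded sets and ‖m‖, ‖n‖ are controlled; these two values are adjoint
to each other. Linearity in the second variable is then inherited from the first. -/
lemma star_form (S T : selfDualCompletion A M) : star (form S T) = form T S := by
  refine (isPredual_predual A).eq_of_forall_nonneg fun ψ hψ hp => ?_
  have hst (a : A) : ψ (star a) = star (ψ a) := apply_star_of_nonneg (ψ := (ψ : A →ₗ[ℂ] ℂ)) hp a
  rw [← sub_eq_zero, ← norm_eq_zero]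
  refine le_antisymm (le_of_forall_pos_le_add fun ε hε => ?_) (norm_nonneg _)
  have key (S T : selfDualCompletion A M) : ∃ m : M, ‖m‖ ≤ ‖T‖ ∧
      ‖ψ (S.1 m) - ψ (star (form S T))‖ ≤ ε / 4 ∧
      ∀ x : M, ‖x‖ ≤ ‖S‖ → ‖ψ (T.1 x - inner A x m)‖ ≤ ε / 4 := by
    have h1 := (isApprox_approx T).1
    have h2 := (isApprox_approx T).2 ψ hψ hp ‖S‖ (ε / 4) (by positivity)
    have h3 := Metric.tendsto_nhds.1 (weakTendsto_form S T ψ hψ) (ε / 4) (by positivity)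
    obtain ⟨m, hm1, hm2, hm3⟩ := (h1.and (h2.and h3)).exists
    refine ⟨m, hm1, ?_, hm2⟩
    rw [dist_eq_norm, hst, ← star_star (form S T), hst, ← star_sub, norm_star] at hm3
    exact hm3.le
  obtain ⟨m, hm1, hm2, hm3⟩ := key S T
  obtain ⟨n, hn1, hn2, hn3⟩ := key T S
  have a1 := hm3 n hn1
  have a2 := hn3 m hm1
  rw [← norm_star, ← hst, star_sub, star_inner', map_sub] at a2
  rw [map_sub] at a1
  rw [← norm_star, star_sub, ← hst, ← hst, star_star] at hn2 hm2
  rw [← norm_star, star_sub, ← hst, ← hst, star_star]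
  have e : ψ (form S T) - ψ (star (form T S)) = -(ψ (star (S.1 m)) - ψ (form S T)) +
      (ψ (star (S.1 m)) - ψ (inner A n m)) - (ψ (T.1 n) - ψ (inner A n m)) +
      star (ψ (star (T.1 n)) - ψ (form T S)) := by
    rw [star_sub, ← hst, ← hst, star_star]; ring
  rw [e, zero_add]
  refine (norm_add_le _ _).trans ?_
  refine (add_le_add_left ((norm_sub_le _ _).trans
    (add_le_add_left (norm_add_le _ _) _)) _).trans ?_
  rw [norm_neg, norm_star]
  linarith

lemma form_embed_left (x : M) (T : selfDualCompletion A M) : form (embed A M x) T = T.1 x := by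
  refine (isPredual_predual A).eq_of_forall_nonneg fun ψ hψ hp => ?_
  have h := weakTendsto_form (embed A M x) T ψ hψ
  simp only [embed_apply, star_inner'] at h
  refine tendsto_nhds_unique h (Metric.tendsto_nhds.2 fun ε hε => ?_)
  refine ((isApprox_approx T).2 ψ hψ hp ‖x‖ (ε / 2) (by positivity)).mono fun m hm => ?_
  have := hm x le_rfl
  rw [map_sub] at this
  rw [dist_eq_norm, ← norm_neg, neg_sub]
  linarith

lemma form_embed_right (x : M) (T : selfDualCompletion A M) :
    form T (embed A M x) = star (T.1 x) := by
  rw [← star_form, form_embed_left]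

lemma form_add_left (S S' T : selfDualCompletion A M) :
    form (S + S') T = form S T + form S' T :=
  form_eq_of_weakTendsto (((weakTendsto_form S T).add (weakTendsto_form S' T)).congr'
    (.of_forall fun m => (star_add (S.1 m) (S'.1 m)).symm))

lemma form_smul_left (c : ℂ) (S T : selfDualCompletion A M) :
    form (c • S) T = star c • form S T :=
  form_eq_of_weakTendsto (((weakTendsto_form S T).smul (star c)).congr'
    (.of_forall fun m => (star_smul c (S.1 m)).symm))

lemma form_rsmul_left (S T : selfDualCompletion A M) (a : A) :
    form (S <• a) T = star a * form S T :=
  form_eq_of_weakTendsto ((WeakTendsto.mul_left (isPredual_predual A) (weakTendsto_form S T)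
    (star a)).congr' (.of_forall fun m => (star_mul (S.1 m) a).symm))

lemma isSesquilinearForm_form :
    IsSesquilinearForm A (selfDualCompletion A M) form where
  right_linear S T T' c := by
    rw [← star_form, form_add_left, form_smul_left, star_add, star_smul, star_star, star_form,
      star_form]
  left_conj_linear S T T' c := by rw [form_add_left, form_smul_left]
  right_rsmul S T a := by
    rw [← star_form, form_rsmul_left, star_mul, star_star, star_form]
  left_rsmul S T a := form_rsmul_left S T a

lemma form_self_nonneg (T : selfDualCompletion A M) : 0 ≤ form T T := by
  refine (isPredual_predual A).nonneg_of_forall (star_form T T) fun ψ hψ hp => ?_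
  have h1 : Tendsto (fun m => ψ (inner A m m)) (approx T : Filter M) (𝓝 (ψ (form T T))) := by
    have h2 := weakTendsto_form T T ψ hψ
    have h3 : Tendsto (fun m => ψ (star (T.1 m)) - ψ (inner A m m))
        (approx T : Filter M) (𝓝 0) := by
      refine Metric.tendsto_nhds.2 fun ε hε => ?_
      filter_upwards [(isApprox_approx T).1,
        (isApprox_approx T).2 ψ hψ hp ‖T‖ (ε / 2) (by positivity)] with m hm1 hm2
      have h4 := hm2 m hm1
      have hst (a : A) : ψ (star a) = star (ψ a) :=
        apply_star_of_nonneg (ψ := (ψ : A →ₗ[ℂ] ℂ)) hp a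
      rw [dist_zero_right, ← star_inner' m m, hst, hst, ← star_sub, norm_star, ← map_sub]
      linarith
    simpa using h2.sub h3
  exact ge_of_tendsto' h1 fun m => hp _ (inner_self_nonneg m)

/-- The operator norm is bounded by the form through Cauchy–Schwarz against embedded vectors, since
T(x) = ⟨x | T⟩; the other bound was built into `form`. -/
lemma norm_eq_sqrt_norm_form (T : selfDualCompletion A M) : ‖T‖ = √‖form T T‖ := by
  refine le_antisymm ?_ (Real.sqrt_le_iff.2 ⟨norm_nonneg _, ?_⟩)
  · refine ContinuousLinearMap.opNorm_le_bound _ (Real.sqrt_nonneg _) fun x => ?_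
    have h := isSesquilinearForm_form.norm_apply_le form_self_nonneg (embed A M x) T
    rw [form_embed_left, form_embed_left, embed_apply, ← HilbertModule.norm_eq] at h
    rwa [mul_comm]
  · rw [sq]
    exact norm_form_le T T

noncomputable instance : HilbertModule A (selfDualCompletion A M) where
  inner := form
  sesquilinear := isSesquilinearForm_form
  inner_self_nonneg := form_self_nonneg
  eq_zero_of_inner_self T h := by
    have := norm_eq_sqrt_norm_form T
    rw [h, norm_zero, Real.sqrt_zero] at this
    exact norm_eq_zero.1 this
  norm_eq := norm_eq_sqrt_norm_form
  complete := (isClosed_conjLinearMaps A M).completeSpace_coe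

lemma inner_embed_left (x : M) (T : selfDualCompletion A M) :
    inner A (embed A M x) T = T.1 x := form_embed_left x T

lemma inner_embed_right (x : M) (T : selfDualCompletion A M) :
    inner A T (embed A M x) = star (T.1 x) := form_embed_right x T

lemma inner_embed (x y : M) : inner A (embed A M x) (embed A M y) = inner A x y :=
  inner_embed_left x _

/-- This is τ₁-density of M. The defect D = m - T has norm at most 2‖T‖, and ⟨D | D⟩ is a limit of
values D(n)⋆ = -(T n - ⟨n | m⟩)⋆ with ‖n‖ ≤ 2‖T‖, all uniformly small under ψ. -/
lemma tendsto_inner_embed_sub (T : selfDualCompletion A M) {ψ : StrongDual ℂ A}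
    (hψ : ψ ∈ predual A) (hp : ∀ a, 0 ≤ a → 0 ≤ ψ a) :
    Tendsto (fun m => ψ (inner A (embed A M m - T) (embed A M m - T)))
      (approx T : Filter M) (𝓝 0) := by
  refine Metric.tendsto_nhds.2 fun ε hε => ?_
  filter_upwards [(isApprox_approx T).1,
    (isApprox_approx T).2 ψ hψ hp (2 * ‖T‖) (ε / 2) (by positivity)] with m hm1 hm2
  rw [dist_zero_right]
  refine lt_of_le_of_lt ?_ (half_lt_self hε)
  set D := embed A M m - T with hD
  have hDn : ‖D‖ ≤ 2 * ‖T‖ := by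
    refine (norm_sub_le _ _).trans ?_
    have := (norm_embed_le (A := A) m).trans hm1
    change ‖embed A M m‖ ≤ ‖T‖ at this
    linarith
  refine le_of_tendsto (weakTendsto_form D D ψ hψ).norm ?_
  filter_upwards [(isApprox_approx D).1] with n hn
  have h4 := hm2 n (hn.trans hDn)
  have e : D.1 n = -(T.1 n - inner A n m) := by
    rw [neg_sub]; rfl
  have hst : ψ (star (D.1 n)) = star (ψ (D.1 n)) :=
    apply_star_of_nonneg (ψ := (ψ : A →ₗ[ℂ] ℂ)) hp (D.1 n)
  rw [hst, norm_star, e, map_neg, norm_neg]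
  exact h4

/-- The self-dual completion is self-dual. -/
theorem isSelfDual : IsSelfDual A (selfDualCompletion A M) := by
  intro F hF
  let T : selfDualCompletion A M :=
    (⟨LinearMap.mkContinuous
      { toFun := fun x => star (F (embed A M x))
        map_add' := fun x y => by rw [map_add, map_add, star_add]
        map_smul' := fun c x => by rw [map_smul, map_smul, star_smul]; rfl } ‖F‖ fun x => by
          refine (norm_star _).trans_le ((F.le_opNorm _).trans ?_)
          exact mul_le_mul_of_nonneg_left (norm_embed_le x) (norm_nonneg _),
      fun x a => by
        change star (F (embed A M (x <• a))) = star a * star (F (embed A M x))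
        rw [show embed A M (x <• a) = embed A M x <• a from (embed A M).map_rsmul x a, hF,
          star_mul]⟩ : conjLinearMaps A M)
  have hT (x : M) : T.1 x = star (F (embed A M x)) := rfl
  refine ⟨T, fun X => ?_⟩
  -- G vanishes on M. By `apply_star_mul_self_le`, ψ(G(X)⋆G(X)) ≤ ‖G‖² ψ⟨m - X | m - X⟩, which tends
  -- to 0 as m approaches X.
  let G : selfDualCompletion A M →L[ℂ] A := F - innerCLM A T
  have hG (X) : G X = F X - inner A T X := rfl
  have hGr (X : selfDualCompletion A M) (a : A) : G (X <• a) = G X * a := by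
    rw [hG, hG, hF, inner_rsmul_right, sub_mul]
  have hGe (m : M) : G (embed A M m) = 0 := by
    rw [hG, inner_embed_right, hT, star_star, sub_self]
  refine sub_eq_zero.1 ((CStarRing.star_mul_self_eq_zero_iff (G X)).1
    ((isPredual_predual A).eq_zero_of_forall_nonneg fun ψ hψ hp => ?_))
  have h0 := hp _ (star_mul_self_nonneg (G X))
  have h1 := (Complex.continuous_re.tendsto _).comp (tendsto_inner_embed_sub X hψ hp)
  have h2 : (ψ (star (G X) * G X)).re ≤ 0 := by
    refine ge_of_tendsto' (by simpa using h1.const_mul (‖G‖ ^ 2)) fun m => ?_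
    have h3 := apply_star_mul_self_le (ψ := (ψ : A →ₗ[ℂ] ℂ)) hp G hGr (embed A M m - X)
    rw [map_sub, hGe, zero_sub, star_neg, neg_mul_neg] at h3
    exact h3
  have h3 := Complex.le_def.1 h0
  exact Complex.ext (le_antisymm h2 h3.1) h3.2.symm

end selfDualCompletion

end SelfDual

/-! ### Uniqueness of the self-dual completion, and extension of operators -/

section SelfDualUnitary

open HilbertModule

namespace HilbertUnitary

variable {A M N P : Type*} [NonUnitalCStarAlgebra A] [PartialOrder A]
  [NormedAddCommGroup M] [NormedSpace ℂ M] [HilbertModule A M]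
  [NormedAddCommGroup N] [NormedSpace ℂ N] [HilbertModule A N]
  [NormedAddCommGroup P] [NormedSpace ℂ P] [HilbertModule A P]

/-- The composition of a unitary map with the inverse of another. -/
lemma exists_comp_inverse (W : HilbertUnitary A M P) (W' : HilbertUnitary A N P) :
    ∃ W'' : HilbertUnitary A M N, ∀ x, W' (W'' x) = W x := by
  let e := LinearEquiv.ofBijective W.toLinearMap W.bijective
  let e' := LinearEquiv.ofBijective W'.toLinearMap W'.bijective
  have h (x : M) : W' (e'.symm (e x)) = W x := e'.apply_symm_apply (e x)
  refine ⟨⟨⟨(e.trans e'.symm : M →ₗ[ℂ] N), fun x a => W'.bijective.1 ?_⟩,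
    (e.trans e'.symm).bijective, fun x y => ?_⟩, h⟩
  · have h1 := W'.map_rsmul (e'.symm (e x)) a
    have h2 := W.map_rsmul x a
    have h3 := h (x <• a)
    have h4 := h x
    exact h3.trans (h2.trans ((congrArg (· <• a) h4).symm.trans h1.symm))
  · have h1 := W'.inner_map (e'.symm (e x)) (e'.symm (e y))
    have h2 := W.inner_map x y
    refine h1.symm.trans (Eq.trans ?_ h2)
    exact congrArg₂ (inner A) (h x) (h y)

end HilbertUnitary

namespace selfDualCompletion

variable {A M L : Type*} [CStarAlgebra A] [PartialOrder A] [StarOrderedRing A]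
  [NormedAddCommGroup M] [NormedSpace ℂ M] [HilbertModule A M]
  [NormedAddCommGroup L] [NormedSpace ℂ L] [HilbertModule A L]

/-- The extension of an adjointable operator to the self-dual completion. -/
noncomputable def extendCLM (P : adjointable A M) :
    selfDualCompletion A M →L[ℂ] selfDualCompletion A M :=
  LinearMap.mkContinuous
    { toFun := fun T => (⟨T.1.comp (star P).1, fun x a => by
        change T.1 ((star P).1 (x <• a)) = star a * T.1 ((star P).1 x)
        rw [(star P).2.1, T.2]⟩ : conjLinearMaps A M)
      map_add' := fun S T => rfl
      map_smul' := fun c T => rfl } ‖(star P).1‖ fun T => by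
        rw [mul_comm]
        exact ContinuousLinearMap.opNorm_comp_le T.1 (star P).1

lemma extendCLM_apply (P : adjointable A M) (T : selfDualCompletion A M) (x : M) :
    (extendCLM P T).1 x = T.1 ((star P).1 x) := rfl

lemma extendCLM_rsmul (P : adjointable A M) (T : selfDualCompletion A M) (a : A) :
    extendCLM P (T <• a) = extendCLM P T <• a := rfl

lemma extendCLM_embed (P : adjointable A M) (x : M) :
    extendCLM P (embed A M x) = embed A M (P.1 x) := ext fun y => by
  rw [extendCLM_apply, embed_apply, embed_apply, adjointable.inner_apply_right]

variable [WStarAlgebra A]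

/-- A self-dual module in which the image of `M` has trivial orthogonal complement is the
self-dual completion of `M`. -/
theorem exists_unitary (hL : IsSelfDual A L) (j : RightLinearMap A M L)
    (hj : ∀ x y, inner A (j x) (j y) = inner A x y)
    (hsep : ∀ l : L, (∀ x, inner A (j x) l = 0) → l = 0) :
    ∃ W : HilbertUnitary A L (selfDualCompletion A M), ∀ x, W (j x) = embed A M x := by
  let k : L →ₗ[ℂ] selfDualCompletion A M :=
    { toFun := ofInner j hj
      map_add' := fun l l' => ext fun x => inner_add_right' (j x) l l'
      map_smul' := fun c l => ext fun x => inner_smul_right' c (j x) l }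
  have hk (l : L) (x : M) : (k l).1 x = inner A (j x) l := rfl
  have hkj (x : M) : k (j x) = embed A M x := ext fun y => hj y x
  have hkr (l : L) (a : A) : k (l <• a) = k l <• a := ext fun x => inner_rsmul_right (j x) l a
  have hinj : Function.Injective k := (injective_iff_map_eq_zero k).2 fun l hl =>
    hsep l fun x => by rw [← hk, hl]; rfl
  let kc : L →L[ℂ] selfDualCompletion A M := k.mkContinuous 1 fun l => by
    rw [one_mul]; exact norm_ofInner_le j hj l
  -- Self-duality of L represents ⟨T | k ·⟩ by some l, and testing on j x shows k l = T, so k is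
  -- onto. For T = k l, injectivity identifies the representing vector with l, so k preserves inner
  -- products.
  have hrep (T : selfDualCompletion A M) : ∃ l : L, k l = T ∧
      ∀ l', inner A T (k l') = inner A l l' := by
    obtain ⟨l, hl⟩ := hL ((innerCLM A T).comp kc) fun x a => by
      change inner A T (k (x <• a)) = inner A T (k x) * a
      rw [hkr, inner_rsmul_right]
    have hl' (l' : L) : inner A T (k l') = inner A l l' := hl l'
    refine ⟨l, ext fun x => ?_, hl'⟩
    have := hl' (j x)
    rw [hkj, inner_embed_right, ← star_inner' (j x) l] at this
    rw [hk, star_injective this]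
  refine ⟨⟨⟨k, hkr⟩, ⟨hinj, fun T => ?_⟩, fun l l' => ?_⟩, hkj⟩
  · obtain ⟨l, hl, -⟩ := hrep T
    exact ⟨l, hl⟩
  · obtain ⟨l₁, hl₁, h⟩ := hrep (k l)
    rw [hinj hl₁] at h
    exact h l'

/-- On a self-dual module, ⟨S | P ·⟩ is represented by some Z for any bounded `A`-linear P;
evaluation on M identifies Z with the extension of P⋆ applied to S. -/
lemma isAdjointOf_extendCLM (P : adjointable A M) :
    IsAdjointOf (A := A) (extendCLM (star P)) (extendCLM P) := fun S T => by
  obtain ⟨Z, hZ⟩ := isSelfDual (A := A) (M := M) ((innerCLM A S).comp (extendCLM P)) fun T a => by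
    change inner A S (extendCLM P (T <• a)) = inner A S (extendCLM P T) * a
    rw [extendCLM_rsmul, inner_rsmul_right]
  have hZ' (T) : inner A S (extendCLM P T) = inner A Z T := hZ T
  have e : Z = extendCLM (star P) S := ext fun x => by
    have := hZ' (embed A M x)
    rw [extendCLM_embed, inner_embed_right, inner_embed_right] at this
    rw [extendCLM_apply, star_star, star_injective this]
  rw [hZ', e]

/-- The extension of an adjointable operator, as an adjointable operator. -/
noncomputable def extendOp (P : adjointable A M) : adjointable A (selfDualCompletion A M) :=
  adjointable.ofIsAdjointOf (extendCLM P) (extendCLM (star P)) (isAdjointOf_extendCLM P)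

lemma star_extendOp (P : adjointable A M) : star (extendOp P) = extendOp (star P) :=
  adjointable.star_eq_of_inner (T := extendOp P) (T' := extendOp (star P))
    (isAdjointOf_extendCLM P)

variable (A M) in
/-- The extension of adjointable operators to the self-dual completion. -/
noncomputable def extend : adjointable A M →⋆ₐ[ℂ] adjointable A (selfDualCompletion A M) where
  toFun P := extendOp P
  map_one' := Subtype.ext (ContinuousLinearMap.ext fun T => ext fun x => by
    change T.1 ((star (1 : adjointable A M)).1 x) = T.1 x
    rw [star_one]; rfl)
  map_mul' P Q := Subtype.ext (ContinuousLinearMap.ext fun T => ext fun x => by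
    change T.1 ((star (P * Q)).1 x) = T.1 ((star Q).1 ((star P).1 x))
    rw [star_mul]; rfl)
  map_zero' := Subtype.ext (ContinuousLinearMap.ext fun T => ext fun x => by
    change T.1 ((star (0 : adjointable A M)).1 x) = 0
    rw [star_zero]; exact map_zero T.1)
  map_add' P Q := Subtype.ext (ContinuousLinearMap.ext fun T => ext fun x => by
    change T.1 ((star (P + Q)).1 x) = T.1 ((star P).1 x) + T.1 ((star Q).1 x)
    rw [star_add]; exact map_add T.1 _ _)
  commutes' c := Subtype.ext (ContinuousLinearMap.ext fun T => ext fun x => by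
    have h : star (algebraMap ℂ (adjointable A M) c) = algebraMap ℂ (adjointable A M) (star c) :=
      adjointable.star_eq_of_inner fun x y => by
        change inner A x (c • y) = inner A (star c • x) y
        rw [inner_smul_right', inner_smul_left', star_star]
    change T.1 ((star (algebraMap ℂ (adjointable A M) c)).1 x) = c • T.1 x
    rw [h]
    change T.1 (star c • x) = c • T.1 x
    rw [ContinuousLinearMap.map_smulₛₗ]
    simp)
  map_star' P := (star_extendOp P).symm

lemma extend_embed (P : adjointable A M) (x : M) :
    (extend A M P).1 (embed A M x) = embed A M (P.1 x) := extendCLM_embed P x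

end selfDualCompletion

end SelfDualUnitary

/-! ### Convergence and density for τ₁ and τ₂ -/

section TauTopologies

open Filter Topology HilbertModule

variable {A L : Type*} [CStarAlgebra A] [PartialOrder A]
  [NormedAddCommGroup L] [NormedSpace ℂ L] [HilbertModule A L]

lemma norm_apply_inner_sq_le (φ : A →ₚ[ℂ] ℂ) (x y : L) :
    ‖φ (inner A x y)‖ ^ 2 ≤ ‖φ (inner A x x)‖ * ‖φ (inner A y y)‖ := by
  have hφ (x : L) : 0 ≤ φ (inner A x x) := φ.map_nonneg (inner_self_nonneg x)
  refine (norm_apply_sq_le (s := scalarForm L φ.toLinearMap) hφ x y).trans ?_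
  exact mul_le_mul (Complex.re_le_norm _) (Complex.re_le_norm _) (Complex.le_def.1 (hφ y)).1
    (norm_nonneg _)

/-- The seminorm `x ↦ √φ⟨x | x⟩` satisfies the triangle inequality. -/
lemma sqrt_norm_apply_inner_add_le (φ : A →ₚ[ℂ] ℂ) (x y : L) :
    √‖φ (inner A (x + y) (x + y))‖ ≤ √‖φ (inner A x x)‖ + √‖φ (inner A y y)‖ := by
  have h1 := norm_apply_inner_sq_le φ x y
  have h2 := norm_apply_inner_sq_le φ y x
  have hx := norm_nonneg (φ (inner A x x))
  have hy := norm_nonneg (φ (inner A y y))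
  have hx2 := Real.sq_sqrt hx
  have hy2 := Real.sq_sqrt hy
  have b1 : ‖φ (inner A x y)‖ ≤ √‖φ (inner A x x)‖ * √‖φ (inner A y y)‖ :=
    le_of_sq_le_sq (by rw [mul_pow, hx2, hy2]; exact h1) (by positivity)
  have b2 : ‖φ (inner A y x)‖ ≤ √‖φ (inner A x x)‖ * √‖φ (inner A y y)‖ :=
    le_of_sq_le_sq (by rw [mul_pow, hx2, hy2, mul_comm]; exact h2) (by positivity)
  rw [Real.sqrt_le_iff]
  refine ⟨by positivity, ?_⟩
  rw [inner_add_left', inner_add_right', inner_add_right', map_add, map_add, map_add, add_sq,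
    hx2, hy2]
  refine (norm_add_le _ _).trans ((add_le_add (norm_add_le _ _) (norm_add_le _ _)).trans ?_)
  linarith

variable [StarOrderedRing A] {ι : Type*} {l : Filter ι} {f : ι → L} {x : L}

/-- The generating balls have arbitrary centres, so the triangle inequality moves from the centre x₀
to the limit x. -/
lemma tendsto_tau1 (h : ∀ φ ∈ predualCone A,
      Tendsto (fun i => φ (inner A (f i - x) (f i - x))) l (𝓝 0)) :
    Tendsto f l (@nhds L (tau1 A L) x) := by
  let _ := tau1 A L
  refine TopologicalSpace.tendsto_nhds_generateFrom_iff.2 ?_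
  rintro _ ⟨φ, hφ, x₀, r, hr, rfl⟩ hx
  have h1 : Tendsto (fun i => √‖φ (inner A (f i - x) (f i - x))‖) l (𝓝 0) := by
    simpa using ((h φ hφ).norm).sqrt
  filter_upwards [h1.eventually_lt_const (sub_pos.2 hx)] with i hi
  have h2 := sqrt_norm_apply_inner_add_le φ (f i - x) (x - x₀)
  rw [sub_add_sub_cancel] at h2
  refine h2.trans_lt ?_
  linarith

/-- Convergence in the τ₁ seminorms controls the τ₂ seminorms by Cauchy–Schwarz. -/
lemma tendsto_tau2 (h : ∀ φ ∈ predualCone A,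
      Tendsto (fun i => φ (inner A (f i - x) (f i - x))) l (𝓝 0)) :
    Tendsto f l (@nhds L (tau2 A L) x) := by
  let _ := tau2 A L
  refine TopologicalSpace.tendsto_nhds_generateFrom_iff.2 ?_
  rintro _ ⟨φ, hφ, y, x₀, r, hr, rfl⟩ hx
  have h1 : Tendsto (fun i => √(‖φ (inner A y y)‖ * ‖φ (inner A (f i - x) (f i - x))‖)) l
      (𝓝 0) := by
    simpa using (((h φ hφ).norm).const_mul ‖φ (inner A y y)‖).sqrt
  filter_upwards [h1.eventually_lt_const (sub_pos.2 hx)] with i hi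
  have h2 : ‖φ (inner A y (f i - x))‖ ≤ _ :=
    Real.le_sqrt_of_sq_le (norm_apply_inner_sq_le φ y (f i - x))
  have h3 : φ (inner A y (f i - x₀)) = φ (inner A y (f i - x)) + φ (inner A y (x - x₀)) := by
    rw [← map_add, ← inner_add_right', sub_add_sub_cancel]
  change ‖φ (inner A y (f i - x₀))‖ < r
  rw [h3]
  refine (norm_add_le _ _).trans_lt ?_
  linarith

lemma tendsto_apply_inner_sub {f : ι → L} (hf : Tendsto f l (𝓝 x)) (φ : A →ₚ[ℂ] ℂ) :
    Tendsto (fun i => φ (inner A (f i - x) (f i - x))) l (𝓝 0) := by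
  have h1 : Tendsto (fun i => inner A (f i - x) (f i - x)) l (𝓝 0) := by
    refine squeeze_zero_norm (fun i => norm_inner_le (A := A) _ _) ?_
    have := (tendsto_sub_nhds_zero_iff.2 hf).norm
    simpa using this.mul this
  have := ((positiveCLM φ).continuous.tendsto 0).comp h1
  rwa [map_zero] at this

variable [WStarAlgebra A]

/-- The orthogonal complement of a `τ₁`- or `τ₂`-dense set is trivial. -/
lemma eq_zero_of_forall_inner_eq_zero {s : Set L}
    (hs : @Dense L (tau1 A L) s ∨ @Dense L (tau2 A L) s) {x : L} (hx : ∀ y ∈ s, inner A y x = 0) :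
    x = 0 := by
  refine HilbertModule.eq_zero_of_inner_self (A := A) x
    ((isPredual_predual A).eq_zero_of_forall_nonneg fun ψ hψ hp => ?_)
  let φ : A →ₚ[ℂ] ℂ := PositiveLinearMap.mk₀ (ψ : A →ₗ[ℂ] ℂ) hp
  have hφ : φ ∈ predualCone A := (isPredual_predual A).isNormalMap_of_mem (φ := φ) hψ
  change φ (inner A x x) = 0
  by_contra h0
  have hpos : 0 < ‖φ (inner A x x)‖ := norm_pos_iff.2 h0
  have hx' (y) (hy : y ∈ s) : inner A x y = 0 := by rw [← star_inner', hx y hy, star_zero]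
  -- For τ₁, Pythagoras keeps every y ∈ s at φ-distance at least φ⟨x | x⟩^{1/2} from x. For τ₂, the
  -- functional φ⟨x | ·⟩ vanishes on s but not at x.
  rcases hs with hs | hs
  · obtain ⟨y, hy, hys⟩ := @Dense.exists_mem_open _ (tau1 A L) s hs
      {z : L | √‖φ (inner A (z - x) (z - x))‖ < √‖φ (inner A x x)‖}
      (TopologicalSpace.GenerateOpen.basic _ ⟨φ, hφ, x, _, Real.sqrt_pos.2 hpos, rfl⟩)
      ⟨x, by simpa [inner_zero_left'] using h0⟩
    refine absurd hys (not_lt.2 (Real.sqrt_le_sqrt ?_))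
    have e : inner A (y - x) (y - x) = inner A y y + inner A x x := by
      rw [HilbertModule.inner_sub_left, HilbertModule.inner_sub_right,
        HilbertModule.inner_sub_right, hx y hy, hx' y hy]; abel
    rw [e]
    refine CStarAlgebra.norm_le_norm_of_nonneg_of_le (φ.map_nonneg (inner_self_nonneg x)) ?_
    rw [map_add]
    exact le_add_of_nonneg_left (φ.map_nonneg (inner_self_nonneg y))
  · obtain ⟨y, hy, hys⟩ := @Dense.exists_mem_open _ (tau2 A L) s hs
      {z : L | ‖φ (inner A x (z - x))‖ < ‖φ (inner A x x)‖}
      (TopologicalSpace.GenerateOpen.basic _ ⟨φ, hφ, x, x, _, hpos, rfl⟩)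
      ⟨x, by simpa [inner_zero_right'] using h0⟩
    simp [HilbertModule.inner_sub_right, hx' y hy] at hys

variable {M : Type*} [NormedAddCommGroup M] [NormedSpace ℂ M] [HilbertModule A M]

/-- The image of a norm dense set is dense in the self-dual completion, for every topology weaker
than `τ₁`. -/
lemma selfDualCompletion.dense_of_tendsto (t : TopologicalSpace (selfDualCompletion A M))
    (ht : ∀ (l : Filter M) (f : M → selfDualCompletion A M) (T : selfDualCompletion A M),
      (∀ φ ∈ predualCone A, Tendsto (fun i => φ (inner A (f i - T) (f i - T))) l (𝓝 0)) →
      Tendsto f l (𝓝 T)) {s : Set M} (hs : Dense s) {s' : Set (selfDualCompletion A M)}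
    (hss' : ∀ x ∈ s, embed A M x ∈ s') : Dense s' := by
  have h1 (m : M) : embed A M m ∈ closure s' := by
    have : (𝓝[s] m).NeBot := mem_closure_iff_nhdsWithin_neBot.1 (hs m)
    refine mem_closure_of_tendsto (b := 𝓝[s] m) (f := embed A M) (ht _ _ _ fun φ _ => ?_)
      (eventually_mem_nhdsWithin.mono hss')
    have := tendsto_apply_inner_sub (A := A) (tendsto_id.mono_left (nhdsWithin_le_nhds (a := m)
      (s := s))) φ
    refine this.congr fun x => ?_
    rw [← map_sub, inner_embed]
    rfl
  -- T is a limit of vectors of M, which lie in the closure of s' already. For order-normal φ this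
  -- needs `mem_of_isNormalMap`, the approximation being formulated for the predual.
  intro T
  rw [← closure_closure]
  refine mem_closure_of_tendsto (b := (approx T : Filter M)) (f := embed A M)
    (ht _ _ _ fun φ hφ => ?_) (.of_forall h1)
  exact tendsto_inner_embed_sub T (ψ := positiveCLM φ)
    ((isPredual_predual A).mem_of_isNormalMap φ hφ) fun a ha => φ.map_nonneg ha

end TauTopologies

/-! ### Self-dual dilations -/

section SelfDualDilation

open HilbertModule

namespace selfDualCompletion

variable {A B V G M : Type*} [CStarAlgebra A] [PartialOrder A] [StarOrderedRing A]
  [NormedAddCommGroup M] [NormedSpace ℂ M] [HilbertModule A M] [AddCommGroup V] [Module ℂ V]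
  [RightModule A V]

/-- The composition of an `A`-linear map with the canonical map to the self-dual completion. -/
noncomputable def embedComp (J : RightLinearMap A V M) :
    RightLinearMap A V (selfDualCompletion A M) where
  toLinearMap := (embed A M).toLinearMap ∘ₗ J.toLinearMap
  map_rsmul v a := (congrArg (embed A M) (J.map_rsmul v a)).trans ((embed A M).map_rsmul _ a)

lemma embedComp_apply (J : RightLinearMap A V M) (v : V) :
    embedComp J v = embed A M (J v) := rfl

variable [WStarAlgebra A]

/-- The extension of unitary representations to the self-dual completion. -/
noncomputable def extendUnitary [Group G] (Ut : G →* unitary (adjointable A M)) :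
    G →* unitary (adjointable A (selfDualCompletion A M)) where
  toFun g := ⟨extend A M (Ut g).1, Unitary.map_mem (extend A M) (Ut g).2⟩
  map_one' := Subtype.ext (by
    change extend A M (Ut 1).1 = 1
    rw [MonoidHom.map_one Ut, OneMemClass.coe_one, map_one])
  map_mul' g h := Subtype.ext (by
    change extend A M (Ut (g * h)).1 = extend A M (Ut g).1 * extend A M (Ut h).1
    rw [MonoidHom.map_mul Ut, Submonoid.coe_mul, map_mul])

lemma extendUnitary_apply [Group G] (Ut : G →* unitary (adjointable A M)) (g : G) :
    (extendUnitary Ut g).1 = extend A M (Ut g).1 := rfl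

variable [CStarAlgebra B] {π : B →⋆ₐ[ℂ] adjointable A M} {J : RightLinearMap A V M}

lemma dilates_extend {S : B →ₗ[ℂ] sesqForms A V} (h : Dilates S π J) :
    Dilates S ((extend A M).comp π) (embedComp J) := fun b v w => by
  rw [h, StarAlgHom.comp_apply, embedComp_apply, embedComp_apply, extend_embed, inner_embed]

lemma embed_mem_dilationSpan {x : M} (hx : x ∈ dilationSpan π J) :
    embed A M x ∈ dilationSpan ((extend A M).comp π) (embedComp J) := by
  induction hx using Submodule.span_induction with
  | mem x hx =>
    obtain ⟨b, v, rfl⟩ := hx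
    exact Submodule.subset_span ⟨b, v, (extend_embed (π b) (J v)).symm⟩
  | zero => rw [map_zero]; exact zero_mem _
  | add x y _ _ hx hy => rw [map_add]; exact add_mem hx hy
  | smul c x _ hx => rw [map_smul]; exact Submodule.smul_mem _ _ hx

lemma intertwines_extend [Group G] {β : G →* (B ≃⋆ₐ[ℂ] B)} {U : G →* rightGL A V}
    {Ut : G →* unitary (adjointable A M)} (h : Intertwines β U π J Ut) :
    Intertwines β U ((extend A M).comp π) (embedComp J) (extendUnitary Ut) where
  map_J g v := by
    rw [extendUnitary_apply, embedComp_apply, embedComp_apply, extend_embed, h.map_J]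
  map_π g b := by
    rw [extendUnitary_apply, StarAlgHom.comp_apply, StarAlgHom.comp_apply, ← map_mul, h.map_π,
      map_mul]

end selfDualCompletion

/-- Every covariant completely positive map has a self-dual covariant dilation. -/
theorem IsCovariantCP.exists_selfDual_dilation {A : Type u} {B : Type v} {V : Type w}
    [CStarAlgebra A] [WStarAlgebra A] [PartialOrder A] [StarOrderedRing A] [CStarAlgebra B]
    [AddCommGroup V] [Module ℂ V] [RightModule A V] {G : Type*} [Group G]
    {β : G →* (B ≃⋆ₐ[ℂ] B)} {U : G →* rightGL A V} {S : B →ₗ[ℂ] sesqForms A V}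
    (hS : IsCovariantCP β U S) :
    ∃ (L : Type (max u v w)) (_ : NormedAddCommGroup L) (_ : NormedSpace ℂ L)
      (_ : HilbertModule A L) (π : B →⋆ₐ[ℂ] adjointable A L) (J : RightLinearMap A V L)
      (Ut : G →* unitary (adjointable A L)),
      IsSelfDual A L ∧ Dilates S π J ∧
      @Dense L (tau1 A L) (dilationSpan π J) ∧ @Dense L (tau2 A L) (dilationSpan π J) ∧
      Intertwines β U π J Ut := by
  obtain ⟨M, _, _, _, π, J, Ut, hD, hd, hi⟩ := hS.exists_minimal_dilation
  exact ⟨selfDualCompletion A M, _, _, _, (selfDualCompletion.extend A M).comp π,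
    selfDualCompletion.embedComp J, selfDualCompletion.extendUnitary Ut,
    selfDualCompletion.isSelfDual, selfDualCompletion.dilates_extend hD,
    selfDualCompletion.dense_of_tendsto _ (fun _ _ _ h => tendsto_tau1 h) hd fun _ =>
      selfDualCompletion.embed_mem_dilationSpan,
    selfDualCompletion.dense_of_tendsto _ (fun _ _ _ h => tendsto_tau2 h) hd fun _ =>
      selfDualCompletion.embed_mem_dilationSpan,
    selfDualCompletion.intertwines_extend hi⟩

variable {A B V G L L' : Type*} [CStarAlgebra A] [WStarAlgebra A] [CStarAlgebra B]
  [AddCommGroup V] [Module ℂ V] [PartialOrder A] [StarOrderedRing A] [RightModule A V]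
  [Group G] {β : G →* (B ≃⋆ₐ[ℂ] B)} {U : G →* rightGL A V} {S : B →ₗ[ℂ] sesqForms A V}
  [NormedAddCommGroup L] [NormedSpace ℂ L] [HilbertModule A L]
  [NormedAddCommGroup L'] [NormedSpace ℂ L'] [HilbertModule A L']
  {π : B →⋆ₐ[ℂ] adjointable A L} {J : RightLinearMap A V L} {Ut : G →* unitary (adjointable A L)}
  {π' : B →⋆ₐ[ℂ] adjointable A L'} {J' : RightLinearMap A V L'}
  {Ut' : G →* unitary (adjointable A L')}

/-- The generating vectors of a dense span separate points. -/
lemma eq_zero_of_forall_inner_generator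
    (hd : @Dense L (tau1 A L) (dilationSpan π J) ∨ @Dense L (tau2 A L) (dilationSpan π J))
    {x : L} (hx : ∀ b v, inner A ((π b).1 (J v)) x = 0) : x = 0 := by
  refine eq_zero_of_forall_inner_eq_zero hd fun y hy => ?_
  induction hy using Submodule.span_induction with
  | mem z hz => obtain ⟨b, v, rfl⟩ := hz; exact hx b v
  | zero => exact inner_zero_left' x
  | add y z _ _ hy hz => rw [inner_add_left', hy, hz, add_zero]
  | smul c z _ hz => rw [inner_smul_left', hz, smul_zero]

/-- The norm-minimal dilation embeds into both modules with trivial orthogonal complement, so both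
are its self-dual completion. -/
theorem Dilates.exists_selfDual_equivalence (hS : IsCovariantCP β U S) (hL : IsSelfDual A L)
    (h : Dilates S π J)
    (hd : @Dense L (tau1 A L) (dilationSpan π J) ∨ @Dense L (tau2 A L) (dilationSpan π J))
    (hi : Intertwines β U π J Ut) (hL' : IsSelfDual A L') (h' : Dilates S π' J')
    (hd' : @Dense L' (tau1 A L') (dilationSpan π' J') ∨
      @Dense L' (tau2 A L') (dilationSpan π' J'))
    (hi' : Intertwines β U π' J' Ut') :
    ∃ W : HilbertUnitary A L L', IsEquivalence W π J Ut π' J' Ut' := by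
  obtain ⟨M, _, _, _, π₀, J₀, Ut₀, hD₀, hd₀, hi₀⟩ := hS.exists_minimal_dilation
  obtain ⟨j, hj, hji⟩ := hD₀.exists_isometry hd₀ h
  obtain ⟨j', hj', hji'⟩ := hD₀.exists_isometry hd₀ h'
  obtain ⟨W, hW⟩ := selfDualCompletion.exists_unitary hL j hji fun l hl =>
    eq_zero_of_forall_inner_generator hd fun b v => by rw [← hj, hl]
  obtain ⟨W', hW'⟩ := selfDualCompletion.exists_unitary hL' j' hji' fun l hl =>
    eq_zero_of_forall_inner_generator hd' fun b v => by rw [← hj', hl]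
  obtain ⟨W'', hW''⟩ := W.exists_comp_inverse W'
  refine ⟨W'', isEquivalence_of_map_generators hi hi'
    (fun x hx => eq_zero_of_forall_inner_generator hd' hx) _ fun b v => W'.bijective.1 ?_⟩
  exact (hW'' _).trans (by rw [← hj, ← hj', hW]; exact (hW' _).symm)

end SelfDualDilation

/-! ### The C⋆-algebra of adjointable operators -/

section AdjointableCStar

open HilbertModule Filter Topology

variable {A M : Type*} [NonUnitalCStarAlgebra A] [PartialOrder A] [StarOrderedRing A]
  [NormedAddCommGroup M] [NormedSpace ℂ M] [HilbertModule A M]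

namespace adjointable

instance : CStarRing (adjointable A M) where
  norm_mul_self_le T := by
    have h : ‖T.1‖ ≤ √‖(star T * T).1‖ := by
      refine ContinuousLinearMap.opNorm_le_bound _ (Real.sqrt_nonneg _) fun x => ?_
      refine le_of_sq_le_sq ?_ (by positivity)
      rw [mul_pow, Real.sq_sqrt (norm_nonneg _), norm_sq_eq A, inner_apply_left]
      refine (norm_inner_le _ _).trans ?_
      have := (star T * T).1.le_opNorm x
      calc ‖x‖ * ‖(star T).1 (T.1 x)‖ ≤ ‖x‖ * (‖(star T * T).1‖ * ‖x‖) := by gcongr; exact this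
        _ = _ := by ring
    have h2 := mul_self_le_mul_self (norm_nonneg T.1) h
    rw [Real.mul_self_sqrt (norm_nonneg (star T * T).1)] at h2
    exact h2

instance : StarModule ℂ (adjointable A M) where
  star_smul c T := star_eq_of_inner fun x y => by
    change inner A x (c • T.1 y) = inner A (star c • (star T).1 x) y
    rw [inner_smul_right', inner_smul_left', star_star, inner_apply_right]

/-- A norm limit of adjointable operators is adjointable because the adjoints form a Cauchy sequence
too. -/
instance : CompleteSpace (adjointable A M) := by
  have : CompleteSpace M := HilbertModule.complete (A := A)
  refine Metric.complete_of_cauchySeq_tendsto fun u hu => ?_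
  have hu' : CauchySeq fun n => star (u n) :=
    (starₗᵢ ℂ : adjointable A M ≃ₗᵢ⋆[ℂ] adjointable A M).isometry.uniformContinuous
      |>.comp_cauchySeq hu
  obtain ⟨T, hT⟩ := cauchySeq_tendsto_of_complete (uniformContinuous_subtype_val.comp_cauchySeq hu)
  obtain ⟨T', hT'⟩ := cauchySeq_tendsto_of_complete
    (uniformContinuous_subtype_val.comp_cauchySeq hu')
  have happ {f : ℕ → M →L[ℂ] M} {F : M →L[ℂ] M} (h : Tendsto f atTop (𝓝 F)) (x : M) :
      Tendsto (fun n => f n x) atTop (𝓝 (F x)) :=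
    ((ContinuousLinearMap.apply ℂ M x).continuous.tendsto F).comp h
  refine ⟨ofIsAdjointOf T T' fun x y => ?_, tendsto_subtype_rng.2 hT⟩
  refine tendsto_nhds_unique (((continuous_inner_right (A := A) x).tendsto _).comp (happ hT y)) ?_
  refine (((continuous_inner_left (A := A) y).tendsto _).comp (happ hT' x)).congr fun n => ?_
  exact (inner_apply_right (u n) x y).symm

noncomputable instance : CStarAlgebra (adjointable A M) where

end adjointable

/-- Self-adjoint elements are differences of orthogonal squares. -/
lemma IsSelfAdjoint.exists_eq_sub_sq {C : Type*} [CStarAlgebra C] {T : C} (hT : IsSelfAdjoint T) :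
    ∃ p n : C, IsSelfAdjoint p ∧ IsSelfAdjoint n ∧ T = p * p - n * n ∧ (p * p) * (n * n) = 0 := by
  let _ := CStarAlgebra.spectralOrder C
  have := CStarAlgebra.spectralOrderedRing C
  have hp := CFC.sqrt_mul_sqrt_self (T⁺) (CFC.posPart_nonneg T)
  have hn := CFC.sqrt_mul_sqrt_self (T⁻) (CFC.negPart_nonneg T)
  refine ⟨CFC.sqrt T⁺, CFC.sqrt T⁻, .of_nonneg (CFC.sqrt_nonneg _), .of_nonneg (CFC.sqrt_nonneg _),
    ?_, ?_⟩
  · rw [hp, hn, CFC.posPart_sub_negPart T hT]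
  · rw [hp, hn, CFC.posPart_mul_negPart]

/-- An operator with positive quadratic form is positive. -/
lemma adjointable.exists_eq_star_mul_self {T : adjointable A M} (hT : IsSelfAdjoint T)
    (h : ∀ x, 0 ≤ inner A x (T.1 x)) : ∃ R : adjointable A M, T = star R * R := by
  obtain ⟨p, n, hp, hn, hTpn, hpn⟩ := hT.exists_eq_sub_sq
  -- Evaluating the quadratic form of T at n²x gives -⟨n³x | n³x⟩, so positivity kills the negative
  -- part n².
  have h1 (x : M) : (n * n * n).1 x = 0 := by
    refine HilbertModule.eq_zero_of_inner_self (A := A) _ (le_antisymm ?_ (inner_self_nonneg _))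
    have h2 := h ((n * n).1 x)
    have e : (n * n) * T * (n * n) = -((n * n * n) * (n * n * n)) := by
      rw [hTpn, mul_sub, sub_mul, mul_assoc (n * n) (p * p), hpn, mul_zero, zero_sub]
      noncomm_ring
    have e1 : inner A ((n * n).1 x) (T.1 ((n * n).1 x)) =
        inner A x ((n * n * T * (n * n)).1 x) := by
      rw [inner_apply_left, star_mul, hn.star_eq]
      rfl
    have e2 : inner A ((n * n * n).1 x) ((n * n * n).1 x) =
        inner A x (((n * n * n) * (n * n * n)).1 x) := by
      rw [inner_apply_left, star_mul, star_mul, hn.star_eq, ← mul_assoc]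
      rfl
    rw [e1, e] at h2
    have e3 : inner A x ((-(n * n * n * (n * n * n))).1 x) =
        -inner A x ((n * n * n * (n * n * n)).1 x) :=
      map_neg (innerCLM A x) ((n * n * n * (n * n * n)).1 x)
    rw [e3] at h2
    rw [e2]
    exact neg_nonneg.1 h2
  have h3 : n * n * n = 0 := Subtype.ext (ContinuousLinearMap.ext h1)
  have h4 : n * n = 0 := by
    refine (CStarRing.star_mul_self_eq_zero_iff (n * n)).1 ?_
    rw [star_mul, hn.star_eq, ← mul_assoc, h3, zero_mul]
  exact ⟨p, by rw [hTpn, h4, sub_zero, hp.star_eq]⟩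

lemma adjointable.le_of_forall_inner_le {S T : adjointable A M} (hS : IsSelfAdjoint S)
    (hT : IsSelfAdjoint T) (h : ∀ x, inner A x (S.1 x) ≤ inner A x (T.1 x)) : S ≤ T :=
  exists_eq_star_mul_self (hT.sub hS) fun x => by
    have : inner A x ((T - S).1 x) = inner A x (T.1 x) - inner A x (S.1 x) :=
      map_sub (innerCLM A x) _ _
    rw [this]
    exact sub_nonneg.2 (h x)

lemma adjointable.inner_le_of_le {S T : adjointable A M} (h : S ≤ T) (x : M) :
    inner A x (S.1 x) ≤ inner A x (T.1 x) := by
  obtain ⟨R, hR⟩ := h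
  have e : inner A x ((T - S).1 x) = inner A x (T.1 x) - inner A x (S.1 x) :=
    map_sub (innerCLM A x) _ _
  rw [← sub_nonneg, ← e, hR]
  change 0 ≤ inner A x ((star R).1 (R.1 x))
  rw [← adjointable.inner_apply_left]
  exact inner_self_nonneg _

end AdjointableCStar

/-! ### Normality of dilations -/

section Normality

open Filter Topology HilbertModule

lemma tendsto_zero_of_sqrt_norm {ι : Type*} {l : Filter ι} {f : ι → ℂ}
    (h : Tendsto (fun i => √‖f i‖) l (𝓝 0)) : Tendsto f l (𝓝 0) := by
  refine tendsto_zero_iff_norm_tendsto_zero.2 ?_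
  have := h.pow 2
  simpa [Real.sq_sqrt (norm_nonneg _)] using this

/-- On a self-dual module over a W⋆-algebra, bounded families of operators have weak limits. -/
lemma IsSelfDual.exists_limit_operator {A L ι : Type*} [CStarAlgebra A] [WStarAlgebra A]
    [PartialOrder A] [StarOrderedRing A] [NormedAddCommGroup L] [NormedSpace ℂ L]
    [HilbertModule A L] (hL : IsSelfDual A L) (u : Ultrafilter ι) (P : ι → adjointable A L)
    (hP : ∀ᶠ i in (u : Filter ι), IsSelfAdjoint (P i)) {C : ℝ} (hC0 : 0 ≤ C)
    (hC : ∀ᶠ i in (u : Filter ι), ∀ x, ‖(P i).1 x‖ ≤ C * ‖x‖) :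
    ∃ T : adjointable A L, IsSelfAdjoint T ∧ ∀ x y,
      WeakTendsto (predual A) (u : Filter ι) (fun i => inner A x ((P i).1 y))
        (inner A x (T.1 y)) := by
  have hY := isPredual_predual A
  have hb (x y : L) : ∀ᶠ i in (u : Filter ι), ‖inner A x ((P i).1 y)‖ ≤ C * ‖x‖ * ‖y‖ :=
    hC.mono fun i hi => (norm_inner_le _ _).trans (by
      calc ‖x‖ * ‖(P i).1 y‖ ≤ ‖x‖ * (C * ‖y‖) := by gcongr; exact hi y
        _ = _ := by ring)
  have hq (x y : L) : ∃ a : A, ‖a‖ ≤ C * ‖x‖ * ‖y‖ ∧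
      WeakTendsto (predual A) (u : Filter ι) (fun i => inner A x ((P i).1 y)) a :=
    hY.exists_weakTendsto u (hb x y)
  choose q hqn hq using hq
  have huniq {x y : L} {a : A} (h : WeakTendsto (predual A) (u : Filter ι)
      (fun i => inner A x ((P i).1 y)) a) : q x y = a := (hq x y).unique hY h
  have hstar (x y : L) : star (q x y) = q y x := by
    refine (huniq ((hY.weakTendsto_star (hb x y) (hq x y)).congr' (hP.mono fun i hi => ?_))).symm
    dsimp only
    rw [star_inner', adjointable.inner_apply_left, hi.star_eq]
  have hadd (x y z : L) : q x (y + z) = q x y + q x z :=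
    huniq (((hq x y).add (hq x z)).congr' (.of_forall fun i => by
      dsimp only
      rw [map_add, inner_add_right']))
  have hsmul (c : ℂ) (x y : L) : q x (c • y) = c • q x y :=
    huniq (((hq x y).smul c).congr' (.of_forall fun i => by
      dsimp only
      rw [map_smul, inner_smul_right']))
  have hr (x y : L) (a : A) : q x (y <• a) = q x y * a :=
    huniq ((WeakTendsto.mul_right hY (hq x y) a).congr' (.of_forall fun i => by
      dsimp only
      rw [(P i).2.1, inner_rsmul_right]))
  -- The weak limits form a bounded `A`-valued form q; self-duality turns it into an operator, and
  -- its hermitian symmetry makes that operator linear and self-adjoint.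
  have hrep (x : L) : ∃ m : L, ∀ y, q x y = inner A m y :=
    hL (LinearMap.mkContinuous ⟨⟨q x, hadd x⟩, fun c => hsmul c x⟩ (C * ‖x‖) (hqn x))
      fun y a => hr x y a
  choose T hT using hrep
  have hTn (x : L) : ‖T x‖ ≤ C * ‖x‖ := by
    have h1 := hqn x (T x)
    rw [hT, ← norm_sq_eq A, sq] at h1
    rcases (norm_nonneg (T x)).eq_or_lt with h0 | h0
    · rw [← h0]; positivity
    · exact le_of_mul_le_mul_right h1 h0
  let T' : L →L[ℂ] L := LinearMap.mkContinuous
    { toFun := T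
      map_add' := fun x y => HilbertModule.ext_left (A := A) fun z => by
        rw [inner_add_left', ← hT, ← hT, ← hT, ← hstar, hadd, star_add, hstar, hstar]
      map_smul' := fun c x => HilbertModule.ext_left (A := A) fun z => by
        rw [RingHom.id_apply, inner_smul_left', ← hT, ← hT, ← hstar, hsmul, star_smul, hstar] }
    C hTn
  have hT' (x y : L) : inner A (T' x) y = q x y := (hT x y).symm
  have hadj : IsAdjointOf (A := A) T' T' := fun x y => by
    rw [hT', ← star_inner', hT', hstar]
  refine ⟨adjointable.ofIsAdjointOf T' T' hadj, adjointable.star_eq_of_inner hadj, fun x y => ?_⟩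
  have e : inner A x (T' y) = q x y := by rw [hadj, hT']
  change WeakTendsto _ _ _ (inner A x (T' y))
  rw [e]
  exact hq x y

variable {A B V G L : Type*} [CStarAlgebra A] [PartialOrder A] [StarOrderedRing A]
  [CStarAlgebra B] [NormedAddCommGroup L] [NormedSpace ℂ L] [HilbertModule A L]
  {π : B →⋆ₐ[ℂ] adjointable A L}

lemma norm_starAlgHom_apply_le (π : B →⋆ₐ[ℂ] adjointable A L) (b : B) (x : L) :
    ‖(π b).1 x‖ ≤ ‖b‖ * ‖x‖ :=
  ((π b).1.le_opNorm x).trans (mul_le_mul_of_nonneg_right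
    (NonUnitalStarAlgHom.norm_apply_le π b) (norm_nonneg x))

lemma inner_starAlgHom_sub (π : B →⋆ₐ[ℂ] adjointable A L) (b c : B) (x y : L) :
    inner A x ((π (b - c)).1 y) = inner A x ((π b).1 y) - inner A x ((π c).1 y) := by
  rw [map_sub]
  exact HilbertModule.inner_sub_right (A := A) _ _ _

section Approximation

variable [WStarAlgebra A] [AddCommGroup V] [Module ℂ V] [RightModule A V]
  {S : B →ₗ[ℂ] sesqForms A V} {J : RightLinearMap A V L} [Group G]
  {β : G →* (B ≃⋆ₐ[ℂ] B)} {U : G →* rightGL A V} {Ut : G →* unitary (adjointable A L)}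

/-- In a minimal self-dual dilation, vectors are `τ₁`-approximated by generating vectors. -/
lemma Dilates.exists_mem_dilationSpan (hS : IsCovariantCP β U S) (hL : IsSelfDual A L)
    (h : Dilates S π J)
    (hd : @Dense L (tau1 A L) (dilationSpan π J) ∨ @Dense L (tau2 A L) (dilationSpan π J))
    (hi : Intertwines β U π J Ut) {φ : A →ₚ[ℂ] ℂ} (hφ : φ ∈ predualCone A) (y : L) {ε : ℝ}
    (hε : 0 < ε) : ∃ z ∈ dilationSpan π J, √‖φ (inner A (y - z) (y - z))‖ < ε := by
  -- A span known only to be τ₂-dense gives no τ₁-approximation directly. The canonical self-dual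
  -- dilation has a τ₁-dense span, and the equivalence transports it.
  obtain ⟨L₀, _, _, _, π₀, J₀, Ut₀, hL₀, h₀, hd₀, -, hi₀⟩ := hS.exists_selfDual_dilation
  obtain ⟨W, hW⟩ := Dilates.exists_selfDual_equivalence hS hL₀ h₀ (.inl hd₀) hi₀ hL h hd hi
  obtain ⟨y₀, rfl⟩ := W.bijective.2 y
  obtain ⟨z₀, hz₀, hzy⟩ := @Dense.exists_mem_open _ (tau1 A L₀) _ hd₀
    {z : L₀ | √‖φ (inner A (z - y₀) (z - y₀))‖ < ε}
    (TopologicalSpace.GenerateOpen.basic _ ⟨φ, hφ, y₀, _, hε, rfl⟩)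
    ⟨y₀, by simpa [inner_zero_left'] using hε⟩
  refine ⟨W z₀, ?_, ?_⟩
  · clear hzy
    induction hz₀ using Submodule.span_induction with
    | mem z hz =>
      obtain ⟨b, v, rfl⟩ := hz
      rw [hW.map_π, hW.map_J]
      exact Submodule.subset_span ⟨b, v, rfl⟩
    | zero => rw [map_zero]; exact zero_mem _
    | add x y _ _ hx hy => rw [map_add]; exact add_mem hx hy
    | smul c x _ hx => rw [map_smul]; exact Submodule.smul_mem _ _ hx
  · have e : inner A (W y₀ - W z₀) (W y₀ - W z₀) = inner A (z₀ - y₀) (z₀ - y₀) := by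
      rw [← map_sub]
      refine (W.inner_map _ _).trans ?_
      simp only [HilbertModule.inner_sub_left, HilbertModule.inner_sub_right]
      abel
    change √‖φ (inner A (W y₀ - W z₀) (W y₀ - W z₀))‖ < ε
    rw [e]
    exact hzy

end Approximation

variable [PartialOrder B] [StarOrderedRing B]

lemma starAlgHom_le (π : B →⋆ₐ[ℂ] adjointable A L) {b c : B} (h : b ≤ c) : π b ≤ π c := by
  obtain ⟨r, hr⟩ := CStarAlgebra.nonneg_iff_eq_star_mul_self.1 (sub_nonneg.2 h)
  exact ⟨π r, by rw [← map_sub, hr, map_mul, map_star]⟩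

lemma inner_starAlgHom_mono (π : B →⋆ₐ[ℂ] adjointable A L) {b c : B} (h : b ≤ c) (x : L) :
    inner A x ((π b).1 x) ≤ inner A x ((π c).1 x) :=
  adjointable.inner_le_of_le (starAlgHom_le π h) x

lemma inner_starAlgHom_nonneg (π : B →⋆ₐ[ℂ] adjointable A L) {b : B} (h : 0 ≤ b) (x : L) :
    0 ≤ inner A x ((π b).1 x) := by
  have := inner_starAlgHom_mono π h x
  rw [map_zero] at this
  exact (inner_zero_right' (A := A) x).symm.trans_le this

lemma norm_apply_inner_starAlgHom_le (φ : A →ₚ[ℂ] ℂ) {b : B} (hb : 0 ≤ b) {K : ℝ}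
    (hK : ‖b‖ ≤ K) (x : L) : ‖φ (inner A x ((π b).1 x))‖ ≤ K * ‖φ (inner A x x)‖ := by
  have hK0 : 0 ≤ K := (norm_nonneg b).trans hK
  have h1 : b ≤ algebraMap ℂ B (K : ℂ) := by
    have := (CStarAlgebra.norm_le_iff_le_algebraMap b hK0).1 hK
    rwa [Algebra.algebraMap_eq_smul_one, ← Complex.coe_smul, ← Algebra.algebraMap_eq_smul_one]
      at this
  have h2 := inner_starAlgHom_mono π h1 x
  rw [AlgHomClass.commutes] at h2
  have e : inner A x ((algebraMap ℂ (adjointable A L) (K : ℂ)).1 x) = (K : ℂ) • inner A x x :=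
    inner_smul_right' (A := A) (K : ℂ) x x
  rw [e] at h2
  refine (CStarAlgebra.norm_le_norm_of_nonneg_of_le
    (φ.map_nonneg (inner_starAlgHom_nonneg π hb x)) (OrderHomClass.mono φ h2)).trans ?_
  rw [map_smul, norm_smul, Complex.norm_real, Real.norm_of_nonneg hK0]

/-- The triangle inequality for the seminorm `x ↦ √φ⟨x | π(b)x⟩`. -/
lemma sqrt_norm_apply_inner_starAlgHom_add_le (φ : A →ₚ[ℂ] ℂ) {b : B} (hb : 0 ≤ b) (x y : L) :
    √‖φ (inner A (x + y) ((π b).1 (x + y)))‖ ≤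
      √‖φ (inner A x ((π b).1 x))‖ + √‖φ (inner A y ((π b).1 y))‖ := by
  obtain ⟨r, rfl⟩ := CStarAlgebra.nonneg_iff_eq_star_mul_self.1 hb
  have e (z : L) : inner A z ((π (star r * r)).1 z) = inner A ((π r).1 z) ((π r).1 z) := by
    rw [map_mul, map_star, adjointable.inner_apply_left]; rfl
  rw [e, e, e, map_add]
  exact sqrt_norm_apply_inner_add_le φ _ _

variable [WStarAlgebra B] [AddCommGroup V] [Module ℂ V] [RightModule A V]
  {S : B →ₗ[ℂ] sesqForms A V} {J : RightLinearMap A V L}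

/-- Normality of the form at a vector, as normality of functionals on `B`. -/
lemma Dilates.tendsto_apply_generator (h : Dilates S π J) (hS : IsNormalCP S) {φ : A →ₚ[ℂ] ℂ}
    (hφ : φ ∈ predualCone A) {l : Filter B} {x : B}
    (hl : WeakTendsto (predual B) l id x) (b : B) (v : V) :
    Tendsto (fun d => φ (inner A ((π b).1 (J v)) ((π (x - d)).1 ((π b).1 (J v))))) l (𝓝 0) := by
  let f : B →ₗ[ℂ] ℂ :=
    { toFun := fun c => φ (S c v v)
      map_add' := fun c d => by
        rw [map_add S]
        exact map_add φ (S c v v) (S d v v)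
      map_smul' := fun r c => by
        rw [map_smul S]
        exact map_smul φ r (S c v v) }
  have hf (c : B) : f c = φ (S c v v) := rfl
  let ω : B →ₚ[ℂ] ℂ := PositiveLinearMap.mk₀ f fun c hc => by
    rw [hf, h]
    exact φ.map_nonneg (inner_starAlgHom_nonneg π hc _)
  have hω (c : B) : ω c = φ (S c v v) := rfl
  have hωn : IsNormalMap ω := by
    intro D hne hD hsa x hx
    have h1 := hS v D hne hD hsa x hx
    have h2 := hφ _ (hne.image _) ?_ ?_ _ h1
    · rwa [Set.image_image] at h2
    · rintro _ ⟨d, hd, rfl⟩ _ ⟨e, he, rfl⟩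
      obtain ⟨k, hk, hdk, hek⟩ := hD d hd e he
      refine ⟨_, ⟨k, hk, rfl⟩, ?_, ?_⟩ <;> dsimp only <;> rw [h, h]
      · exact inner_starAlgHom_mono π hdk _
      · exact inner_starAlgHom_mono π hek _
    · rintro _ ⟨d, hd, rfl⟩
      dsimp only
      rw [h, IsSelfAdjoint, star_inner', adjointable.inner_apply_left, ← map_star,
        (hsa d hd).star_eq]
  -- The quantity equals ω(b⋆(x - d)b) with ω = φ(S_·(v, v)), and the compression of ω by b is again
  -- in the predual.
  have hmem := (isPredual_predual B).conjFunctional_mem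
    ((isPredual_predual B).mem_of_isNormalMap ω hωn) b
  have e (d : B) : φ (inner A ((π b).1 (J v)) ((π (x - d)).1 ((π b).1 (J v)))) =
      conjFunctional b (positiveCLM ω) x - conjFunctional b (positiveCLM ω) d := by
    rw [← map_sub, conjFunctional_apply, positiveCLM_apply, hω, mul_assoc, ← h.inner_eq, map_mul]
    rfl
  have h2 := (hl _ hmem).const_sub (conjFunctional b (positiveCLM ω) x)
  rw [sub_self] at h2
  exact h2.congr fun d => (e d).symm

/-- Convergence passes from generators to sums because z ↦ φ⟨z | π(x - d)z⟩^{1/2} is a seminorm;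
this uses x - d ≥ 0. -/
lemma Dilates.tendsto_apply_dilationSpan (h : Dilates S π J) (hS : IsNormalCP S) {φ : A →ₚ[ℂ] ℂ}
    (hφ : φ ∈ predualCone A) {l : Filter B} {x : B} (hl : WeakTendsto (predual B) l id x)
    (hx : ∀ᶠ d in l, d ≤ x) {z : L} (hz : z ∈ dilationSpan π J) :
    Tendsto (fun d => φ (inner A z ((π (x - d)).1 z))) l (𝓝 0) := by
  induction hz using Submodule.span_induction with
  | mem z hz =>
    obtain ⟨b, v, rfl⟩ := hz
    exact h.tendsto_apply_generator hS hφ hl b v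
  | zero =>
    simp only [inner_zero_left', map_zero]
    exact tendsto_const_nhds
  | add y z _ _ hy hz =>
    have h1 : Tendsto (fun d => √‖φ (inner A (y + z) ((π (x - d)).1 (y + z)))‖) l (𝓝 0) := by
      refine squeeze_zero' (g := fun d => √‖φ (inner A y ((π (x - d)).1 y))‖ +
        √‖φ (inner A z ((π (x - d)).1 z))‖) (.of_forall fun d => Real.sqrt_nonneg _)
        (hx.mono fun d hd =>
          sqrt_norm_apply_inner_starAlgHom_add_le φ (sub_nonneg.2 hd) y z) ?_
      simpa using hy.norm.sqrt.add hz.norm.sqrt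
    exact tendsto_zero_of_sqrt_norm h1
  | smul c z _ hz =>
    have e (d : B) : φ (inner A (c • z) ((π (x - d)).1 (c • z))) =
        (star c * c) * φ (inner A z ((π (x - d)).1 z)) := by
      rw [map_smul, inner_smul_left', inner_smul_right', map_smul, map_smul, smul_eq_mul,
        smul_eq_mul, mul_assoc]
    simp only [e]
    simpa using hz.const_mul (star c * c)

variable [WStarAlgebra A]

/-- A completely positive map with normal dilation is normal. -/
theorem Dilates.isNormalCP (h : Dilates S π J) (hL : IsSelfDual A L) (hπ : IsNormalMap π) :
    IsNormalCP S := by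
  intro v D hne hD hsa x hx
  have hY := isPredual_predual A
  obtain ⟨u, hu, ⟨C, hC⟩, htail⟩ :=
    (isPredual_predual B).exists_ultrafilter_of_isLUB hne hD hx
  have hmem : ∀ᶠ d in (u : Filter B), d ∈ D := (htail _ hne.choose_spec).mono fun d hd => hd.1
  have hbd : ∀ᶠ d in (u : Filter B), ∀ y : L, ‖(π d).1 y‖ ≤ max C 0 * ‖y‖ := hC.mono fun d hd y =>
    (norm_starAlgHom_apply_le π d y).trans (by gcongr; exact hd.trans (le_max_left _ _))
  obtain ⟨T, hTsa, hT⟩ := hL.exists_limit_operator u π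
    (hmem.mono fun d hd => (hsa d hd).map π) (le_max_right C 0) hbd
  have hbd' (y : L) : ∀ᶠ d in (u : Filter B), ‖inner A y ((π d).1 y)‖ ≤ ‖y‖ * (max C 0 * ‖y‖) :=
    hbd.mono fun d hd => (norm_inner_le _ _).trans (by gcongr; exact hd y)
  -- The weak limit T of the π(d) lies above each of them, hence above π(x) by normality. At J v its
  -- form is the weak limit of S_d(v, v), so it lies below every upper bound of these.
  have hTub : T ∈ upperBounds (π '' D) := by
    rintro _ ⟨d, hd, rfl⟩
    refine adjointable.le_of_forall_inner_le ((hsa d hd).map π) hTsa fun y => ?_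
    exact hY.le_of_weakTendsto (C := ‖inner A y ((π d).1 y)‖) (.of_forall fun _ => le_rfl)
      (hbd' y) ((htail d hd).mono fun e he => inner_starAlgHom_mono π he.2 y)
      (WeakTendsto.const (ι := B) (l := (u : Filter B)) (inner A y ((π d).1 y))) (hT y y)
  have hle := adjointable.inner_le_of_le ((hπ D hne hD hsa x hx).2 hTub) (J v)
  refine ⟨?_, fun a ha => ?_⟩
  · rintro _ ⟨d, hd, rfl⟩
    dsimp only
    rw [h, h]
    exact inner_starAlgHom_mono π (hx.1 hd) (J v)
  · dsimp only
    rw [h]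
    refine hle.trans ?_
    refine hY.le_of_weakTendsto (hbd' (J v)) (C' := ‖a‖) (.of_forall fun _ => le_rfl)
      (hmem.mono fun d hd => ?_) (hT (J v) (J v)) (WeakTendsto.const a)
    have := ha ⟨d, hd, rfl⟩
    dsimp only at this
    rwa [h] at this

variable [Group G] {β : G →* (B ≃⋆ₐ[ℂ] B)} {U : G →* rightGL A V}
  {Ut : G →* unitary (adjointable A L)}

/-- The minimal self-dual dilation of a normal completely positive map is normal. -/
theorem Dilates.isNormalMap (hS : IsCovariantCP β U S) (hL : IsSelfDual A L) (h : Dilates S π J)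
    (hd : @Dense L (tau1 A L) (dilationSpan π J) ∨ @Dense L (tau2 A L) (dilationSpan π J))
    (hi : Intertwines β U π J Ut) (hN : IsNormalCP S) : IsNormalMap π := by
  intro D hne hD hsa x hx
  have hY := isPredual_predual A
  have hxsa : IsSelfAdjoint x := by
    obtain ⟨d, hd⟩ := hne
    have := (IsSelfAdjoint.of_nonneg (sub_nonneg.2 (hx.1 hd))).add (hsa d hd)
    rwa [sub_add_cancel] at this
  refine ⟨?_, fun T hT => ?_⟩
  · rintro _ ⟨d, hd, rfl⟩
    exact starAlgHom_le π (hx.1 hd)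
  obtain ⟨u, hu, ⟨C, hC⟩, htail⟩ :=
    (isPredual_predual B).exists_ultrafilter_of_isLUB hne hD hx
  have hmem : ∀ᶠ d in (u : Filter B), d ∈ D := (htail _ hne.choose_spec).mono fun d hd => hd.1
  have hdx : ∀ᶠ d in (u : Filter B), d ≤ x := hmem.mono fun d hd => hx.1 hd
  have hTsa : IsSelfAdjoint T := by
    obtain ⟨d, hd⟩ := hne
    obtain ⟨R, hR⟩ := hT ⟨d, hd, rfl⟩
    have := (IsSelfAdjoint.star_mul_self R).add ((hsa d hd).map π)
    rwa [← hR, sub_add_cancel] at this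
  -- Split y as z + (y - z) with z in the span. The second part is bounded by √K φ⟨y - z | y -
  -- z⟩^{1/2}, uniformly in d because ‖x - d‖ ≤ K.
  have hlim (φ : A →ₚ[ℂ] ℂ) (hφ : φ ∈ predualCone A) (y : L) :
      Tendsto (fun d => φ (inner A y ((π (x - d)).1 y))) (u : Filter B) (𝓝 0) := by
    refine tendsto_zero_of_sqrt_norm (Metric.tendsto_nhds.2 fun ε hε => ?_)
    set K := ‖x‖ + |C| + 1 with hK
    have hK0 : 0 < √K := Real.sqrt_pos.2 (by positivity)
    obtain ⟨z, hz, hzy⟩ := h.exists_mem_dilationSpan hS hL hd hi hφ y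
      (div_pos (half_pos hε) hK0)
    have h1 : Tendsto (fun d => √‖φ (inner A z ((π (x - d)).1 z))‖) (u : Filter B) (𝓝 0) := by
      simpa using (h.tendsto_apply_dilationSpan hN hφ hu hdx hz).norm.sqrt
    filter_upwards [h1.eventually_lt_const (half_pos hε), hdx, hC] with d h2 h3 h4
    have h5 := sqrt_norm_apply_inner_starAlgHom_add_le (π := π) φ (sub_nonneg.2 h3) z (y - z)
    have h6 : √‖φ (inner A (y - z) ((π (x - d)).1 (y - z)))‖ ≤
        √K * √‖φ (inner A (y - z) (y - z))‖ := by
      rw [← Real.sqrt_mul (by positivity)]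
      refine Real.sqrt_le_sqrt (norm_apply_inner_starAlgHom_le φ (sub_nonneg.2 h3) ?_ _)
      have := norm_sub_le x d
      have := le_abs_self C
      linarith
    rw [lt_div_iff₀ hK0, mul_comm] at hzy
    rw [add_sub_cancel] at h5
    rw [Real.dist_eq, sub_zero, abs_of_nonneg (Real.sqrt_nonneg _)]
    linarith
  refine adjointable.le_of_forall_inner_le (hxsa.map π) hTsa fun y => ?_
  have hsa' {P : adjointable A L} (hP : IsSelfAdjoint P) : IsSelfAdjoint (inner A y (P.1 y)) := by
    rw [IsSelfAdjoint, star_inner', adjointable.inner_apply_left, hP.star_eq]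
  rw [← sub_nonneg]
  -- Positive functionals of the predual test the inequality: φ⟨y | (T - π(d))y⟩ is nonnegative and
  -- converges to φ⟨y | (T - π(x))y⟩ by `hlim`.
  refine hY.nonneg_of_forall ((hsa' hTsa).sub (hsa' (hxsa.map π))) fun ψ hψ hp => ?_
  let φ : A →ₚ[ℂ] ℂ := PositiveLinearMap.mk₀ (ψ : A →ₗ[ℂ] ℂ) hp
  have h1 := (hlim φ (hY.isNormalMap_of_mem (φ := φ) hψ) y).const_add
    (φ (inner A y (T.1 y) - inner A y ((π x).1 y)))
  rw [add_zero] at h1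
  refine ge_of_tendsto h1 (hmem.mono fun d hd => ?_)
  rw [← map_add, inner_starAlgHom_sub, sub_add_sub_cancel]
  exact φ.map_nonneg (sub_nonneg.2 (adjointable.inner_le_of_le (hT ⟨d, hd, rfl⟩) y))

end Normality

theorem mainTheorem4
    {B : Type v} [CStarAlgebra B] [PartialOrder B] [StarOrderedRing B]
    {G : Type t} [Group G] (β : G →* (B ≃⋆ₐ[ℂ] B))
    {V : Type w} [AddCommGroup V] [Module ℂ V] :
    -- existence and uniqueness of the minimal covariant dilation over a C⋆-algebra `A`
    (∀ {A : Type u} [NonUnitalCStarAlgebra A] [PartialOrder A] [StarOrderedRing A]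
      [RightModule A V] (U : G →* rightGL A V) (S : B →ₗ[ℂ] sesqForms A V),
      IsCovariantCP β U S →
      (∃ (M : Type (max u v w)) (_ : NormedAddCommGroup M) (_ : NormedSpace ℂ M)
        (_ : HilbertModule A M) (π : B →⋆ₐ[ℂ] adjointable A M) (J : RightLinearMap A V M)
        (Ut : G →* unitary (adjointable A M)),
        Dilates S π J ∧ Dense (dilationSpan π J : Set M) ∧ Intertwines β U π J Ut) ∧
      (∀ {M : Type y} [NormedAddCommGroup M] [NormedSpace ℂ M] [HilbertModule A M]
        (π : B →⋆ₐ[ℂ] adjointable A M) (J : RightLinearMap A V M)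
        (Ut : G →* unitary (adjointable A M))
        {M' : Type z} [NormedAddCommGroup M'] [NormedSpace ℂ M'] [HilbertModule A M']
        (π' : B →⋆ₐ[ℂ] adjointable A M') (J' : RightLinearMap A V M')
        (Ut' : G →* unitary (adjointable A M')),
        Dilates S π J → Dense (dilationSpan π J : Set M) → Intertwines β U π J Ut →
        Dilates S π' J' → Dense (dilationSpan π' J' : Set M') → Intertwines β U π' J' Ut' →
        ∃ W : HilbertUnitary A M M', IsEquivalence W π J Ut π' J' Ut')) ∧
    -- the self-dual version over a W⋆-algebra `A`
    (∀ {A : Type u} [CStarAlgebra A] [WStarAlgebra A] [PartialOrder A] [StarOrderedRing A]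
      [RightModule A V] (U : G →* rightGL A V) (S : B →ₗ[ℂ] sesqForms A V),
      IsCovariantCP β U S →
      (∃ (L : Type (max u v w)) (_ : NormedAddCommGroup L) (_ : NormedSpace ℂ L)
        (_ : HilbertModule A L) (π : B →⋆ₐ[ℂ] adjointable A L) (J : RightLinearMap A V L)
        (Ut : G →* unitary (adjointable A L)),
        IsSelfDual A L ∧ Dilates S π J ∧
        @Dense L (tau1 A L) (dilationSpan π J) ∧ @Dense L (tau2 A L) (dilationSpan π J) ∧
        Intertwines β U π J Ut) ∧
      (∀ {L : Type y} [NormedAddCommGroup L] [NormedSpace ℂ L] [HilbertModule A L]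
        (π : B →⋆ₐ[ℂ] adjointable A L) (J : RightLinearMap A V L)
        (Ut : G →* unitary (adjointable A L))
        {L' : Type z} [NormedAddCommGroup L'] [NormedSpace ℂ L'] [HilbertModule A L']
        (π' : B →⋆ₐ[ℂ] adjointable A L') (J' : RightLinearMap A V L')
        (Ut' : G →* unitary (adjointable A L')),
        IsSelfDual A L → Dilates S π J →
        (@Dense L (tau1 A L) (dilationSpan π J) ∨ @Dense L (tau2 A L) (dilationSpan π J)) →
        Intertwines β U π J Ut →
        IsSelfDual A L' → Dilates S π' J' →
        (@Dense L' (tau1 A L') (dilationSpan π' J') ∨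
          @Dense L' (tau2 A L') (dilationSpan π' J')) →
        Intertwines β U π' J' Ut' →
        ∃ W : HilbertUnitary A L L', IsEquivalence W π J Ut π' J' Ut')) ∧
    -- normality, for W⋆-algebras `A` and `B`
    (∀ {A : Type u} [CStarAlgebra A] [WStarAlgebra A] [PartialOrder A] [StarOrderedRing A]
      [RightModule A V] (U : G →* rightGL A V) (S : B →ₗ[ℂ] sesqForms A V),
      WStarAlgebra B → IsCovariantCP β U S →
      ∀ {L : Type y} [NormedAddCommGroup L] [NormedSpace ℂ L] [HilbertModule A L]
        (π : B →⋆ₐ[ℂ] adjointable A L) (J : RightLinearMap A V L)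
        (Ut : G →* unitary (adjointable A L)),
        IsSelfDual A L → Dilates S π J →
        (@Dense L (tau1 A L) (dilationSpan π J) ∨ @Dense L (tau2 A L) (dilationSpan π J)) →
        Intertwines β U π J Ut →
        (IsNormalCP S ↔ IsNormalMap π)) ∧
    -- conversely, every covariant quadruple defines a covariant completely positive map
    (∀ {A : Type u} [NonUnitalCStarAlgebra A] [PartialOrder A] [StarOrderedRing A]
      [RightModule A V] (U : G →* rightGL A V)
      {M : Type y} [NormedAddCommGroup M] [NormedSpace ℂ M] [HilbertModule A M]
      (π : B →⋆ₐ[ℂ] adjointable A M) (J : RightLinearMap A V M)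
      (Ut : G →* unitary (adjointable A M)), Intertwines β U π J Ut →
      ∃ S : B →ₗ[ℂ] sesqForms A V, Dilates S π J ∧ IsCovariantCP β U S) := by
  refine ⟨fun U S hS => ⟨hS.exists_minimal_dilation,
      fun π J Ut M' _ _ _ π' J' Ut' h hd hi h' hd' hi' => h.exists_equivalence hd hi h' hd' hi'⟩,
    fun U S hS => ⟨hS.exists_selfDual_dilation, fun π J Ut L' _ _ _ π' J' Ut' hL h hd hi hL' h' hd'
      hi' => Dilates.exists_selfDual_equivalence hS hL h hd hi hL' h' hd' hi'⟩,
    fun U S _ hS L _ _ _ π J Ut hL h hd hi =>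
      ⟨fun hN => Dilates.isNormalMap hS hL h hd hi hN, fun hπ => h.isNormalCP hL hπ⟩,
    fun U M _ _ _ π J Ut hi => hi.exists_isCovariantCP⟩
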